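/- **Setting.** Let $A$ be a Hermitian negative semi-definite matrix on the space register of $d\,n_x$ qubits, let $f\in C^1([0,T])$ be vector valued, $T>0$, and let $u'(t)=Au(t)+f(t)$ on $[0,T]$ with $u(T)\neq 0$. In the main example this is the central difference discretisation of $\partial_t u=a\Delta u$ on a cube, where $f$ is made of the boundary values. Let $R>0$, $N_p=2^{n_p}$ with $n_p\ge1$, $p_k=-\pi R+2\pi Rk/N_p$, $\eta_k=(k-N_p/2)/R$ for $0\le k<N_p$, let $\Phi$ be the unitary discrete Fourier transform $\Phi_{jl}=N_p^{-1/2}e^{i\eta_l(p_j+\pi R)}$, and put $H=-A\otimes\mathrm{diag}(\eta_k)$, $e=[e^{-|p_k|}]_k$, $\tilde w(0)=(I\otimes\Phi^{-1})(u(0)\otimes e)$, $\tilde b(t)=(I\otimes\Phi^{-1})(f(t)\otimes e)$, $$\tilde w(T)=e^{iHT}\tilde w(0)+\int_0^Te^{iH(T-s)}\tilde b(s)\,ds,\qquad w(T)=(I\otimes\Phi)\tilde w(T),$$ $$C_e=\Big(\sum_k e^{-2|p_k|}\Big)^{1/2},\qquad C_{e0}=\Big(\sum_{p_k\ge0}e^{-2|p_k|}\Big)^{1/2}.$$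 Say that the $p$-mesh *resolves the problem to accuracy $\varepsilon$* if $\|\Pi_+\big(w(T)-u(T)\otimes e\big)\|\le\varepsilon\,C_{e0}\|u(T)\|$, where $\Pi_+$ keeps the components with $p_k\ge 0$. For a time register of $n_s$ qubits let $K=2^{n_s}$, $\Delta s=T/K$, $s_j=j\Delta s$ and $\|f\|_{avg}=\Delta s\sum_{j<K}\|f(s_j)\|$. For $C_{heat}\ge 0$, the oracles are unitaries such that: $O_H$ satisfies $\|O_H-e^{iH\Delta s}\|\le C_{heat}\Delta s^2$; $O_{prep}|0\rangle=|\tilde w(0)\rangle$; $O_b|j\rangle|0\rangle=|j\rangle|\tilde b(s_j)\rangle$; and $O_{coef}|0\rangle=\|\alpha\|_1^{-1/2}\sum_j\sqrt{\alpha_j}\,|j\rangle$ with $\alpha_j=\Delta s\|\tilde b(s_j)\|$ (nothing is required where the vector to be normalised vanishes). An algorithm is a finite sequence of fixed unitaries and of controlled queries to the oracles or their inverses, on the registers above and a work register, started in the all-zero state, followed by a measurement of a flag. **Theorem.** 1. There are absolute constants $c,C,p_0>0$ such that for all $d,n_x$ and all $n_p\ge 1$ there is an algorithm, including its choice of $n_s$,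 which is determined by the numbers $R$, $T$, $\delta$, $C_{heat}$, $\|u(0)\|$, $\|u(T)\|$, $S=\sup_{t\in[0,T]}\big(\tfrac{N_p}{2R}\|A\|\|f(t)\|+\|f'(t)\|\big)$ and $\|f\|_{avg}$ (as a function of $n_s$), and accesses $A,u(0),f$ only through the oracles, with the following property. Let $0<\delta\le1$, $\|u(0)\|+\int_0^T\|f(t)\|\,dt\ge1$, and let the $p$-mesh resolve the problem to accuracy $\delta/4$. Then, for all oracles as above, with probability at least $p_0$ the flag shows success, and then the normalised state is within $\delta$ of $|u(T)\rangle\otimes|g\rangle$ for some state $|g\rangle$ of the registers other than the space register. With $$\frac1{Pr}=\frac{C_e^3}{C_{e0}^2}\Big(\frac{\|u(0)\|+\|f\|_{avg}}{\|u(T)\|}\Big)^3,\qquad C_{LCU}=C_{heat}+\sup_{t\in[0,T]}\Big(\frac{N_p}{2R}\|A\|\|f(t)\|+\|f'(t)\|\Big),$$ the number $N_t$ of queries to $O_H$ satisfies $$c\,\frac1{Pr}\max\Big\{1,\frac{C_{LCU}T^2}{\delta}\Big\}\le N_t\le C\,\frac1{Pr}\max\Big\{1,\frac{C_{LCU}T^2}{\delta}\Big\},$$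 and the numbers of queries to $O_{prep}$, to $O_b$ and to $O_{coef}$ are each at most $$C\,\frac{C_e^2}{C_{e0}^2}\Big(\frac{\|u(0)\|+\|f\|_{avg}}{\|u(T)\|}\Big)^2.$$ 2. For every $A,u,f,T$ as above and every $\varepsilon>0$ there is $R_0>0$ such that for every $R\ge R_0$ the $p$-mesh resolves the problem to accuracy $\varepsilon$ for all sufficiently large $n_p$. 3. Let $n_x,n_p\ge1$ and $a,\Delta x,R>0$. The central difference equations for $\partial_tu=a\Delta u$ with $2^{n_x}$ interior nodes per direction and given values on the boundary have the form $u'=Au+f$ with $A=a\sum_{\alpha=1}^d(D)_\alpha$, $D=(S^+-2I+S^-)/\Delta x^2$, which is Hermitian and negative semi-definite, and $f$ the vector of boundary values times $a/\Delta x^2$. Here $S^\pm=\sum_{j=1}^{n_x}s_j^\pm$ are the shift operators, $s_j^-=I^{\otimes(n_x-j)}\otimes|0\rangle\langle1|\otimes(|1\rangle\langle0|)^{\otimes(j-1)}$, $s_j^+=(s_j^-)^\dagger$, and $(\cdot)_\alpha$ acts in the $\alpha$-th direction. With $\gamma_0=a/(\Delta x^2R)$, $V_0(\tau)=e^{-2i\gamma_0\tau}\prod_{j=1}^{n_x}e^{i\gamma_0\tau(s_j^-+s_j^+)}$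 and $V_{heat}(\tau)=\sum_k\big(\prod_\alpha(V_0(\tau))_\alpha\big)^{k-N_p/2}\otimes|k\rangle\langle k|$, the matrix $V_{heat}(-s)$ is unitary and $\|e^{isH}-V_{heat}(-s)\|\le C_{heat}s^2$ for all real $s$, where $C_{heat}=\tfrac14 dN_p(n_x-1)\gamma_0^2$; hence $V_{heat}(-\Delta s)$ can serve as $O_H$. -/

import Mathlib

open scoped Kronecker Matrix.Norms.L2Operator ComplexOrder

noncomputable section

namespace HeatLCU

/-! ### Registers and vectors -/

/-- Basis labels of the space register: `d` blocks of `nx` qubits, one block per coordinate. -/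
abbrev XReg (d nx : ℕ) : Type := Fin d → Fin (2 ^ nx)

/-- Basis labels of an `n`-qubit register. -/
abbrev QReg (n : ℕ) : Type := Fin (2 ^ n)

/-- The vector `M v`. -/
def act {m n : Type} [Fintype m] [Fintype n] [DecidableEq n]
    (M : Matrix m n ℂ) (v : EuclideanSpace ℂ n) : EuclideanSpace ℂ m :=
  Matrix.toEuclideanLin M v

/-- The computational basis vector `|i⟩`. -/
def ket {n : Type} [Fintype n] [DecidableEq n] (i : n) : EuclideanSpace ℂ n :=
  EuclideanSpace.single i 1

/-- The tensor product `v ⊗ q` of two vectors. -/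
def tens {m n : Type} [Fintype m] [Fintype n]
    (v : EuclideanSpace ℂ m) (q : EuclideanSpace ℂ n) : EuclideanSpace ℂ (m × n) :=
  WithLp.toLp 2 fun i => v i.1 * q i.2

/-- `y` solves `y' = A y + f` on `[0, T]` (one-sided derivatives at the end points). -/
def SolvesODE {X : Type} [Fintype X] [DecidableEq X] (A : Matrix X X ℂ)
    (f : ℝ → EuclideanSpace ℂ X) (T : ℝ) (y : ℝ → EuclideanSpace ℂ X) : Prop :=
  ∀ t ∈ Set.Icc (0 : ℝ) T, HasDerivWithinAt y (act A (y t) + f t) (Set.Icc 0 T) t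

/-! ### The auxiliary variable `p ∈ [-πR, πR]` and the Schrödingerised system -/

/-- The grid points `p_k = -πR + k Δp`, where `Δp = 2πR / N_p` and `N_p = 2 ^ np`. -/
def pGrid (np : ℕ) (R : ℝ) (k : QReg np) : ℝ :=
  -(Real.pi * R) + (k : ℕ) * (2 * Real.pi * R / 2 ^ np)

/-- The Fourier modes `η_k = (k - N_p / 2) / R`. -/
def eta (np : ℕ) (R : ℝ) (k : QReg np) : ℝ := (((k : ℕ) : ℝ) - 2 ^ np / 2) / R

/-- The vector `[e^{-|p_0|}, …, e^{-|p_{N_p - 1}|}]`. -/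
def expVec (np : ℕ) (R : ℝ) : EuclideanSpace ℂ (QReg np) :=
  WithLp.toLp 2 fun k => ((Real.exp (-|pGrid np R k|) : ℝ) : ℂ)

/-- The restriction of a vector on `X ⊗ p` to the labels `k` with `p_k ≥ 0`. -/
def restrictPos {X : Type} [Fintype X] (np : ℕ) (R : ℝ) (w : EuclideanSpace ℂ (X × QReg np)) :
    EuclideanSpace ℂ (X × QReg np) :=
  WithLp.toLp 2 fun i => if 0 ≤ pGrid np R i.2 then w i else 0

/-- `C_e = (∑_k e^{-2 |p_k|})^{1/2}`. -/
def Ce (np : ℕ) (R : ℝ) : ℝ := Real.sqrt (∑ k : QReg np, Real.exp (-2 * |pGrid np R k|))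

/-- `C_{e0} = (∑_{p_k ≥ 0} e^{-2 |p_k|})^{1/2}`. -/
def Ce0 (np : ℕ) (R : ℝ) : ℝ :=
  Real.sqrt (∑ k : QReg np, if 0 ≤ pGrid np R k then Real.exp (-2 * |pGrid np R k|) else 0)

/-- The unitary discrete Fourier transform `Φ_{jl} = N_p^{-1/2} e^{i η_l (p_j + πR)}`. -/
def dft (np : ℕ) (R : ℝ) : Matrix (QReg np) (QReg np) ℂ :=
  Matrix.of fun j l =>
    Complex.exp (Complex.I * ((eta np R l * (pGrid np R j + Real.pi * R) : ℝ) : ℂ)) /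
      ((Real.sqrt (2 ^ np) : ℝ) : ℂ)

/-- `I ⊗ Φ`. -/
def fourierX (X : Type) [DecidableEq X] (np : ℕ) (R : ℝ) :
    Matrix (X × QReg np) (X × QReg np) ℂ :=
  (1 : Matrix X X ℂ) ⊗ₖ dft np R

/-- The Hamiltonian `H = - A ⊗ D_η` of the Schrödingerised system (for Hermitian `A`). -/
def schrH {X : Type} (A : Matrix X X ℂ) (np : ℕ) (R : ℝ) :
    Matrix (X × QReg np) (X × QReg np) ℂ :=
  -(A ⊗ₖ Matrix.diagonal fun k => ((eta np R k : ℝ) : ℂ))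

/-- The unitary `e^{i s H}`. -/
def evolH {X : Type} [Fintype X] [DecidableEq X] (A : Matrix X X ℂ) (np : ℕ) (R s : ℝ) :
    Matrix (X × QReg np) (X × QReg np) ℂ :=
  NormedSpace.exp ((Complex.I * (s : ℂ)) • schrH A np R)

/-- `(I ⊗ Φ⁻¹) (v ⊗ [e^{-|p_k|}]_k)`.  With `v = u(0)` this is the initial value `w̃(0)`, with
`v = f(t)` it is the inhomogeneous term `b̃(t)`. -/
def lift {X : Type} [Fintype X] [DecidableEq X] (np : ℕ) (R : ℝ) (v : EuclideanSpace ℂ X) :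
    EuclideanSpace ℂ (X × QReg np) :=
  act (fourierX X np R).conjTranspose (tens v (expVec np R))

/-- The solution of `w̃' = i H w̃ + b̃`, `w̃(0) = (I ⊗ Φ⁻¹) w(0)`, at time `T`. -/
def wTilde {X : Type} [Fintype X] [DecidableEq X] (A : Matrix X X ℂ)
    (f : ℝ → EuclideanSpace ℂ X) (u₀ : EuclideanSpace ℂ X) (np : ℕ) (R T : ℝ) :
    EuclideanSpace ℂ (X × QReg np) :=
  act (evolH A np R T) (lift np R u₀) +
    ∫ s in (0 : ℝ)..T, act (evolH A np R (T - s)) (lift np R (f s))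

/-- The mesh of the auxiliary variable resolves the recovery relation
`u(T) = e^{p_k} w(T, p_k)`, `p_k ≥ 0`, to relative accuracy `ε`, where `w = (I ⊗ Φ) w̃`
is the exact solution of the discretised Schrödingerised system. -/
def Resolved {X : Type} [Fintype X] [DecidableEq X] (A : Matrix X X ℂ)
    (f u : ℝ → EuclideanSpace ℂ X) (np : ℕ) (R T ε : ℝ) : Prop :=
  ‖restrictPos np R (act (fourierX X np R) (wTilde A f (u 0) np R T)) -
      restrictPos np R (tens (u T) (expVec np R))‖ ≤ ε * (Ce0 np R * ‖u T‖)

/-! ### The quantities in the complexity bounds -/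

/-- `‖f‖_avg = Δs (‖f(s_0)‖ + ⋯ + ‖f(s_{K-1})‖)` with `K = 2 ^ ns`, `Δs = T / K`, `s_j = j Δs`. -/
def fAvg {X : Type} [Fintype X] (f : ℝ → EuclideanSpace ℂ X) (T : ℝ) (ns : ℕ) : ℝ :=
  T / 2 ^ ns * ∑ j : QReg ns, ‖f ((j : ℕ) * (T / 2 ^ ns))‖

/-- `sup_{t ∈ [0,T]} (N_p / (2R) ‖A‖ ‖f(t)‖ + ‖f'(t)‖)`, with the spectral norm of `A`. -/
def supTerm {X : Type} [Fintype X] [DecidableEq X] (A : Matrix X X ℂ)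
    (f : ℝ → EuclideanSpace ℂ X) (np : ℕ) (R T : ℝ) : ℝ :=
  ⨆ t : Set.Icc (0 : ℝ) T,
    (2 ^ np / (2 * R) * ‖A‖ * ‖f t‖ + ‖derivWithin f (Set.Icc 0 T) t‖)

/-- `C_LCU = C_heat + sup_{t ∈ [0,T]} (N_p / (2R) ‖A‖ ‖f(t)‖ + ‖f'(t)‖)`. -/
def CLCU {X : Type} [Fintype X] [DecidableEq X] (A : Matrix X X ℂ)
    (f : ℝ → EuclideanSpace ℂ X) (np : ℕ) (R T Cheat : ℝ) : ℝ :=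
  Cheat + supTerm A f np R T

/-- `1 / Pr = (C_e³ / C_{e0}²) ((‖u(0)‖ + ‖f‖_avg) / ‖u(T)‖)³`. -/
def invPr {X : Type} [Fintype X] (f u : ℝ → EuclideanSpace ℂ X) (np : ℕ) (R T : ℝ)
    (ns : ℕ) : ℝ :=
  Ce np R ^ 3 / Ce0 np R ^ 2 * ((‖u 0‖ + fAvg f T ns) / ‖u T‖) ^ 3

/-- `(1 / Pr) · max {1, C_LCU T² / δ}`. -/
def evolBound {X : Type} [Fintype X] [DecidableEq X] (A : Matrix X X ℂ)
    (f u : ℝ → EuclideanSpace ℂ X) (np : ℕ) (R T δ Cheat : ℝ) (ns : ℕ) : ℝ :=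
  invPr f u np R T ns * max 1 (CLCU A f np R T Cheat * T ^ 2 / δ)

/-- `(C_e² / C_{e0}²) ((‖u(0)‖ + ‖f‖_avg) / ‖u(T)‖)²`. -/
def stateBound {X : Type} [Fintype X] (f u : ℝ → EuclideanSpace ℂ X) (np : ℕ) (R T : ℝ)
    (ns : ℕ) : ℝ :=
  Ce np R ^ 2 / Ce0 np R ^ 2 * ((‖u 0‖ + fAvg f T ns) / ‖u T‖) ^ 2

/-! ### Oracles -/

/-- Black-box unitaries given to the algorithm.  The time register has `ns` qubits. -/
structure Oracles (d nx np ns : ℕ) where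
  /-- one-segment time evolution oracle `O_H` -/
  evol : Matrix.unitaryGroup (XReg d nx × QReg np) ℂ
  /-- state preparation oracle `O_prep` -/
  prep : Matrix.unitaryGroup (XReg d nx × QReg np) ℂ
  /-- source term input oracle `O_b` -/
  source : Matrix.unitaryGroup (QReg ns × (XReg d nx × QReg np)) ℂ
  /-- coefficient oracle `O_coef` -/
  coef : Matrix.unitaryGroup (QReg ns) ℂ

/-- The matrix `V` is a one-segment evolution: it approximates `e^{i s H}` in operator norm up
to `C_heat s²`. -/
def ApproxEvol {X : Type} [Fintype X] [DecidableEq X] (A : Matrix X X ℂ) (np : ℕ)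
    (R Cheat s : ℝ) (V : Matrix (X × QReg np) (X × QReg np) ℂ) : Prop :=
  ‖evolH A np R s - V‖ ≤ Cheat * s ^ 2

/-- The oracles encode the given problem.  A quantum state `|v⟩` means `v / ‖v‖`; the conditions
are multiplied by the norms, so that nothing is required where the vector vanishes.
* `O_H` approximates `e^{i H Δs}`, `Δs = T / K`, `K = 2 ^ ns`, up to `C_heat Δs²`;
* `O_prep |0⟩ = |w̃(0)⟩`;
* `O_b |j⟩|0⟩ = |j⟩|b̃(s_j)⟩`;
* `O_coef |0⟩ = ‖α‖₁^{-1/2} ∑_j √α_j |j⟩`, where `α_j = Δs ‖b̃(s_j)‖`. -/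
def Oracles.Encode {d nx np ns : ℕ} (O : Oracles d nx np ns)
    (A : Matrix (XReg d nx) (XReg d nx) ℂ) (f : ℝ → EuclideanSpace ℂ (XReg d nx))
    (u₀ : EuclideanSpace ℂ (XReg d nx)) (R T Cheat : ℝ) : Prop :=
  let Δs : ℝ := T / 2 ^ ns
  let b : QReg ns → EuclideanSpace ℂ (XReg d nx × QReg np) :=
    fun j => lift np R (f ((j : ℕ) * Δs))
  let α : QReg ns → ℝ := fun j => Δs * ‖b j‖
  ApproxEvol A np R Cheat Δs O.evol.1 ∧
  ((‖lift np R u₀‖ : ℝ) : ℂ) • act O.prep.1 (ket 0) = lift np R u₀ ∧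
  (∀ j, ((‖b j‖ : ℝ) : ℂ) • act O.source.1 (ket (j, 0)) = tens (ket j) (b j)) ∧
  ((Real.sqrt (∑ j, α j) : ℝ) : ℂ) • act O.coef.1 (ket 0) =
    WithLp.toLp 2 fun j => ((Real.sqrt (α j) : ℝ) : ℂ)

/-! ### Quantum query algorithms -/

/-- Basis labels of the whole memory: `nw` work qubits, the time register, and the registers
of `x` and `p`. -/
abbrev Mem (d nx np nw ns : ℕ) : Type :=
  QReg nw × (QReg ns × (XReg d nx × QReg np))

/-- One step of a circuit: a fixed (oracle-independent) unitary, or a query to an oracle or to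
its inverse, controlled by a Boolean function of the basis state of the remaining registers. -/
inductive Step (d nx np nw ns : ℕ) : Type
  | gate (G : Matrix.unitaryGroup (Mem d nx np nw ns) ℂ)
  | evol (inverse : Bool) (ctrl : QReg nw × QReg ns → Bool)
  | prep (inverse : Bool) (ctrl : QReg nw × QReg ns → Bool)
  | source (inverse : Bool) (ctrl : QReg nw → Bool)
  | coef (inverse : Bool) (ctrl : QReg nw × (XReg d nx × QReg np) → Bool)

/-- The controlled unitary `∑_{c : ctrl c} |c⟩⟨c| ⊗ U + ∑_{c : ¬ ctrl c} |c⟩⟨c| ⊗ I`, with `U`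
replaced by its adjoint if `inverse` holds. -/
def controlled {C Y : Type} [DecidableEq C] [DecidableEq Y] (inverse : Bool) (ctrl : C → Bool)
    (U : Matrix Y Y ℂ) : Matrix (C × Y) (C × Y) ℂ :=
  Matrix.of fun a b =>
    if a.1 = b.1 then
      (if ctrl a.1 then (if inverse then U.conjTranspose else U) else 1) a.2 b.2
    else 0

/-- Regrouping of the memory that brings the time register to the end. -/
def timeLast (d nx np nw ns : ℕ) :
    Mem d nx np nw ns → (QReg nw × (XReg d nx × QReg np)) × QReg ns :=
  fun i => ((i.1, i.2.2), i.2.1)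

/-- Regrouping of the memory that splits off the registers of `x` and `p`. -/
def spaceLast (d nx np nw ns : ℕ) :
    Mem d nx np nw ns → (QReg nw × QReg ns) × (XReg d nx × QReg np) :=
  fun i => ((i.1, i.2.1), i.2.2)

/-- The matrix of a step on the whole memory. -/
def Step.matrix {d nx np nw ns : ℕ} (O : Oracles d nx np ns) :
    Step d nx np nw ns → Matrix (Mem d nx np nw ns) (Mem d nx np nw ns) ℂ
  | .gate G => G.1
  | .evol inverse ctrl =>
      (controlled inverse ctrl O.evol.1).submatrix (spaceLast d nx np nw ns) (spaceLast d nx np nw ns)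
  | .prep inverse ctrl =>
      (controlled inverse ctrl O.prep.1).submatrix (spaceLast d nx np nw ns) (spaceLast d nx np nw ns)
  | .source inverse ctrl => controlled inverse ctrl O.source.1
  | .coef inverse ctrl =>
      (controlled inverse ctrl O.coef.1).submatrix (timeLast d nx np nw ns) (timeLast d nx np nw ns)

def Step.isEvol {d nx np nw ns : ℕ} : Step d nx np nw ns → Bool
  | .evol .. => true
  | _ => false

def Step.isPrep {d nx np nw ns : ℕ} : Step d nx np nw ns → Bool
  | .prep .. => true
  | _ => false

def Step.isSource {d nx np nw ns : ℕ} : Step d nx np nw ns → Bool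
  | .source .. => true
  | _ => false

def Step.isCoef {d nx np nw ns : ℕ} : Step d nx np nw ns → Bool
  | .coef .. => true
  | _ => false

/-- A quantum query algorithm: the sizes of its work and time registers, its list of steps (the
first one is executed first) and the work register outcomes that flag success. -/
structure Algorithm (d nx np : ℕ) where
  nw : ℕ
  ns : ℕ
  steps : List (Step d nx np nw ns)
  flag : QReg nw → Bool

namespace Algorithm

variable {d nx np : ℕ}

/-- Number of queries to `O_H` and its inverse. -/
def evolQueries (𝒜 : Algorithm d nx np) : ℕ := 𝒜.steps.countP Step.isEvol

/-- Number of queries to `O_prep` and its inverse. -/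
def prepQueries (𝒜 : Algorithm d nx np) : ℕ := 𝒜.steps.countP Step.isPrep

/-- Number of queries to `O_b` and its inverse. -/
def sourceQueries (𝒜 : Algorithm d nx np) : ℕ := 𝒜.steps.countP Step.isSource

/-- Number of queries to `O_coef` and its inverse. -/
def coefQueries (𝒜 : Algorithm d nx np) : ℕ := 𝒜.steps.countP Step.isCoef

/-- The state after all steps, when the memory starts in the all-zero state. -/
def finalState (𝒜 : Algorithm d nx np) (O : Oracles d nx np 𝒜.ns) :
    EuclideanSpace ℂ (Mem d nx np 𝒜.nw 𝒜.ns) :=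
  𝒜.steps.foldl (fun ψ s => act (s.matrix O) ψ) (ket 0)

/-- The unnormalised state after the flag has been measured with outcome success. -/
def successState (𝒜 : Algorithm d nx np) (O : Oracles d nx np 𝒜.ns) :
    EuclideanSpace ℂ (Mem d nx np 𝒜.nw 𝒜.ns) :=
  WithLp.toLp 2 fun i => if 𝒜.flag i.1 then 𝒜.finalState O i else 0

/-- The probability of measuring the flag with outcome success. -/
def successProb (𝒜 : Algorithm d nx np) (O : Oracles d nx np 𝒜.ns) : ℝ :=
  ‖𝒜.successState O‖ ^ 2

/-- The product state with `v` in the space register and `g` in all the other registers. -/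
def withSpace {nw ns : ℕ} (v : EuclideanSpace ℂ (XReg d nx))
    (g : EuclideanSpace ℂ (QReg nw × QReg ns × QReg np)) :
    EuclideanSpace ℂ (Mem d nx np nw ns) :=
  WithLp.toLp 2 fun i => v i.2.2.1 * g (i.1, i.2.1, i.2.2.2)

/-- With probability at least `p₀` the flag shows success, and then the space register holds a
`δ`-approximation of the quantum state `|v⟩ = v / ‖v‖`: the normalised state of the memory is
within `δ` of a product of `|v⟩` and some state of the other registers. -/
def Prepares (𝒜 : Algorithm d nx np) (O : Oracles d nx np 𝒜.ns)
    (v : EuclideanSpace ℂ (XReg d nx)) (δ p₀ : ℝ) : Prop :=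
  p₀ ≤ 𝒜.successProb O ∧
  ∃ g : EuclideanSpace ℂ (QReg 𝒜.nw × QReg 𝒜.ns × QReg np), ‖g‖ = 1 ∧
    ‖((‖𝒜.successState O‖⁻¹ : ℝ) : ℂ) • 𝒜.successState O -
      withSpace (((‖v‖⁻¹ : ℝ) : ℂ) • v) g‖ ≤ δ

end Algorithm

/-- The numbers that the algorithm may depend on (besides the sizes of the registers).  All other
information on `A`, `u(0)` and `f` reaches it through oracle queries only. -/
structure Inputs where
  R : ℝ
  T : ℝ
  δ : ℝ
  Cheat : ℝ
  /-- `‖u(0)‖` -/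
  normInit : ℝ
  /-- `‖u(T)‖` -/
  normFinal : ℝ
  /-- `sup_{t ∈ [0,T]} (N_p / (2R) ‖A‖ ‖f(t)‖ + ‖f'(t)‖)` -/
  sup : ℝ
  /-- `‖f‖_avg` for each possible number `K = 2 ^ ns` of nodes -/
  avg : ℕ → ℝ

/-- The input of the algorithm for a given problem. -/
def inputs {X : Type} [Fintype X] [DecidableEq X] (A : Matrix X X ℂ)
    (f u : ℝ → EuclideanSpace ℂ X) (np : ℕ) (R T δ Cheat : ℝ) : Inputs where
  R := R
  T := T
  δ := δ
  Cheat := Cheat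
  normInit := ‖u 0‖
  normFinal := ‖u T‖
  sup := supTerm A f np R T
  avg := fAvg f T

/-! ### The discrete heat equation and the evolution circuit -/

/-- The one-dimensional operator `(S⁺ - 2 I + S⁻) / Δx²` on `nx` qubits. -/
def laplace1 (nx : ℕ) (Δx : ℝ) : Matrix (QReg nx) (QReg nx) ℂ :=
  ((Δx ^ 2 : ℝ) : ℂ)⁻¹ • Matrix.of fun (x y : QReg nx) =>
    if x = y then (-2 : ℂ) else if (x : ℕ) = y + 1 ∨ (y : ℕ) = x + 1 then 1 else 0

/-- The coefficient matrix `a ∑_α (D)_α`, `D = (S⁺ - 2 I + S⁻) / Δx²`, where `(D)_α` acts on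
the `α`-th block of qubits, of the central difference discretisation of `∂_t u = a Δu`. -/
def heatMatrix (d nx : ℕ) (a Δx : ℝ) : Matrix (XReg d nx) (XReg d nx) ℂ :=
  (a : ℂ) • ∑ α : Fin d, Matrix.of fun x y =>
    if ∀ β, β ≠ α → x β = y β then laplace1 nx Δx (x α) (y α) else 0

/-- The grid node `j = (x_1 + 1, …, x_d + 1)` of an unknown.  Along each axis the nodes are
`0, …, N_x + 1` with `N_x = 2 ^ nx`, of which `0` and `N_x + 1` lie on the boundary. -/
def node {d nx : ℕ} (x : XReg d nx) : Fin d → ℕ := fun i => (x i : ℕ) + 1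

/-- The central difference equations for `∂_t u = a Δu` at the interior nodes, on `[0, T]`, for
a grid function `U` whose values on the boundary are the boundary data. -/
def SolvesHeatScheme {d : ℕ} (nx : ℕ) (a Δx T : ℝ) (U : ℝ → (Fin d → ℕ) → ℂ) : Prop :=
  ∀ x : XReg d nx, ∀ t ∈ Set.Icc (0 : ℝ) T,
    HasDerivWithinAt (fun s => U s (node x))
      ((a / Δx ^ 2 : ℝ) * ∑ k : Fin d,
        (U t (Function.update (node x) k (node x k - 1)) - 2 * U t (node x) +
          U t (Function.update (node x) k (node x k + 1))))
      (Set.Icc 0 T) t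

/-- The vector of unknowns of a grid function. -/
def interior {d : ℕ} (nx : ℕ) (U : ℝ → (Fin d → ℕ) → ℂ) (t : ℝ) :
    EuclideanSpace ℂ (XReg d nx) :=
  WithLp.toLp 2 fun x => U t (node x)

/-- The inhomogeneous term `(a / Δx²) ∑_k (u_{0,k} + u_{M,k})` made of the boundary values. -/
def boundarySource {d : ℕ} (nx : ℕ) (a Δx : ℝ) (U : ℝ → (Fin d → ℕ) → ℂ) (t : ℝ) :
    EuclideanSpace ℂ (XReg d nx) :=
  WithLp.toLp 2 fun x => ((a / Δx ^ 2 : ℝ) : ℂ) * ∑ k : Fin d,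
    ((if (x k : ℕ) = 0 then U t (Function.update (node x) k 0) else 0) +
      (if (x k : ℕ) + 1 = 2 ^ nx then U t (Function.update (node x) k (2 ^ nx + 1)) else 0))

/-- For `j < nx`, the summand `s_{j+1}⁻ + s_{j+1}⁺` of `S⁻ + S⁺`, where
`s_{j+1}⁻ = I^{⊗ (nx - j - 1)} ⊗ |0⟩⟨1| ⊗ (|1⟩⟨0|)^{⊗ j}`: it connects neighbours `x` and `x + 1`
such that the binary representation of `x + 1` ends in exactly `j` zeros. -/
def shiftTerm (nx j : ℕ) : Matrix (QReg nx) (QReg nx) ℂ :=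
  Matrix.of fun (x y : QReg nx) =>
    if ((x : ℕ) = y + 1 ∧ padicValNat 2 (x : ℕ) = j) ∨
      ((y : ℕ) = x + 1 ∧ padicValNat 2 (y : ℕ) = j)
    then 1 else 0

/-- The product formula `V_0(τ) = e^{-2iγ₀τ} ∏_j e^{iγ₀τ (s_j⁻ + s_j⁺)}`. -/
def V0 (nx : ℕ) (γ₀ τ : ℝ) : Matrix (QReg nx) (QReg nx) ℂ :=
  Complex.exp (-2 * Complex.I * ((γ₀ * τ : ℝ) : ℂ)) •
    (List.ofFn fun j : Fin nx =>
      NormedSpace.exp ((Complex.I * ((γ₀ * τ : ℝ) : ℂ)) • shiftTerm nx j)).prod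

/-- `∏_α (V_0(τ))_α = V_0(τ) ⊗ ⋯ ⊗ V_0(τ)`. -/
def V0Tensor (d nx : ℕ) (γ₀ τ : ℝ) : Matrix (XReg d nx) (XReg d nx) ℂ :=
  Matrix.of fun x y => ∏ α : Fin d, V0 nx γ₀ τ (x α) (y α)

/-- `γ₀ = a / (Δx² R)`. -/
def gamma0 (a Δx R : ℝ) : ℝ := a / (Δx ^ 2 * R)

/-- The evolution circuit
`V_heat(τ) = ∑_k (∏_α (V_0(τ))_α)^{k - N_p / 2} ⊗ |k⟩⟨k|`. -/
def Vheat (d nx np : ℕ) (a Δx R τ : ℝ) :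
    Matrix (XReg d nx × QReg np) (XReg d nx × QReg np) ℂ :=
  Matrix.of fun i j =>
    if i.2 = j.2 then
      (V0Tensor d nx (gamma0 a Δx R) τ ^ (((i.2 : ℕ) : ℤ) - 2 ^ (np - 1))) i.1 j.1
    else 0

/-- `C_heat = d N_p (n_x - 1) γ₀² / 4`. -/
def cHeat (d nx np : ℕ) (a Δx R : ℝ) : ℝ :=
  d * 2 ^ np * ((nx : ℝ) - 1) * gamma0 a Δx R ^ 2 / 4

end HeatLCU

end

set_option linter.unusedSectionVars false

noncomputable section

namespace HeatLCU

/-! ### Matrices acting on vectors -/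

section Act

variable {l m n : Type} [Fintype l] [Fintype m] [Fintype n] [DecidableEq m] [DecidableEq n]

/-! Recovery. `H` is diagonal in the Fourier label, so on an eigenvector of `A` with eigenvalue `-λ
≤ 0` the flow `e^{iHt}`, seen through `Φ`, translates the profile `e^{-|p|}` by `τ = λt`. On `p ≥ 0`
such a translation is multiplication by `e^{-τ}`, which is exactly how `e^{tA}` acts
(`recoveryDefect_eigenvector`). On the grid, a translation by whole mesh steps is a cyclic shift,
and the fractional remainder moves a vector no further than one whole step because all modes satisfy
`|η_k Δp| ≤ π` (`norm_transl_sub_le`). This leaves a mesh error and a wraparound error `e^{τ - πR}`,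
both times `√N_p`; since `√N_p` is at most a multiple of `√R C_{e0}` (`sqrt_le_Ce0`), taking first
`R` and then `n_p` large makes them small relative to `C_{e0}`. Variation of constants on both sides
(`recovery_eq`) passes from modes to the inhomogeneous problem.

Algorithm. Duhamel's integral is replaced by a left Riemann sum and `e^{iHΔs}` by `O_H`, which gives
`lcuSum`; both errors are of order `1/K` (`norm_wTilde_sub_lcuSum_le`). One circuit loads the
initial value and the sources in two branches of a work register, applies `O_H` exactly `K - j`
times to the time label `j`, and undoes the loading. The flagged component is then the restriction
of `lcuSum` to `p ≥ 0`, divided by `C_e (‖u(0)‖ + ‖f‖_avg)` (`flagPart_lcuSteps_of_encode`). Its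
norm is about `1/B`, where `B = C_e (‖u(0)‖ + ‖f‖_avg) / (C_{e0} ‖u(T)‖)`. Amplitude amplification
with about `B/8` rounds rescales this component to constant size and keeps its direction, so it does
not enlarge the error (`flagPart_amplify`).

Counts. The state oracles are queried a multiple of `B` times, and `B` is bounded below, so `B²`
bounds this. The two-sided bound for `O_H` is `B³ C_{e0} M` with `M = max {1, C_LCU T²/δ}`, so `K`
is taken of order `B² C_{e0} M`, which is also more than the order `B M` that accuracy needs. `B`
itself depends on `K` through `‖f‖_avg`; a preliminary coarse time grid determines it up to a factor
`3` and breaks the circle (`lcu_parameter_bounds`).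

Heat equation. The edges of the path are split by the 2-adic valuation of their right end point. All
classes but the first connect disjoint pairs and commute, so the product formula is a splitting into
odd and even edges only, and its error is governed by one commutator. Tensor products contribute a
factor `d`, powers a factor at most `N_p/2` (`approxEvol_Vheat`). -/

lemma act_apply (M : Matrix m n ℂ) (v : EuclideanSpace ℂ n) (i : m) :
    act M v i = ∑ j, M i j * v j := rfl

lemma act_mul (M : Matrix l m ℂ) (N : Matrix m n ℂ) (v : EuclideanSpace ℂ n) :
    act (M * N) v = act M (act N v) := by
  ext i
  have := congrFun (Matrix.mulVec_mulVec v.ofLp M N) i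
  exact this.symm

@[simp] lemma act_one (v : EuclideanSpace ℂ n) : act (1 : Matrix n n ℂ) v = v := by
  ext i
  simp [act_apply, Matrix.one_apply]

lemma act_add (M : Matrix m n ℂ) (v w : EuclideanSpace ℂ n) :
    act M (v + w) = act M v + act M w := map_add _ _ _

lemma act_sub (M : Matrix m n ℂ) (v w : EuclideanSpace ℂ n) :
    act M (v - w) = act M v - act M w := map_sub _ _ _

lemma act_smul (M : Matrix m n ℂ) (c : ℂ) (v : EuclideanSpace ℂ n) :
    act M (c • v) = c • act M v := map_smul _ _ _

lemma act_sum {ι : Type*} (M : Matrix m n ℂ) (s : Finset ι) (v : ι → EuclideanSpace ℂ n) :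
    act M (∑ i ∈ s, v i) = ∑ i ∈ s, act M (v i) := map_sum _ _ _

lemma add_act (M N : Matrix m n ℂ) (v : EuclideanSpace ℂ n) :
    act (M + N) v = act M v + act N v := by
  simp [act]

lemma sub_act (M N : Matrix m n ℂ) (v : EuclideanSpace ℂ n) :
    act (M - N) v = act M v - act N v := by
  simp [act]

lemma smul_act (c : ℂ) (M : Matrix m n ℂ) (v : EuclideanSpace ℂ n) :
    act (c • M) v = c • act M v := by
  simp [act]

lemma norm_act_le (M : Matrix m n ℂ) (v : EuclideanSpace ℂ n) : ‖act M v‖ ≤ ‖M‖ * ‖v‖ :=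
  M.l2_opNorm_mulVec v

lemma norm_le_of_act (M : Matrix n n ℂ) {c : ℝ} (hc : 0 ≤ c)
    (h : ∀ v, ‖act M v‖ ≤ c * ‖v‖) : ‖M‖ ≤ c := by
  rw [Matrix.cstar_norm_def]
  exact ContinuousLinearMap.opNorm_le_bound _ hc h

/-- `act` as a continuous linear map in the vector. -/
def actL (M : Matrix m n ℂ) : EuclideanSpace ℂ n →L[ℂ] EuclideanSpace ℂ m :=
  LinearMap.toContinuousLinearMap (Matrix.toEuclideanLin M)

@[simp] lemma actL_apply (M : Matrix m n ℂ) (v : EuclideanSpace ℂ n) : actL M v = act M v := rfl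

lemma act_star_mul_self {U : Matrix n n ℂ} (hU : U ∈ Matrix.unitaryGroup n ℂ)
    (v : EuclideanSpace ℂ n) : act U.conjTranspose (act U v) = v := by
  rw [← act_mul, ← Matrix.star_eq_conjTranspose, Unitary.star_mul_self_of_mem hU, act_one]

lemma act_self_mul_star {U : Matrix n n ℂ} (hU : U ∈ Matrix.unitaryGroup n ℂ)
    (v : EuclideanSpace ℂ n) : act U (act U.conjTranspose v) = v := by
  rw [← act_mul, ← Matrix.star_eq_conjTranspose, Unitary.mul_star_self_of_mem hU, act_one]

lemma norm_le_one_of_mem_unitary {U : Matrix n n ℂ} (hU : U ∈ Matrix.unitaryGroup n ℂ) :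
    ‖U‖ ≤ 1 := by
  rcases isEmpty_or_nonempty n with h | h
  · rw [Subsingleton.elim U 0, norm_zero]
    exact zero_le_one
  · exact (CStarRing.norm_of_mem_unitary hU).le

lemma conjTranspose_mem_unitary {U : Matrix n n ℂ} (hU : U ∈ Matrix.unitaryGroup n ℂ) :
    U.conjTranspose ∈ Matrix.unitaryGroup n ℂ := Unitary.star_mem hU

lemma norm_act_of_mem_unitary {U : Matrix n n ℂ} (hU : U ∈ Matrix.unitaryGroup n ℂ)
    (v : EuclideanSpace ℂ n) : ‖act U v‖ = ‖v‖ := by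
  have key : ∀ {W : Matrix n n ℂ}, W ∈ Matrix.unitaryGroup n ℂ → ∀ w, ‖act W w‖ ≤ ‖w‖ :=
    fun hW w => (norm_act_le _ _).trans
      (mul_le_of_le_one_left (norm_nonneg _) (norm_le_one_of_mem_unitary hW))
  refine le_antisymm (key hU v) ?_
  simpa [act_star_mul_self hU] using key (conjTranspose_mem_unitary hU) (act U v)

lemma inner_act_left (M : Matrix n n ℂ) (v w : EuclideanSpace ℂ n) :
    inner ℂ (act M v) w = inner ℂ v (act M.conjTranspose w) := by
  have h := ContinuousLinearMap.adjoint_inner_right (Matrix.toEuclideanCLM (n := n) (𝕜 := ℂ) M) v w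
  rw [← ContinuousLinearMap.star_eq_adjoint, ← map_star] at h
  exact h.symm

lemma tens_add_left (v w : EuclideanSpace ℂ m) (q : EuclideanSpace ℂ n) :
    tens (v + w) q = tens v q + tens w q := by
  ext i; simp [tens, add_mul]

lemma tens_smul_left (c : ℂ) (v : EuclideanSpace ℂ m) (q : EuclideanSpace ℂ n) :
    tens (c • v) q = c • tens v q := by
  ext i; simp [tens, mul_assoc]

lemma tens_smul_right (c : ℂ) (v : EuclideanSpace ℂ m) (q : EuclideanSpace ℂ n) :
    tens v (c • q) = c • tens v q := by
  ext i; simp [tens, mul_left_comm]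

lemma tens_sub_right (v : EuclideanSpace ℂ m) (q r : EuclideanSpace ℂ n) :
    tens v (q - r) = tens v q - tens v r := by
  ext i; simp [tens, mul_sub]

/-- The map `v ↦ v ⊗ q`. -/
def tensL (q : EuclideanSpace ℂ n) : EuclideanSpace ℂ m →L[ℂ] EuclideanSpace ℂ (m × n) :=
  LinearMap.toContinuousLinearMap
    { toFun := fun v => tens v q
      map_add' := fun v w => tens_add_left v w q
      map_smul' := fun c v => tens_smul_left c v q }

@[simp] lemma tensL_apply (q : EuclideanSpace ℂ n) (v : EuclideanSpace ℂ m) :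
    tensL q v = tens v q := rfl

lemma norm_tens (v : EuclideanSpace ℂ m) (q : EuclideanSpace ℂ n) :
    ‖tens v q‖ = ‖v‖ * ‖q‖ := by
  have h : ‖tens v q‖ ^ 2 = (‖v‖ * ‖q‖) ^ 2 := by
    rw [mul_pow, EuclideanSpace.norm_sq_eq, EuclideanSpace.norm_sq_eq, EuclideanSpace.norm_sq_eq,
      Finset.sum_mul_sum, Fintype.sum_prod_type]
    simp [tens, mul_pow]
  exact (sq_eq_sq₀ (norm_nonneg _) (by positivity)).1 h

lemma act_kronecker_tens (M : Matrix m m ℂ) (N : Matrix n n ℂ) (v : EuclideanSpace ℂ m)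
    (q : EuclideanSpace ℂ n) : act (M ⊗ₖ N) (tens v q) = tens (act M v) (act N q) := by
  ext i
  simp only [act_apply, tens, Matrix.kroneckerMap_apply, Fintype.sum_prod_type, Finset.sum_mul_sum]
  refine Finset.sum_congr rfl fun a _ => Finset.sum_congr rfl fun b _ => by ring

end Act

/-! ### Powers of unitaries and block diagonal matrices -/

section Unitary

variable {n o : Type} [Fintype n] [DecidableEq n] [Fintype o] [DecidableEq o]

/-- Telescoping: since all factors are contractions, errors of successive steps only add up. -/
lemma norm_pow_sub_pow_le {U V : Matrix n n ℂ} (hU : U ∈ Matrix.unitaryGroup n ℂ)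
    (hV : V ∈ Matrix.unitaryGroup n ℂ) (k : ℕ) : ‖U ^ k - V ^ k‖ ≤ k * ‖U - V‖ := by
  induction k with
  | zero => simp
  | succ k ih =>
    have e : U ^ (k + 1) - V ^ (k + 1) = U ^ k * (U - V) + (U ^ k - V ^ k) * V := by
      rw [pow_succ, pow_succ]; noncomm_ring
    rw [e]
    have h1 : ‖U ^ k * (U - V)‖ ≤ ‖U - V‖ := (norm_mul_le _ _).trans
      (mul_le_of_le_one_left (norm_nonneg _) (norm_le_one_of_mem_unitary (pow_mem hU k)))
    have h2 : ‖(U ^ k - V ^ k) * V‖ ≤ ‖U ^ k - V ^ k‖ := (norm_mul_le _ _).trans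
      (mul_le_of_le_one_right (norm_nonneg _) (norm_le_one_of_mem_unitary hV))
    calc _ ≤ _ := norm_add_le _ _
      _ ≤ ‖U - V‖ + k * ‖U - V‖ := add_le_add h1 (h2.trans ih)
      _ = _ := by push_cast; ring

lemma inv_eq_star_of_mem_unitary {U : Matrix n n ℂ} (hU : U ∈ Matrix.unitaryGroup n ℂ) :
    U⁻¹ = star U := Matrix.inv_eq_left_inv (Unitary.star_mul_self_of_mem hU)

lemma zpow_mem_unitary {U : Matrix n n ℂ} (hU : U ∈ Matrix.unitaryGroup n ℂ) (z : ℤ) :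
    U ^ z ∈ Matrix.unitaryGroup n ℂ := by
  cases z with
  | ofNat k => simpa using pow_mem hU k
  | negSucc k =>
    rw [zpow_negSucc, inv_eq_star_of_mem_unitary (pow_mem hU _)]
    exact Unitary.star_mem (pow_mem hU _)

/-- Negative powers of unitaries are adjoints of positive ones, and the adjoint preserves the norm.
-/
lemma norm_zpow_sub_zpow_le {U V : Matrix n n ℂ} (hU : U ∈ Matrix.unitaryGroup n ℂ)
    (hV : V ∈ Matrix.unitaryGroup n ℂ) (z : ℤ) : ‖U ^ z - V ^ z‖ ≤ |(z : ℝ)| * ‖U - V‖ := by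
  cases z with
  | ofNat k => simpa using norm_pow_sub_pow_le hU hV k
  | negSucc k =>
    rw [zpow_negSucc, zpow_negSucc, inv_eq_star_of_mem_unitary (pow_mem hU _),
      inv_eq_star_of_mem_unitary (pow_mem hV _), ← star_sub, norm_star]
    refine (norm_pow_sub_pow_le hU hV (k + 1)).trans_eq ?_
    have h : |((Int.negSucc k : ℤ) : ℝ)| = ((k + 1 : ℕ) : ℝ) := by
      rw [Int.cast_negSucc, abs_neg]; exact abs_of_nonneg (Nat.cast_nonneg _)
    rw [h]

lemma blockDiagonal_mem_unitary {M : o → Matrix n n ℂ}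
    (h : ∀ k, M k ∈ Matrix.unitaryGroup n ℂ) :
    Matrix.blockDiagonal M ∈ Matrix.unitaryGroup (n × o) ℂ := by
  rw [Matrix.mem_unitaryGroup_iff, Matrix.star_eq_conjTranspose, Matrix.blockDiagonal_conjTranspose,
    ← Matrix.blockDiagonal_mul]
  have : (fun k => M k * (M k).conjTranspose) = fun _ => (1 : Matrix n n ℂ) := by
    funext k; exact Unitary.mul_star_self_of_mem (h k)
  rw [this]
  exact Matrix.blockDiagonal_one

/-- The blocks act on mutually orthogonal slices `v (·, k)`, so the squared bounds add by
Pythagoras. -/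
lemma norm_blockDiagonal_le {M : o → Matrix n n ℂ} {c : ℝ} (hc : 0 ≤ c) (h : ∀ k, ‖M k‖ ≤ c) :
    ‖Matrix.blockDiagonal M‖ ≤ c := by
  refine norm_le_of_act _ hc fun v => ?_
  have hs : ∀ k : o, ∑ i, ‖act (Matrix.blockDiagonal M) v (i, k)‖ ^ 2 ≤
      c ^ 2 * ∑ i, ‖v (i, k)‖ ^ 2 := by
    intro k
    have e : ∀ i, act (Matrix.blockDiagonal M) v (i, k) =
        act (M k) (WithLp.toLp 2 fun j => v (j, k)) i := by
      intro i
      simp [act_apply, Matrix.blockDiagonal_apply, Fintype.sum_prod_type]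
    simp only [e]
    have h1 := norm_act_le (M k) (WithLp.toLp 2 fun j => v (j, k))
    have h2 : ‖act (M k) (WithLp.toLp 2 fun j => v (j, k))‖ ^ 2 ≤
        (c * ‖(WithLp.toLp 2 fun j => v (j, k) : EuclideanSpace ℂ n)‖) ^ 2 :=
      pow_le_pow_left₀ (norm_nonneg _)
        (h1.trans (mul_le_mul_of_nonneg_right (h k) (norm_nonneg _))) 2
    rwa [mul_pow, EuclideanSpace.norm_sq_eq, EuclideanSpace.norm_sq_eq] at h2
  refine (sq_le_sq₀ (norm_nonneg _) (by positivity)).1 ?_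
  rw [mul_pow, EuclideanSpace.norm_sq_eq, EuclideanSpace.norm_sq_eq, Fintype.sum_prod_type_right,
    Fintype.sum_prod_type_right, Finset.mul_sum]
  exact Finset.sum_le_sum fun k _ => hs k

end Unitary

/-! ### The evolution of the Schrödingerised system -/

section Evol

variable {X : Type} [Fintype X] [DecidableEq X]

lemma exp_smul_hermitian_mem_unitary {H : Matrix X X ℂ} (hH : H.IsHermitian) (s : ℝ) :
    NormedSpace.exp ((Complex.I * (s : ℂ)) • H) ∈ Matrix.unitaryGroup X ℂ := by
  let +nondep : NormedAlgebra ℚ (Matrix X X ℂ) := .restrictScalars ℚ ℂ _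
  apply NormedSpace.exp_mem_unitary_of_mem_skewAdjoint
  rw [skewAdjoint.mem_iff, star_smul, Matrix.star_eq_conjTranspose, hH.eq]
  simp

lemma exp_blockDiagonal_apply {o : Type} [Fintype o] [DecidableEq o] (M : o → Matrix X X ℂ) :
    NormedSpace.exp (Matrix.blockDiagonal M) =
      Matrix.blockDiagonal fun k => NormedSpace.exp (M k) := by
  let +nondep : NormedAlgebra ℚ (Matrix X X ℂ) := .restrictScalars ℚ ℂ _
  rw [Matrix.exp_blockDiagonal, Pi.exp_def]

/-- The flow decouples into one exponential of `A` for each Fourier mode; both the recovery analysis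
and the heat circuit start from this form. -/
lemma evolH_eq_blockDiagonal (A : Matrix X X ℂ) (np : ℕ) (R s : ℝ) :
    evolH A np R s = Matrix.blockDiagonal fun k =>
      NormedSpace.exp ((Complex.I * ((-(s * eta np R k) : ℝ) : ℂ)) • A) := by
  rw [evolH, ← exp_blockDiagonal_apply]
  congr 1
  ext i j
  simp only [schrH, Matrix.smul_apply, Matrix.neg_apply, Matrix.kroneckerMap_apply,
    Matrix.diagonal_apply, Matrix.blockDiagonal_apply]
  split_ifs <;> simp
  ring

lemma schrH_isHermitian {A : Matrix X X ℂ} (hA : A.IsHermitian) (np : ℕ) (R : ℝ) :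
    (schrH A np R).IsHermitian := by
  ext i j
  have h := congrFun (congrFun hA.eq i.1) j.1
  simp only [Matrix.conjTranspose_apply] at h
  simp only [schrH, Matrix.conjTranspose_apply, Matrix.neg_apply, Matrix.kroneckerMap_apply,
    Matrix.diagonal_apply]
  rw [star_neg, star_mul', h]
  by_cases e : i.2 = j.2
  · rw [e]; simp
  · simp [e, Ne.symm e]

lemma evolH_mem_unitary {A : Matrix X X ℂ} (hA : A.IsHermitian) (np : ℕ) (R s : ℝ) :
    evolH A np R s ∈ Matrix.unitaryGroup (X × QReg np) ℂ :=
  exp_smul_hermitian_mem_unitary (schrH_isHermitian hA np R) s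

lemma evolH_nat_mul (A : Matrix X X ℂ) (np : ℕ) (R s : ℝ) (k : ℕ) :
    evolH A np R (k * s) = evolH A np R s ^ k := by
  rw [evolH, evolH, ← Matrix.exp_nsmul]
  congr 1
  rw [← Nat.cast_smul_eq_nsmul ℂ, smul_smul]
  congr 1
  push_cast
  ring

lemma hasDerivAt_evolH (A : Matrix X X ℂ) (np : ℕ) (R s : ℝ) :
    HasDerivAt (fun s => evolH A np R s) (evolH A np R s * (Complex.I • schrH A np R)) s := by
  have h := hasDerivAt_exp_smul_const (𝕂 := ℝ) (Complex.I • schrH A np R) s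
  have e : ∀ t : ℝ, evolH A np R t = NormedSpace.exp (t • Complex.I • schrH A np R) := by
    intro t
    rw [evolH, mul_comm, ← smul_smul, Complex.coe_smul]
  simp only [e]
  exact h

lemma continuous_evolH (A : Matrix X X ℂ) (np : ℕ) (R : ℝ) :
    Continuous fun s => evolH A np R s :=
  continuous_iff_continuousAt.2 fun s => (hasDerivAt_evolH A np R s).continuousAt

end Evol

/-! ### Operators on the blocks of the space register -/

section Tensor

variable {d : ℕ} {ι : Type} [Fintype ι] [DecidableEq ι]

/-- The tensor product `⨂_α M_α`. -/
def tensorPi (M : Fin d → Matrix ι ι ℂ) : Matrix (Fin d → ι) (Fin d → ι) ℂ :=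
  Matrix.of fun x y => ∏ α, M α (x α) (y α)

lemma tensorPi_mul (M N : Fin d → Matrix ι ι ℂ) :
    tensorPi M * tensorPi N = tensorPi fun α => M α * N α := by
  ext x y
  simp only [tensorPi, Matrix.mul_apply, Matrix.of_apply, ← Finset.prod_mul_distrib]
  rw [Finset.prod_univ_sum]
  simp

lemma tensorPi_one : tensorPi (fun _ : Fin d => (1 : Matrix ι ι ℂ)) = 1 := by
  ext x y
  simp only [tensorPi, Matrix.of_apply, Matrix.one_apply, Finset.prod_boole]
  simp [funext_iff]

lemma star_tensorPi (M : Fin d → Matrix ι ι ℂ) :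
    star (tensorPi M) = tensorPi fun α => star (M α) := by
  ext x y
  simp [tensorPi, Matrix.star_apply]

lemma tensorPi_mem_unitary {M : Fin d → Matrix ι ι ℂ}
    (h : ∀ α, M α ∈ Matrix.unitaryGroup ι ℂ) :
    tensorPi M ∈ Matrix.unitaryGroup (Fin d → ι) ℂ := by
  rw [Matrix.mem_unitaryGroup_iff, star_tensorPi, tensorPi_mul]
  simp only [fun α => Unitary.mul_star_self_of_mem (h α)]
  exact tensorPi_one

/-- `(M)_α`: the matrix `M` acting on block `α`. -/
def onAxis (α : Fin d) (M : Matrix ι ι ℂ) : Matrix (Fin d → ι) (Fin d → ι) ℂ :=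
  Matrix.of fun x y => if ∀ β, β ≠ α → x β = y β then M (x α) (y α) else 0

/-- Reduces the algebra of one-block operators to the factorwise product rule `tensorPi_mul`. -/
lemma onAxis_eq_tensorPi (α : Fin d) (M : Matrix ι ι ℂ) :
    onAxis α M = tensorPi (Function.update (fun _ => 1) α M) := by
  ext x y
  simp only [onAxis, tensorPi, Matrix.of_apply]
  rw [← Finset.mul_prod_erase Finset.univ _ (Finset.mem_univ α), Function.update_self]
  have h : ∏ β ∈ Finset.univ.erase α, Function.update (fun _ => (1 : Matrix ι ι ℂ)) α M β (x β) (y β)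
      = if ∀ β, β ≠ α → x β = y β then 1 else 0 := by
    rw [Finset.prod_congr rfl (g := fun β => if x β = y β then (1 : ℂ) else 0)]
    · rw [Finset.prod_boole]; simp
    · intro β hβ
      rw [Function.update_of_ne (Finset.ne_of_mem_erase hβ), Matrix.one_apply]
  rw [h]
  split_ifs <;> simp

lemma onAxis_mul (α : Fin d) (M N : Matrix ι ι ℂ) :
    onAxis α (M * N) = onAxis α M * onAxis α N := by
  simp only [onAxis_eq_tensorPi, tensorPi_mul]
  congr 1
  funext β
  by_cases h : β = α
  · subst h; simp
  · simp [h]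

lemma onAxis_one (α : Fin d) : onAxis α (1 : Matrix ι ι ℂ) = 1 := by
  rw [onAxis_eq_tensorPi, ← tensorPi_one]
  congr 1
  exact Function.update_eq_self α (fun _ => (1 : Matrix ι ι ℂ))

/-- `M ↦ (M)_α` as a homomorphism of star algebras. -/
def onAxisHom (α : Fin d) : Matrix ι ι ℂ →⋆ₐ[ℂ] Matrix (Fin d → ι) (Fin d → ι) ℂ where
  toFun := onAxis α
  map_one' := onAxis_one α
  map_mul' := onAxis_mul α
  map_zero' := by ext x y; simp [onAxis]
  map_add' M N := by
    ext x y
    simp only [onAxis, Matrix.of_apply, Matrix.add_apply]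
    split_ifs <;> simp
  commutes' c := by
    have h : onAxis α (c • (1 : Matrix ι ι ℂ)) = c • onAxis α (1 : Matrix ι ι ℂ) := by
      ext x y
      simp [onAxis]
    rw [Algebra.algebraMap_eq_smul_one, Algebra.algebraMap_eq_smul_one, h, onAxis_one]
  map_star' M := by
    rw [onAxis_eq_tensorPi, onAxis_eq_tensorPi, star_tensorPi]
    congr 1
    funext β
    by_cases h : β = α
    · subst h; simp
    · simp [h]

@[simp] lemma onAxisHom_apply (α : Fin d) (M : Matrix ι ι ℂ) : onAxisHom α M = onAxis α M := rfl

/-- Homomorphisms of C⋆-algebras are contractive. -/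
lemma norm_onAxis_le (α : Fin d) (M : Matrix ι ι ℂ) : ‖onAxis α M‖ ≤ ‖M‖ :=
  NonUnitalStarAlgHom.norm_apply_le (onAxisHom α) M

lemma onAxis_commute {α β : Fin d} (h : α ≠ β) (M N : Matrix ι ι ℂ) :
    Commute (onAxis α M) (onAxis β N) := by
  rw [commute_iff_eq]
  simp only [onAxis_eq_tensorPi, tensorPi_mul]
  congr 1
  funext γ
  by_cases h1 : γ = α
  · subst h1; simp [h]
  · by_cases h2 : γ = β
    · subst h2; simp [h1]
    · simp [h1, h2]

lemma onAxis_exp (α : Fin d) (M : Matrix ι ι ℂ) :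
    onAxis α (NormedSpace.exp M) = NormedSpace.exp (onAxis α M) := by
  let +nondep : NormedAlgebra ℚ (Matrix ι ι ℂ) := .restrictScalars ℚ ℂ _
  exact NormedSpace.map_exp (onAxisHom α)
    (AddMonoidHomClass.continuous_of_bound (onAxisHom α) 1
      fun N => by
      rw [one_mul]; exact norm_onAxis_le α N) M

lemma tensorPi_ite_insert (M : Matrix ι ι ℂ) (s : Finset (Fin d)) {α : Fin d} (hα : α ∉ s) :
    tensorPi (fun β => if β ∈ insert α s then M else 1) =
      onAxis α M * tensorPi fun β => if β ∈ s then M else 1 := by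
  rw [onAxis_eq_tensorPi, tensorPi_mul]
  congr 1
  funext β
  by_cases h : β = α
  · subst h; simp [hα]
  · simp [h]

/-- Operators on different blocks commute, so the exponential of the sum is a product of one-block
exponentials. -/
lemma exp_sum_onAxis (M : Matrix ι ι ℂ) :
    NormedSpace.exp (∑ α : Fin d, onAxis α M) = tensorPi fun _ => NormedSpace.exp M := by
  let +nondep : NormedAlgebra ℚ (Matrix ι ι ℂ) := .restrictScalars ℚ ℂ _
  have key : ∀ s : Finset (Fin d), NormedSpace.exp (∑ α ∈ s, onAxis α M) =
      tensorPi fun β => if β ∈ s then NormedSpace.exp M else 1 := by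
    intro s
    induction s using Finset.induction_on with
    | empty => simp [NormedSpace.exp_zero, tensorPi_one]
    | insert α s hα ih =>
      rw [Finset.sum_insert hα, Matrix.exp_add_of_commute, ih, tensorPi_ite_insert _ _ hα,
        onAxis_exp]
      exact Commute.sum_right _ _ _ fun β hβ => onAxis_commute (by rintro rfl; exact hα hβ) M M
  simpa using key Finset.univ

/-- The factors are exchanged one block at a time; each exchange costs at most `‖U - V‖` because all
other factors are contractions. -/
lemma norm_tensorPi_sub_le {U V : Matrix ι ι ℂ} (hU : U ∈ Matrix.unitaryGroup ι ℂ)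
    (hV : V ∈ Matrix.unitaryGroup ι ℂ) :
    ‖tensorPi (fun _ : Fin d => U) - tensorPi (fun _ => V)‖ ≤ d * ‖U - V‖ := by
  have key : ∀ s : Finset (Fin d), ‖tensorPi (fun β => if β ∈ s then U else 1) -
      tensorPi (fun β => if β ∈ s then V else 1)‖ ≤ s.card * ‖U - V‖ := by
    intro s
    induction s using Finset.induction_on with
    | empty => simp
    | insert α s hα ih =>
      rw [tensorPi_ite_insert _ _ hα, tensorPi_ite_insert _ _ hα, Finset.card_insert_of_notMem hα]
      set P := tensorPi fun β => if β ∈ s then U else 1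
      set Q := tensorPi fun β => if β ∈ s then V else 1
      have hP : ‖P‖ ≤ 1 := norm_le_one_of_mem_unitary (tensorPi_mem_unitary fun β => by
        split_ifs
        exacts [hU, one_mem _])
      have e : onAxis α U * P - onAxis α V * Q =
          onAxis α (U - V) * P + onAxis α V * (P - Q) := by
        have : onAxis α (U - V) = onAxis α U - onAxis α V := map_sub (onAxisHom α) U V
        rw [this]; noncomm_ring
      rw [e]
      have h1 : ‖onAxis α (U - V) * P‖ ≤ ‖U - V‖ := (norm_mul_le _ _).trans
        ((mul_le_of_le_one_right (norm_nonneg _) hP).trans (norm_onAxis_le α _))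
      have h2 : ‖onAxis α V * (P - Q)‖ ≤ ‖P - Q‖ := (norm_mul_le _ _).trans
        (mul_le_of_le_one_left (norm_nonneg _)
          ((norm_onAxis_le α V).trans (norm_le_one_of_mem_unitary hV)))
      calc _ ≤ _ := norm_add_le _ _
        _ ≤ ‖U - V‖ + s.card * ‖U - V‖ := add_le_add h1 (h2.trans ih)
        _ = _ := by push_cast; ring
  simpa using key Finset.univ

open scoped MatrixOrder in
-- A positive semi-definite matrix is `B⋆B`, and this form is preserved by star homomorphisms.
lemma onAxis_posSemidef (α : Fin d) {M : Matrix ι ι ℂ} (hM : M.PosSemidef) :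
    (onAxis α M).PosSemidef := by
  obtain ⟨B, rfl⟩ := CStarAlgebra.nonneg_iff_eq_star_mul_self.1 hM.nonneg
  rw [onAxis_mul]
  have : onAxis α (star B) = (onAxis α B).conjTranspose := map_star (onAxisHom α) B
  rw [this]
  exact Matrix.posSemidef_conjTranspose_mul_self _

end Tensor

/-! ### First order splitting of exponentials -/

section Splitting

variable {n : Type} [Fintype n] [DecidableEq n]

lemma hasDerivAt_exp_I_smul (H : Matrix n n ℂ) (s : ℝ) :
    HasDerivAt (fun s : ℝ => NormedSpace.exp ((Complex.I * (s : ℂ)) • H))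
      (NormedSpace.exp ((Complex.I * (s : ℂ)) • H) * (Complex.I • H)) s := by
  have h := hasDerivAt_exp_smul_const (𝕂 := ℝ) (Complex.I • H) s
  have e : ∀ t : ℝ, (Complex.I * (t : ℂ)) • H = t • Complex.I • H := by
    intro t
    rw [mul_comm, ← smul_smul, Complex.coe_smul]
  simp only [e]
  exact h

lemma hasDerivAt_exp_I_smul' (H : Matrix n n ℂ) (s : ℝ) :
    HasDerivAt (fun s : ℝ => NormedSpace.exp ((Complex.I * (s : ℂ)) • H))
      ((Complex.I • H) * NormedSpace.exp ((Complex.I * (s : ℂ)) • H)) s := by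
  have h := hasDerivAt_exp_smul_const' (𝕂 := ℝ) (Complex.I • H) s
  have e : ∀ t : ℝ, (Complex.I * (t : ℂ)) • H = t • Complex.I • H := by
    intro t
    rw [mul_comm, ← smul_smul, Complex.coe_smul]
  simp only [e]
  exact h

lemma norm_unitary_conj_le {U V M : Matrix n n ℂ} (hU : U ∈ Matrix.unitaryGroup n ℂ)
    (hV : V ∈ Matrix.unitaryGroup n ℂ) : ‖U * M * V‖ ≤ ‖M‖ :=
  (norm_mul_le _ _).trans ((mul_le_of_le_one_right (norm_nonneg _)
    (norm_le_one_of_mem_unitary hV)).trans ((norm_mul_le _ _).trans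
      (mul_le_of_le_one_left (norm_nonneg _) (norm_le_one_of_mem_unitary hU))))

lemma exp_I_mul_exp_neg (H : Matrix n n ℂ) (s : ℝ) :
    NormedSpace.exp ((Complex.I * (s : ℂ)) • H) *
      NormedSpace.exp ((Complex.I * ((-s : ℝ) : ℂ)) • H) = 1 := by
  let +nondep : NormedAlgebra ℚ (Matrix n n ℂ) := .restrictScalars ℚ ℂ _
  rw [← Matrix.exp_add_of_commute, ← add_smul]
  · simp [NormedSpace.exp_zero]
  · exact ((Commute.refl H).smul_left _).smul_right _

/-- The derivative of the conjugated matrix is the conjugate of `i[G, H]`, whose norm is at most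
`‖[G, H]‖`. -/
lemma norm_exp_conj_sub_le {G H : Matrix n n ℂ} (hG : G.IsHermitian) {t : ℝ} (ht : 0 ≤ t) :
    ‖NormedSpace.exp ((Complex.I * (t : ℂ)) • G) * H *
      NormedSpace.exp ((Complex.I * ((-t : ℝ) : ℂ)) • G) - H‖ ≤ ‖G * H - H * G‖ * t := by
  set E : ℝ → Matrix n n ℂ := fun s => NormedSpace.exp ((Complex.I * (s : ℂ)) • G)
  have hE := fun s => hasDerivAt_exp_I_smul G s
  have hE' : ∀ s, HasDerivAt (fun s => E (-s)) (-((Complex.I • G) * E (-s))) s := by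
    intro s
    have := (hasDerivAt_exp_I_smul' G (-s)).scomp s (hasDerivAt_neg s)
    rw [neg_one_smul] at this
    exact this
  have hF : ∀ s, HasDerivAt (fun s => E s * H * E (-s))
      (E s * (Complex.I • (G * H - H * G)) * E (-s)) s := by
    intro s
    refine (((hE s).mul_const H).mul (hE' s)).congr_deriv ?_
    change E s * Complex.I • G * H * E (-s) + E s * H * -(Complex.I • G * E (-s)) = _
    simp only [E, smul_sub, mul_sub, sub_mul, Matrix.mul_smul, Matrix.smul_mul, Matrix.mul_assoc,
      mul_neg]
    abel
  have hb := norm_image_sub_le_of_norm_deriv_le_segment' (f := fun s => E s * H * E (-s))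
    (f' := fun s => E s * (Complex.I • (G * H - H * G)) * E (-s)) (a := 0) (b := t)
    (C := ‖G * H - H * G‖) (fun s _ => (hF s).hasDerivWithinAt) (fun s _ => by
      refine (norm_unitary_conj_le (exp_smul_hermitian_mem_unitary hG s)
        (exp_smul_hermitian_mem_unitary hG (-s))).trans ?_
      rw [norm_smul, Complex.norm_I, one_mul]) t ⟨ht, le_rfl⟩
  simpa [E, NormedSpace.exp_zero] using hb

/-- In the interaction picture, `W(s) = e^{-is(G+H)} e^{isG} e^{isH}` starts at `1`, and its speed
is the distance between `H` and its conjugate under `e^{isG}`, hence at most `‖[G, H]‖ s`.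
Integration gives the factor `t²/2`. -/
lemma norm_exp_add_sub_le_of_nonneg {G H : Matrix n n ℂ} (hG : G.IsHermitian)
    (hH : H.IsHermitian) {t : ℝ} (ht : 0 ≤ t) :
    ‖NormedSpace.exp ((Complex.I * (t : ℂ)) • (G + H)) -
      NormedSpace.exp ((Complex.I * (t : ℂ)) • G) * NormedSpace.exp ((Complex.I * (t : ℂ)) • H)‖ ≤
      ‖G * H - H * G‖ * t ^ 2 / 2 := by
  set E : Matrix n n ℂ → ℝ → Matrix n n ℂ := fun M s => NormedSpace.exp ((Complex.I * (s : ℂ)) • M)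
  have hEu : ∀ {M : Matrix n n ℂ}, M.IsHermitian → ∀ s, E M s ∈ Matrix.unitaryGroup n ℂ :=
    fun hM s => exp_smul_hermitian_mem_unitary hM s
  have hGH : (G + H).IsHermitian := hG.add hH
  have hS : ∀ s, HasDerivAt (fun s => E (G + H) (-s)) (-(E (G + H) (-s) * (Complex.I • (G + H)))) s := by
    intro s
    have := (hasDerivAt_exp_I_smul (G + H) (-s)).scomp s (hasDerivAt_neg s)
    rw [neg_one_smul] at this
    exact this
  have hW : ∀ s, HasDerivAt (fun s => E (G + H) (-s) * (E G s * E H s))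
      (E (G + H) (-s) * (E G s * (H - E G (-s) * H * E G s) * Complex.I • E H s)) s := by
    intro s
    refine ((hS s).mul ((hasDerivAt_exp_I_smul' G s).mul (hasDerivAt_exp_I_smul' H s))).congr_deriv ?_
    have e1 : E G s * (H - E G (-s) * H * E G s) = E G s * H - H * E G s := by
      have := exp_I_mul_exp_neg G s
      rw [mul_sub, ← mul_assoc, ← mul_assoc]
      change _ - E G s * E G (-s) * H * E G s = _
      rw [this, one_mul]
    rw [e1]
    change -(E (G + H) (-s) * Complex.I • (G + H)) * (E G s * E H s) + E (G + H) (-s) *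
      (Complex.I • G * E G s * E H s + E G s * (Complex.I • H * E H s)) = _
    simp only [smul_add, mul_add, add_mul, mul_sub, sub_mul, Matrix.mul_smul, Matrix.smul_mul,
      Matrix.mul_assoc, neg_mul]
    abel
  have hb := image_norm_le_of_norm_deriv_right_le_deriv_boundary
    (f := fun s => E (G + H) (-s) * (E G s * E H s) - 1) (a := 0) (b := t)
    (f' := fun s => E (G + H) (-s) * (E G s * (H - E G (-s) * H * E G s) * Complex.I • E H s))
    (B := fun s => ‖G * H - H * G‖ * s ^ 2 / 2) (B' := fun s => ‖G * H - H * G‖ * s)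
    (fun s _ => ((hW s).sub_const 1).continuousAt.continuousWithinAt)
    (fun s _ => ((hW s).sub_const 1).hasDerivWithinAt)
    (by simp [E, NormedSpace.exp_zero])
    (fun s => by
      have := ((hasDerivAt_pow 2 s).const_mul ‖G * H - H * G‖).div_const 2
      refine this.congr_deriv ?_
      simp only [Nat.cast_ofNat, Nat.add_one_sub_one, pow_one]
      ring)
    (fun s hs => by
      have h1 := norm_exp_conj_sub_le (H := H) hG hs.1
      -- Moving the conjugation to the left of `E G s` brings the derivative to the form of
      -- `norm_exp_conj_sub_le`.
      have e2 : E G s * (H - E G (-s) * H * E G s) = (E G s * H * E G (-s) - H) * E G s := by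
        have := exp_I_mul_exp_neg G s
        have h' := exp_I_mul_exp_neg G (-s)
        rw [neg_neg] at h'
        change E G s * E G (-s) = 1 at this
        change E G (-s) * E G s = 1 at h'
        rw [mul_sub, sub_mul, mul_assoc (E G s * H), h', mul_one, ← mul_assoc, ← mul_assoc, this,
          one_mul]
      rw [e2]
      refine ((norm_mul_le _ _).trans (mul_le_of_le_one_left (norm_nonneg _)
        (norm_le_one_of_mem_unitary (hEu hGH _)))).trans ?_
      rw [Matrix.mul_smul, norm_smul, Complex.norm_I, one_mul]
      refine (norm_mul_le _ _).trans ((mul_le_of_le_one_right (norm_nonneg _)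
        (norm_le_one_of_mem_unitary (hEu hH _))).trans ?_)
      exact (norm_mul_le _ _).trans ((mul_le_of_le_one_right (norm_nonneg _)
        (norm_le_one_of_mem_unitary (hEu hG _))).trans h1)) (⟨ht, le_rfl⟩ : t ∈ Set.Icc 0 t)
  have e3 : E (G + H) t - E G t * E H t =
      -(E (G + H) t * (E (G + H) (-t) * (E G t * E H t) - 1)) := by
    have := exp_I_mul_exp_neg (G + H) t
    change E (G + H) t * E (G + H) (-t) = 1 at this
    rw [mul_sub, ← mul_assoc, this, one_mul, mul_one, neg_sub]
  change ‖E (G + H) t - E G t * E H t‖ ≤ _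
  rw [e3, norm_neg]
  exact ((norm_mul_le _ _).trans (mul_le_of_le_one_left (norm_nonneg _)
    (norm_le_one_of_mem_unitary (hEu hGH _)))).trans hb

lemma norm_exp_add_sub_le {G H : Matrix n n ℂ} (hG : G.IsHermitian) (hH : H.IsHermitian) (t : ℝ) :
    ‖NormedSpace.exp ((Complex.I * (t : ℂ)) • (G + H)) -
      NormedSpace.exp ((Complex.I * (t : ℂ)) • G) * NormedSpace.exp ((Complex.I * (t : ℂ)) • H)‖ ≤
      ‖G * H - H * G‖ * t ^ 2 / 2 := by
  rcases le_total 0 t with ht | ht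
  · exact norm_exp_add_sub_le_of_nonneg hG hH ht
  -- Reversing time is the same as changing the signs of `G` and `H`, which leaves the commutator
  -- unchanged.
  · have h := norm_exp_add_sub_le_of_nonneg hG.neg hH.neg (neg_nonneg.2 ht)
    have e : ∀ M : Matrix n n ℂ, (Complex.I * ((-t : ℝ) : ℂ)) • -M = (Complex.I * (t : ℂ)) • M := by
      intro M; simp
    rw [← neg_add, e, e, e] at h
    simpa using h

end Splitting

/-! ### Matchings of the path graph -/

section Path

/-- Adjacency matrix of the subgraph of the path whose edges are the `{v - 1, v}` with `p v`. -/
def edgeMat (nx : ℕ) (p : ℕ → Prop) [DecidablePred p] : Matrix (QReg nx) (QReg nx) ℂ :=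
  Matrix.of fun (x y : QReg nx) =>
    if ((x : ℕ) = y + 1 ∧ p x) ∨ ((y : ℕ) = x + 1 ∧ p y) then 1 else 0

variable {nx : ℕ} {p q : ℕ → Prop} [DecidablePred p] [DecidablePred q]

lemma edgeMat_symm (x y : QReg nx) : edgeMat nx p x y = edgeMat nx p y x :=
  if_congr or_comm rfl rfl

lemma edgeMat_isHermitian : (edgeMat nx p).IsHermitian := by
  ext x y
  rw [Matrix.conjTranspose_apply, edgeMat_symm]
  simp only [edgeMat, Matrix.of_apply]
  split_ifs <;> simp

lemma edgeMat_apply_ne_zero {x y : QReg nx} (h : edgeMat nx p x y ≠ 0) :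
    ((x : ℕ) = y + 1 ∧ p x) ∨ ((y : ℕ) = x + 1 ∧ p y) := by
  by_contra hn
  exact h (if_neg hn)

/-- Entries of the product count walks along a `p`-edge followed by a `q`-edge; the hypotheses say
that no such edges share a node. -/
lemma edgeMat_mul_eq_zero (h : ∀ v, p v → ¬ q v ∧ ¬ q (v + 1)) (h' : ∀ v, q v → ¬ p (v + 1)) :
    edgeMat nx p * edgeMat nx q = 0 := by
  ext x y
  rw [Matrix.mul_apply, Matrix.zero_apply]
  refine Finset.sum_eq_zero fun z _ => ?_
  by_contra hne
  rcases edgeMat_apply_ne_zero (left_ne_zero_of_mul hne) with ⟨e1, hp⟩ | ⟨e1, hp⟩ <;>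
  rcases edgeMat_apply_ne_zero (right_ne_zero_of_mul hne) with ⟨e2, hq⟩ | ⟨e2, hq⟩
  · exact h' _ hq (e1 ▸ hp)
  · rw [← e1.trans e2.symm] at hq
    exact (h _ hp).1 hq
  · exact (h _ hp).1 hq
  · exact (h _ hp).2 (e2 ▸ hq)

/-- The hypothesis makes the edges a matching, so each node has at most one neighbour. The square is
then diagonal with entries of modulus at most `1`, and the C⋆-identity applies. -/
lemma norm_edgeMat_le_one (h : ∀ v, p v → ¬ p (v + 1)) : ‖edgeMat nx p‖ ≤ 1 := by
  have huniq : ∀ {x y z : QReg nx}, edgeMat nx p x z ≠ 0 → edgeMat nx p y z ≠ 0 → x = y := by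
    intro x y z h1 h2
    apply Fin.ext
    rcases edgeMat_apply_ne_zero h1 with ⟨e1, hp⟩ | ⟨e1, hp⟩ <;>
    rcases edgeMat_apply_ne_zero h2 with ⟨e2, hq⟩ | ⟨e2, hq⟩
    · omega
    · exact absurd (e1 ▸ hp) (h _ hq)
    · exact absurd (e2 ▸ hq) (h _ hp)
    · omega
  have hle : ∀ x y : QReg nx, ‖edgeMat nx p x y‖ ≤ 1 := by
    intro x y
    simp only [edgeMat, Matrix.of_apply]
    split_ifs <;> simp
  have hsq : edgeMat nx p * edgeMat nx p =
      Matrix.diagonal fun x => (edgeMat nx p * edgeMat nx p) x x := by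
    ext x y
    rw [Matrix.diagonal_apply]
    split_ifs with e
    · rw [e]
    · rw [Matrix.mul_apply]
      refine Finset.sum_eq_zero fun z _ => ?_
      by_contra hne
      refine e (huniq (left_ne_zero_of_mul hne) ?_)
      rw [edgeMat_symm]
      exact right_ne_zero_of_mul hne
  have hdiag : ∀ x, ‖(edgeMat nx p * edgeMat nx p) x x‖ ≤ 1 := by
    intro x
    rw [Matrix.mul_apply]
    by_cases hz : ∃ z, edgeMat nx p x z ≠ 0
    · obtain ⟨z, hz⟩ := hz
      rw [Finset.sum_eq_single z]
      · rw [norm_mul]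
        exact mul_le_one₀ (hle _ _) (norm_nonneg _) (hle _ _)
      · intro w _ hw
        by_contra hne
        refine hw (huniq (right_ne_zero_of_mul hne) ?_)
        rwa [edgeMat_symm]
      · simp
    · push Not at hz
      simp [hz]
  have h1 : ‖edgeMat nx p‖ * ‖edgeMat nx p‖ ≤ 1 := by
    rw [← Matrix.l2_opNorm_conjTranspose_mul_self, edgeMat_isHermitian.eq, hsq,
      Matrix.l2_opNorm_diagonal]
    exact (pi_norm_le_iff_of_nonneg zero_le_one).2 hdiag
  nlinarith [norm_nonneg (edgeMat nx p)]

lemma shiftTerm_eq_edgeMat (nx j : ℕ) :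
    shiftTerm nx j = edgeMat nx fun v => padicValNat 2 v = j := rfl

lemma shiftTerm_isHermitian (nx j : ℕ) : (shiftTerm nx j).IsHermitian := by
  rw [shiftTerm_eq_edgeMat]
  exact edgeMat_isHermitian

lemma padicValNat_two_eq_zero_iff {v : ℕ} : padicValNat 2 v = 0 ↔ v = 0 ∨ ¬ 2 ∣ v := by
  rw [padicValNat.eq_zero_iff]; simp

/-- The terms of index at least one connect disjoint pairs of nodes. -/
lemma shiftTerm_mul_shiftTerm {i j : ℕ} (hi : i ≠ 0) (hj : j ≠ 0) (hij : i ≠ j) :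
    shiftTerm nx i * shiftTerm nx j = 0 := by
  have hev : ∀ {k v : ℕ}, k ≠ 0 → padicValNat 2 v = k → v ≠ 0 ∧ 2 ∣ v := by
    intro k v hk hv
    have : ¬ padicValNat 2 v = 0 := by rwa [hv]
    rw [padicValNat_two_eq_zero_iff] at this
    tauto
  rw [shiftTerm_eq_edgeMat, shiftTerm_eq_edgeMat]
  refine edgeMat_mul_eq_zero (fun v hv => ⟨fun h => hij (hv.symm.trans h), fun h => ?_⟩)
    fun v hv h => ?_
  · have := hev hi hv; have := hev hj h; omega
  · have := hev hj hv; have := hev hi h; omega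

/-- The even numbers strictly between `0` and `2 ^ (m + 1)` have 2-adic valuations from `1` to `m`,
each exactly one, so these terms exhaust the even edges without overlap. -/
lemma shiftTerm_sum_succ (m : ℕ) :
    ∑ j : Fin m, shiftTerm (m + 1) (j + 1) = edgeMat (m + 1) fun v => 2 ∣ v := by
  ext x y
  rw [Matrix.sum_apply]
  by_cases h : edgeMat (m + 1) (fun v => 2 ∣ v) x y = 0
  · rw [h]
    refine Finset.sum_eq_zero fun j _ => ?_
    by_contra hne
    have hj := edgeMat_apply_ne_zero (p := fun v => padicValNat 2 v = j + 1) hne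
    have hd : ∀ v : ℕ, padicValNat 2 v = (j : ℕ) + 1 → 2 ∣ v := fun v hv => by
      have h0 : ¬ padicValNat 2 v = 0 := by omega
      rw [padicValNat_two_eq_zero_iff] at h0
      tauto
    have : edgeMat (m + 1) (fun v => 2 ∣ v) x y = 1 :=
      if_pos (hj.imp (fun a => ⟨a.1, hd _ a.2⟩) fun a => ⟨a.1, hd _ a.2⟩)
    rw [this] at h
    exact one_ne_zero h
  · have hval : ∀ v : ℕ, v ≠ 0 → v < 2 ^ (m + 1) → 2 ∣ v →
        ∃ j : Fin m, padicValNat 2 v = j + 1 := by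
      intro v hv hlt hd
      have h0 : ¬ padicValNat 2 v = 0 := by rw [padicValNat_two_eq_zero_iff]; tauto
      have h1 : 2 ^ padicValNat 2 v ≤ v := Nat.le_of_dvd (by omega) pow_padicValNat_dvd
      have h2 : padicValNat 2 v < m + 1 :=
        (Nat.pow_lt_pow_iff_right (by norm_num : 1 < 2)).1 (h1.trans_lt hlt)
      exact ⟨⟨padicValNat 2 v - 1, by omega⟩, by simp; omega⟩
    have hx := x.2
    have hy := y.2
    have he : edgeMat (m + 1) (fun v => 2 ∣ v) x y = 1 := if_pos (edgeMat_apply_ne_zero h)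
    have hterm : ∀ i : ℕ, shiftTerm (m + 1) i x y =
      if ((x : ℕ) = y + 1 ∧ padicValNat 2 (x : ℕ) = i) ∨
        ((y : ℕ) = x + 1 ∧ padicValNat 2 (y : ℕ) = i) then 1 else 0 := fun i => rfl
    rw [he]
    simp only [hterm]
    rcases edgeMat_apply_ne_zero h with ⟨e, hd⟩ | ⟨e, hd⟩
    · obtain ⟨j, hj⟩ := hval x (by omega) hx hd
      rw [Finset.sum_eq_single j]
      · exact if_pos (Or.inl ⟨e, hj⟩)
      · intro i _ hi
        refine if_neg ?_
        rintro (⟨-, h2⟩ | ⟨h2, -⟩)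
        · exact hi (Fin.ext (by omega))
        · omega
      · simp
    · obtain ⟨j, hj⟩ := hval y (by omega) hy hd
      rw [Finset.sum_eq_single j]
      · exact if_pos (Or.inr ⟨e, hj⟩)
      · intro i _ hi
        refine if_neg ?_
        rintro (⟨h2, -⟩ | ⟨-, h2⟩)
        · omega
        · exact hi (Fin.ext (by omega))
      · simp

lemma shiftTerm_zero (nx : ℕ) : shiftTerm nx 0 = edgeMat nx fun v => ¬ 2 ∣ v := by
  ext x y
  simp only [shiftTerm, edgeMat, Matrix.of_apply]
  refine if_congr (or_congr (and_congr_right fun e => ?_) (and_congr_right fun e => ?_)) rfl rfl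
  -- The convention `padicValNat 2 0 = 0` does no harm: the larger end of an edge is a successor,
  -- never `0`.
  all_goals
    rw [padicValNat_two_eq_zero_iff]
    omega

/-- For two qubits the triangle inequality would only give `2`. The commutator is a signed
permutation matrix, hence unitary. -/
lemma norm_commutator_four_le_one :
    ‖edgeMat 2 (fun v => ¬ 2 ∣ v) * edgeMat 2 (fun v => 2 ∣ v) -
      edgeMat 2 (fun v => 2 ∣ v) * edgeMat 2 (fun v => ¬ 2 ∣ v)‖ ≤ 1 := by
  apply norm_le_one_of_mem_unitary
  have e1 : edgeMat 2 (fun v => ¬ 2 ∣ v) = !![0, 1, 0, 0; 1, 0, 0, 0; 0, 0, 0, 1; 0, 0, 1, 0] := by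
    ext i j
    fin_cases i <;> fin_cases j <;> simp [edgeMat]
  have e2 : edgeMat 2 (fun v => 2 ∣ v) = !![0, 0, 0, 0; 0, 0, 1, 0; 0, 1, 0, 0; 0, 0, 0, 0] := by
    ext i j
    fin_cases i <;> fin_cases j <;> simp [edgeMat]
  rw [e1, e2, Matrix.mem_unitaryGroup_iff]
  ext i j
  fin_cases i <;> fin_cases j <;>
    simp [Matrix.mul_apply, Fin.sum_univ_four, Matrix.star_apply]

/-- A product of two contractions gives the bound `2`, which suffices from `m = 2` on. For `m = 0`
there are no even edges, and `m = 1` is the explicit four-node case. -/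
lemma norm_shift_commutator_le (m : ℕ) :
    ‖shiftTerm (m + 1) 0 * (∑ j : Fin m, shiftTerm (m + 1) (j + 1)) -
      (∑ j : Fin m, shiftTerm (m + 1) (j + 1)) * shiftTerm (m + 1) 0‖ ≤ m := by
  rcases m with _ | _ | m
  · simp
  · rw [shiftTerm_sum_succ, shiftTerm_zero]
    simpa using norm_commutator_four_le_one
  · rw [shiftTerm_sum_succ, shiftTerm_zero]
    set G := edgeMat (m + 1 + 1 + 1) fun v => ¬ 2 ∣ v
    set H := edgeMat (m + 1 + 1 + 1) fun v => 2 ∣ v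
    have hG : ‖G‖ ≤ 1 := norm_edgeMat_le_one fun v hv => by omega
    have hH : ‖H‖ ≤ 1 := norm_edgeMat_le_one fun v hv => by omega
    have h1 : ‖G * H‖ ≤ 1 := (norm_mul_le _ _).trans (mul_le_one₀ hG (norm_nonneg _) hH)
    have h2 : ‖H * G‖ ≤ 1 := (norm_mul_le _ _).trans (mul_le_one₀ hH (norm_nonneg _) hG)
    calc _ ≤ _ := norm_sub_le _ _
      _ ≤ (2 : ℝ) := by linarith
      _ ≤ _ := by push_cast; linarith [(Nat.cast_nonneg m : (0 : ℝ) ≤ m)]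

end Path

/-! ### The discrete Laplacian and the circuit for its evolution -/

section Heat

lemma prod_ofFn_exp {n : Type} [Fintype n] [DecidableEq n] {m : ℕ} (M : Fin m → Matrix n n ℂ)
    (h : ∀ i j, Commute (M i) (M j)) :
    (List.ofFn fun j => NormedSpace.exp (M j)).prod = NormedSpace.exp (∑ j, M j) := by
  let +nondep : NormedAlgebra ℚ (Matrix n n ℂ) := .restrictScalars ℚ ℂ _
  induction m with
  | zero => simp [NormedSpace.exp_zero]
  | succ m ih =>
    rw [List.ofFn_succ, List.prod_cons, ih _ fun i j => h _ _, Fin.sum_univ_succ,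
      Matrix.exp_add_of_commute]
    exact Commute.sum_right _ _ _ fun j _ => h _ _

lemma shiftTerm_commute {nx i j : ℕ} (hi : i ≠ 0) (hj : j ≠ 0) :
    Commute (shiftTerm nx i) (shiftTerm nx j) := by
  rcases eq_or_ne i j with rfl | hij
  · exact Commute.refl _
  · rw [commute_iff_eq, shiftTerm_mul_shiftTerm hi hj hij, shiftTerm_mul_shiftTerm hj hi hij.symm]

lemma laplace1_eq (m : ℕ) (Δx : ℝ) :
    laplace1 (m + 1) Δx = ((Δx ^ 2 : ℝ) : ℂ)⁻¹ • ((-2 : ℂ) • (1 : Matrix _ _ ℂ) +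
      (shiftTerm (m + 1) 0 + ∑ j : Fin m, shiftTerm (m + 1) (j + 1))) := by
  rw [laplace1, shiftTerm_sum_succ, shiftTerm_zero]
  congr 1
  ext x y
  simp only [edgeMat, Matrix.of_apply, Matrix.add_apply, Matrix.smul_apply, Matrix.one_apply,
    smul_eq_mul]
  by_cases h : x = y
  · subst h; simp
  · have h' : (x : ℕ) ≠ y := fun e => h (Fin.ext e)
    simp only [if_neg h, mul_zero, zero_add]
    by_cases h1 : (x : ℕ) = y + 1
    · have h2 : ¬ (y : ℕ) = x + 1 := by omega
      by_cases hd : 2 ∣ (x : ℕ)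
      · have hd' : 2 ∣ (y : ℕ) + 1 := by omega
        simp [h1, hd']; omega
      · have hd' : ¬ 2 ∣ (y : ℕ) + 1 := by omega
        simp [h1, hd']; omega
    · by_cases h2 : (y : ℕ) = x + 1
      · by_cases hd : 2 ∣ (y : ℕ)
        · have hd' : 2 ∣ (x : ℕ) + 1 := by omega
          simp [h2, hd']; omega
        · have hd' : ¬ 2 ∣ (x : ℕ) + 1 := by omega
          simp [h2, hd']; omega
      · simp [h1, h2]

/-- All factors but the first commute, so the product formula has only one nontrivial splitting,
between odd and even edges. -/
lemma V0_eq (m : ℕ) (γ τ : ℝ) :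
    V0 (m + 1) γ τ = Complex.exp (-2 * Complex.I * ((γ * τ : ℝ) : ℂ)) •
      (NormedSpace.exp ((Complex.I * ((γ * τ : ℝ) : ℂ)) • shiftTerm (m + 1) 0) *
        NormedSpace.exp ((Complex.I * ((γ * τ : ℝ) : ℂ)) •
          ∑ j : Fin m, shiftTerm (m + 1) (j + 1))) := by
  rw [V0, List.ofFn_succ, List.prod_cons]
  congr 2
  rw [Finset.smul_sum, ← prod_ofFn_exp]
  · rfl
  · intro i j
    exact ((shiftTerm_commute (Nat.succ_ne_zero _) (Nat.succ_ne_zero _)).smul_left _).smul_right _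

lemma norm_exp_I_mul (r : ℝ) : ‖Complex.exp (-2 * Complex.I * (r : ℂ))‖ = 1 := by
  rw [show -2 * Complex.I * (r : ℂ) = ((-2 * r : ℝ) : ℂ) * Complex.I by push_cast; ring]
  exact Complex.norm_exp_ofReal_mul_I _

lemma smul_mem_unitary {n : Type} [Fintype n] [DecidableEq n] {c : ℂ} (hc : ‖c‖ = 1)
    {U : Matrix n n ℂ} (hU : U ∈ Matrix.unitaryGroup n ℂ) : c • U ∈ Matrix.unitaryGroup n ℂ := by
  rw [Matrix.mem_unitaryGroup_iff, star_smul, Matrix.smul_mul, Matrix.mul_smul, smul_smul,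
    Unitary.mul_star_self_of_mem hU]
  have : c * star c = 1 := by
    rw [Complex.star_def, Complex.mul_conj, Complex.normSq_eq_norm_sq, hc]; simp
  rw [this, one_smul]

lemma shift_sum_isHermitian (m : ℕ) :
    (∑ j : Fin m, shiftTerm (m + 1) (j + 1)).IsHermitian := by
  rw [shiftTerm_sum_succ]
  exact edgeMat_isHermitian

lemma V0_mem_unitary {nx : ℕ} (h : 1 ≤ nx) (γ τ : ℝ) :
    V0 nx γ τ ∈ Matrix.unitaryGroup (QReg nx) ℂ := by
  obtain ⟨m, rfl⟩ := Nat.exists_eq_add_of_le' h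
  rw [V0_eq]
  exact smul_mem_unitary (norm_exp_I_mul _) (mul_mem
    (exp_smul_hermitian_mem_unitary (shiftTerm_isHermitian _ _) _)
    (exp_smul_hermitian_mem_unitary (shift_sum_isHermitian m) _))

lemma exp_smul_one_add {n : Type} [Fintype n] [DecidableEq n] (c : ℂ) (M : Matrix n n ℂ) :
    NormedSpace.exp (c • (1 : Matrix n n ℂ) + M) = Complex.exp c • NormedSpace.exp M := by
  let +nondep : NormedAlgebra ℚ (Matrix n n ℂ) := .restrictScalars ℚ ℂ _
  rw [Matrix.exp_add_of_commute _ _ ((Commute.one_left M).smul_left c)]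
  have h1 : NormedSpace.exp (c • (1 : Matrix n n ℂ)) = Complex.exp c • 1 := by
    rw [Complex.exp_eq_exp_ℂ, ← Algebra.algebraMap_eq_smul_one, ← Algebra.algebraMap_eq_smul_one,
      NormedSpace.algebraMap_exp_comm]
  rw [h1, Matrix.smul_mul, one_mul]

/-- The diagonal part `-2` of the Laplacian commutes with everything and yields the same phase on
both sides; what remains is the splitting error for odd and even edges. -/
lemma norm_exp_laplace1_sub_V0_le {nx : ℕ} (h : 1 ≤ nx) {a Δx R : ℝ} (hΔ : 0 < Δx) (hR : 0 < R)
    (s : ℝ) :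
    ‖NormedSpace.exp ((Complex.I * ((-(s * a / R) : ℝ) : ℂ)) • laplace1 nx Δx) -
      V0 nx (gamma0 a Δx R) (-s)‖ ≤ ((nx : ℝ) - 1) * gamma0 a Δx R ^ 2 * s ^ 2 / 2 := by
  obtain ⟨m, rfl⟩ := Nat.exists_eq_add_of_le' h
  rw [V0_eq, laplace1_eq]
  set G := shiftTerm (m + 1) 0
  set H := ∑ j : Fin m, shiftTerm (m + 1) (j + 1)
  set γ := gamma0 a Δx R
  have e : (Complex.I * ((-(s * a / R) : ℝ) : ℂ)) • ((Δx ^ 2 : ℝ) : ℂ)⁻¹ •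
      ((-2 : ℂ) • (1 : Matrix (QReg (m + 1)) (QReg (m + 1)) ℂ) + (G + H)) =
      (-2 * Complex.I * ((γ * -s : ℝ) : ℂ)) • (1 : Matrix (QReg (m + 1)) (QReg (m + 1)) ℂ) +
        (Complex.I * ((γ * -s : ℝ) : ℂ)) • (G + H) := by
    rw [smul_smul, smul_add, smul_smul]
    have h1 : Complex.I * ((-(s * a / R) : ℝ) : ℂ) * ((Δx ^ 2 : ℝ) : ℂ)⁻¹ =
        Complex.I * ((γ * -s : ℝ) : ℂ) := by
      rw [mul_assoc, ← Complex.ofReal_inv, ← Complex.ofReal_mul]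
      congr 2
      simp only [γ, gamma0]
      field_simp
    rw [h1, mul_right_comm, mul_comm Complex.I (-2 : ℂ)]
  rw [e, exp_smul_one_add, ← smul_sub, norm_smul, norm_exp_I_mul, one_mul]
  refine (norm_exp_add_sub_le (shiftTerm_isHermitian _ _) (shift_sum_isHermitian m) _).trans ?_
  have := norm_shift_commutator_le m
  have h2 : 0 ≤ (γ * -s) ^ 2 / 2 := by positivity
  push_cast
  nlinarith [mul_le_mul_of_nonneg_right this h2]

lemma heatMatrix_eq (d nx : ℕ) (a Δx : ℝ) :
    heatMatrix d nx a Δx = (a : ℂ) • ∑ α : Fin d, onAxis α (laplace1 nx Δx) := by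
  rw [heatMatrix]
  congr 1

/-- The modes `η_k` are integer multiples of `1/R`, so the evolution in each mode is an integer
power of one basic evolution. This is the reason for the powers in `Vheat`. -/
lemma exp_heatMatrix (d nx : ℕ) (a Δx r : ℝ) (z : ℤ) :
    NormedSpace.exp ((Complex.I * ((r * z : ℝ) : ℂ)) • heatMatrix d nx a Δx) =
      tensorPi (fun _ => NormedSpace.exp ((Complex.I * ((r * a : ℝ) : ℂ)) • laplace1 nx Δx)) ^ z := by
  rw [← exp_sum_onAxis, ← Matrix.exp_zsmul, heatMatrix_eq]
  congr 1
  have h : ∀ (α : Fin d) (c : ℂ), onAxis α (c • laplace1 nx Δx) = c • onAxis α (laplace1 nx Δx) :=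
    fun α c => map_smul (onAxisHom α) c _
  simp only [h, ← Finset.smul_sum]
  rw [← Int.cast_smul_eq_zsmul ℂ, smul_smul, smul_smul]
  congr 1
  push_cast
  ring

lemma Vheat_eq_blockDiagonal (d nx np : ℕ) (a Δx R τ : ℝ) :
    Vheat d nx np a Δx R τ = Matrix.blockDiagonal fun k : QReg np =>
      tensorPi (fun _ : Fin d => V0 nx (gamma0 a Δx R) τ) ^ (((k : ℕ) : ℤ) - 2 ^ (np - 1)) := by
  ext i j
  simp only [Vheat, Matrix.of_apply, Matrix.blockDiagonal_apply]
  rfl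

lemma Vheat_mem_unitary {d nx np : ℕ} (h : 1 ≤ nx) (a Δx R τ : ℝ) :
    Vheat d nx np a Δx R τ ∈ Matrix.unitaryGroup (XReg d nx × QReg np) ℂ := by
  rw [Vheat_eq_blockDiagonal]
  exact blockDiagonal_mem_unitary fun k =>
    zpow_mem_unitary (tensorPi_mem_unitary fun _ => V0_mem_unitary h _ _) _

lemma laplace1_isHermitian (nx : ℕ) (Δx : ℝ) : (laplace1 nx Δx).IsHermitian := by
  ext x y
  simp only [laplace1, Matrix.conjTranspose_apply, Matrix.smul_apply, Matrix.of_apply]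
  simp only [eq_comm (a := y), or_comm (a := (y : ℕ) = x + 1)]
  split_ifs <;> simp

/-- The constant is the product of `(n_x - 1) γ₀² / 2` from the splitting, `d` from the tensor
product and `N_p / 2` from the largest power. -/
lemma approxEvol_Vheat {d nx np : ℕ} {a Δx R : ℝ} (hnx : 1 ≤ nx) (hnp : 1 ≤ np)
    (hΔ : 0 < Δx) (hR : 0 < R) (s : ℝ) :
    ApproxEvol (heatMatrix d nx a Δx) np R (cHeat d nx np a Δx R) s
      (Vheat d nx np a Δx R (-s)) := by
  have hnx' : (0 : ℝ) ≤ (nx : ℝ) - 1 := by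
    have : (1 : ℝ) ≤ nx := by exact_mod_cast hnx
    linarith
  -- Since `np ≥ 1`, the centre `N_p / 2` is an integer and the truncated exponent `np - 1` is the
  -- true one.
  have hpow : (2 : ℝ) ^ np = 2 * 2 ^ (np - 1) := by
    rw [← pow_succ']; congr 1; omega
  rw [ApproxEvol, evolH_eq_blockDiagonal, Vheat_eq_blockDiagonal, ← Matrix.blockDiagonal_sub]
  refine norm_blockDiagonal_le (by unfold cHeat; positivity) fun k => ?_
  rw [Pi.sub_apply]
  set z : ℤ := ((k : ℕ) : ℤ) - 2 ^ (np - 1)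
  have e : (-(s * eta np R k) : ℝ) = -(s / R) * (z : ℝ) := by
    simp only [eta, z, hpow]
    push_cast
    field_simp
  have e' : -(s / R) * a = -(s * a / R) := by ring
  have hz : |(z : ℝ)| ≤ 2 ^ (np - 1) := by
    have hk : ((k : ℕ) : ℝ) < 2 ^ np := by exact_mod_cast k.2
    have hk0 : (0 : ℝ) ≤ ((k : ℕ) : ℝ) := Nat.cast_nonneg _
    simp only [z]
    push_cast
    rw [abs_le]
    constructor <;> linarith
  rw [e, exp_heatMatrix, e']
  have hU := exp_smul_hermitian_mem_unitary (laplace1_isHermitian nx Δx) (-(s * a / R))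
  have hV := V0_mem_unitary hnx (gamma0 a Δx R) (-s)
  refine (norm_zpow_sub_zpow_le (tensorPi_mem_unitary fun _ => hU)
    (tensorPi_mem_unitary fun _ => hV) z).trans ?_
  have h1 := norm_tensorPi_sub_le (d := d) hU hV
  have h2 := norm_exp_laplace1_sub_V0_le hnx (a := a) hΔ hR s
  calc _ ≤ (2 : ℝ) ^ (np - 1) *
        (d * (((nx : ℝ) - 1) * gamma0 a Δx R ^ 2 * s ^ 2 / 2)) := by
        refine mul_le_mul hz (h1.trans (mul_le_mul_of_nonneg_left h2 (Nat.cast_nonneg _)))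
          (norm_nonneg _) (by positivity)
    _ = _ := by rw [cHeat, hpow]; ring

end Heat

/-! ### The central difference scheme -/

section Scheme

/-- The difference matrix from the `N` interior nodes to the `N + 1` edges. -/
def diffMat (N : ℕ) : Matrix (Fin (N + 1)) (Fin N) ℂ :=
  Matrix.of fun e x => (if e = x.castSucc then 1 else 0) - (if e = x.succ then 1 else 0)

/-- Summation by parts: with zero values outside, the negative second difference is `∂⋆∂`. The two
edges that lead to the boundary account for the full diagonal entry `2` at the end nodes. -/
lemma neg_laplace1_eq (nx : ℕ) (Δx : ℝ) :
    -laplace1 nx Δx = (Δx ^ 2)⁻¹ • ((diffMat (2 ^ nx)).conjTranspose * diffMat (2 ^ nx)) := by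
  ext x y
  have h : ((diffMat (2 ^ nx)).conjTranspose * diffMat (2 ^ nx)) x y =
      (if x = y then 1 else 0) - (if (x : ℕ) = y + 1 then 1 else 0) -
      ((if (y : ℕ) = x + 1 then 1 else 0) - (if x = y then 1 else 0)) := by
    have e1 : x.castSucc = y.succ ↔ (x : ℕ) = y + 1 := by simp [Fin.ext_iff]
    have e2 : x.succ = y.castSucc ↔ (y : ℕ) = x + 1 := by simp [Fin.ext_iff, eq_comm]
    simp only [diffMat, Matrix.mul_apply, Matrix.conjTranspose_apply, Matrix.of_apply, star_sub,
      apply_ite star, star_one, star_zero, sub_mul, mul_sub, ite_mul, one_mul, zero_mul,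
      Finset.sum_sub_distrib, Finset.sum_ite_eq', Finset.mem_univ, if_true, Fin.castSucc_inj,
      Fin.succ_inj, e1, e2]
    ring
  rw [Matrix.smul_apply, h, Matrix.neg_apply]
  simp only [laplace1, Matrix.smul_apply, Matrix.of_apply, smul_eq_mul, Complex.real_smul,
    Complex.ofReal_inv, ← mul_neg]
  congr 1
  by_cases hxy : x = y
  · subst hxy; simp; norm_num
  · have h' : (x : ℕ) ≠ y := fun e => hxy (Fin.ext e)
    by_cases h1 : (x : ℕ) = y + 1
    · have h2 : ¬ (y : ℕ) = x + 1 := by omega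
      simp only [hxy, h1, if_true, if_false, true_or]
      rw [if_neg (by omega)]
      norm_num
    · by_cases h2 : (y : ℕ) = x + 1
      · simp only [hxy, h2, if_true, if_false, or_true]
        rw [if_neg (by omega)]
        norm_num
      · simp [hxy, h1, h2]

lemma neg_heatMatrix_posSemidef (d nx : ℕ) {a : ℝ} (ha : 0 < a) (Δx : ℝ) :
    (-heatMatrix d nx a Δx).PosSemidef := by
  have e : -heatMatrix d nx a Δx = a • ∑ α : Fin d, onAxis α (-laplace1 nx Δx) := by
    have h : ∀ α : Fin d, onAxis α (-laplace1 nx Δx) = -onAxis α (laplace1 nx Δx) :=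
      fun α => map_neg (onAxisHom α) _
    simp only [h, Finset.sum_neg_distrib, smul_neg]
    rw [heatMatrix_eq, Complex.coe_smul]
  rw [e]
  refine Matrix.PosSemidef.smul (Matrix.posSemidef_sum _ fun α _ => onAxis_posSemidef α ?_) ha.le
  rw [neg_laplace1_eq]
  exact (Matrix.posSemidef_conjTranspose_mul_self _).smul (by positivity)

lemma act_onAxis_apply {d : ℕ} {ι : Type} [Fintype ι] [DecidableEq ι] (α : Fin d)
    (M : Matrix ι ι ℂ) (v : EuclideanSpace ℂ (Fin d → ι)) (x : Fin d → ι) :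
    act (onAxis α M) v x = ∑ z, M (x α) z * v (Function.update x α z) := by
  rw [act_apply]
  symm
  refine Finset.sum_of_injOn (fun z => Function.update x α z) ?_ (by simp) ?_ ?_
  · intro z _ w _ h
    have := congrFun h α
    simpa using this
  · intro y _ hy
    rw [onAxis, Matrix.of_apply, if_neg, zero_mul]
    intro h
    refine hy ⟨y α, by simp, ?_⟩
    funext β
    by_cases hβ : β = α
    · subst hβ; simp
    · simp [hβ, h β hβ]
  · intro z _
    rw [onAxis, Matrix.of_apply, if_pos, Function.update_self]
    intro β hβ
    simp [hβ]

/-- A neighbour missing from the matrix row is a boundary node, and the source term supplies exactly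
its value. Unknown `z` sits at node `z + 1`, which explains the shifted arguments of `h`. -/
lemma second_difference_sum {N : ℕ} (i : Fin N) (h : ℕ → ℂ) :
    (∑ z : Fin N, (if i = z then (-2 : ℂ) else
      if (i : ℕ) = z + 1 ∨ (z : ℕ) = i + 1 then 1 else 0) * h (z + 1)) +
      ((if (i : ℕ) = 0 then h 0 else 0) + (if (i : ℕ) + 1 = N then h (N + 1) else 0)) =
    h i - 2 * h (i + 1) + h (i + 2) := by
  have hc : ∀ z : Fin N, (if i = z then (-2 : ℂ) else
      if (i : ℕ) = z + 1 ∨ (z : ℕ) = i + 1 then 1 else 0) * h (z + 1) =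
      (if i = z then -2 * h (z + 1) else 0) + (if (i : ℕ) = z + 1 then h (z + 1) else 0) +
        (if (z : ℕ) = i + 1 then h (z + 1) else 0) := by
    intro z
    by_cases h0 : i = z
    · subst h0; simp
    · have h' : (i : ℕ) ≠ z := fun e => h0 (Fin.ext e)
      by_cases h1 : (i : ℕ) = z + 1
      · have h2 : ¬ (z : ℕ) = i + 1 := by omega
        rw [if_neg h0, if_pos (Or.inl h1), if_neg h0, if_pos h1, if_neg h2]; ring
      · by_cases h2 : (z : ℕ) = i + 1
        · rw [if_neg h0, if_pos (Or.inr h2), if_neg h0, if_neg h1, if_pos h2]; ring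
        · rw [if_neg h0, if_neg (by tauto), if_neg h0, if_neg h1, if_neg h2]; ring
  have hleft : (∑ z : Fin N, if (i : ℕ) = z + 1 then h (z + 1) else 0) +
      (if (i : ℕ) = 0 then h 0 else 0) = h i := by
    by_cases hi : (i : ℕ) = 0
    · rw [Finset.sum_eq_zero fun z _ => if_neg (by omega), if_pos hi, hi, zero_add]
    · have hlt := i.2
      rw [if_neg hi, Finset.sum_eq_single ⟨(i : ℕ) - 1, by omega⟩]
      · have e : (i : ℕ) - 1 + 1 = i := by omega
        simp [e]
      · intro z _ hz
        refine if_neg fun e => hz (Fin.ext ?_)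
        simp; omega
      · simp
  have hright : (∑ z : Fin N, if (z : ℕ) = i + 1 then h (z + 1) else 0) +
      (if (i : ℕ) + 1 = N then h (N + 1) else 0) = h (i + 2) := by
    by_cases hi : (i : ℕ) + 1 = N
    · rw [Finset.sum_eq_zero fun z _ => if_neg (by have := z.2; omega), if_pos hi, zero_add]
      congr 1
      omega
    · have hlt := i.2
      rw [if_neg hi, Finset.sum_eq_single ⟨(i : ℕ) + 1, by omega⟩]
      · simp
      · intro z _ hz
        exact if_neg fun e => hz (Fin.ext e)
      · simp
  simp only [hc, Finset.sum_add_distrib, Finset.sum_ite_eq, Finset.mem_univ, if_true]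
  linear_combination hleft + hright

lemma hasDerivWithinAt_of_apply {X : Type} [Fintype X] {y : ℝ → EuclideanSpace ℂ X}
    {y' : EuclideanSpace ℂ X} {s : Set ℝ} {t : ℝ}
    (h : ∀ x, HasDerivWithinAt (fun r => y r x) (y' x) s t) : HasDerivWithinAt y y' s t := by
  rw [hasDerivWithinAt_iff_hasFDerivWithinAt, hasFDerivWithinAt_piLp 2]
  intro x
  have e : (PiLp.proj 2 (fun _ : X => ℂ) x : _ →L[ℝ] ℂ) ∘L
      ContinuousLinearMap.toSpanSingleton ℝ y' = ContinuousLinearMap.toSpanSingleton ℝ (y' x) := by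
    ext; simp
  rw [e]
  exact (h x).hasFDerivWithinAt

lemma solvesODE_of_solvesHeatScheme {d nx : ℕ} {a Δx T : ℝ} {U : ℝ → (Fin d → ℕ) → ℂ}
    (hU : SolvesHeatScheme nx a Δx T U) :
    SolvesODE (heatMatrix d nx a Δx) (boundarySource nx a Δx U) T (interior nx U) := by
  intro t ht
  refine hasDerivWithinAt_of_apply fun x => ?_
  refine (hU x t ht).congr_deriv ?_
  rw [heatMatrix_eq, PiLp.add_apply, smul_act]
  have hsum : act (∑ α : Fin d, onAxis α (laplace1 nx Δx)) (interior nx U t) =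
      ∑ α : Fin d, act (onAxis α (laplace1 nx Δx)) (interior nx U t) := by
    simp [act]
  have hx : (∑ α : Fin d, act (onAxis α (laplace1 nx Δx)) (interior nx U t)) x =
      ∑ α : Fin d, act (onAxis α (laplace1 nx Δx)) (interior nx U t) x := by simp
  rw [hsum, PiLp.smul_apply, hx]
  simp only [boundarySource, smul_eq_mul, act_onAxis_apply]
  have e : (a : ℂ) * ((Δx ^ 2 : ℝ) : ℂ)⁻¹ = ((a / Δx ^ 2 : ℝ) : ℂ) := by
    push_cast; rw [div_eq_mul_inv]
  have hL : ∀ α : Fin d, ∑ z, laplace1 nx Δx (x α) z * interior nx U t (Function.update x α z) =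
      ((Δx ^ 2 : ℝ) : ℂ)⁻¹ * ∑ z : QReg nx, (if x α = z then (-2 : ℂ) else
        if (x α : ℕ) = z + 1 ∨ (z : ℕ) = x α + 1 then 1 else 0) *
          U t (Function.update (node x) α (z + 1)) := by
    intro α
    rw [Finset.mul_sum]
    refine Finset.sum_congr rfl fun z _ => ?_
    simp only [laplace1, Matrix.smul_apply, Matrix.of_apply, smul_eq_mul, interior, mul_assoc]
    congr 4
    funext β
    by_cases hβ : β = α
    · subst hβ; simp [node]
    · simp [node, hβ]
  simp only [hL]
  rw [← Finset.mul_sum, ← mul_assoc, e, ← mul_add, ← Finset.sum_add_distrib]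
  congr 1
  refine Finset.sum_congr rfl fun α _ => ?_
  rw [second_difference_sum (x α) fun n => U t (Function.update (node x) α n)]
  have hn : node x α = (x α : ℕ) + 1 := rfl
  have hup : Function.update (node x) α ((x α : ℕ) + 1) = node x := by
    rw [← hn, Function.update_eq_self]
  rw [hup, hn]
  rfl

end Scheme

/-! ### The discrete Fourier transform and translations -/

section Fourier

variable {np : ℕ} {R : ℝ}

/-- The mesh size `Δp`. -/
def meshP (np : ℕ) (R : ℝ) : ℝ := 2 * Real.pi * R / 2 ^ np

lemma meshP_pos (hR : 0 < R) : 0 < meshP np R := by unfold meshP; positivity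

lemma two_pow_mul_meshP (np : ℕ) (R : ℝ) : 2 ^ np * meshP np R = 2 * Real.pi * R := by
  unfold meshP; field_simp

lemma pGrid_eq (k : QReg np) : pGrid np R k = (k : ℕ) * meshP np R - Real.pi * R := by
  unfold pGrid meshP; ring

lemma eta_mul_meshP (hR : 0 < R) (l : QReg np) :
    eta np R l * meshP np R = 2 * Real.pi * (((l : ℕ) : ℝ) / 2 ^ np) - Real.pi := by
  unfold eta meshP
  field_simp

lemma abs_eta_mul_meshP_le (hR : 0 < R) (l : QReg np) : |eta np R l * meshP np R| ≤ Real.pi := by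
  rw [eta_mul_meshP hR, abs_le]
  have h0 : 0 ≤ ((l : ℕ) : ℝ) / 2 ^ np := by positivity
  have h1 : ((l : ℕ) : ℝ) / 2 ^ np ≤ 1 := by
    rw [div_le_one (by positivity)]
    exact_mod_cast l.2.le
  have := Real.pi_pos
  constructor <;> nlinarith

/-- A geometric series of `N_p`-th roots of unity. Centring the modes at `0` multiplies it by
`(-1)^m`, which is `1` for `N_p ∣ m` because `N_p` is even. -/
lemma sum_exp_eta (hR : 0 < R) (hnp : 1 ≤ np) (m : ℤ) :
    ∑ l : QReg np, Complex.exp (Complex.I * ((eta np R l * (m * meshP np R) : ℝ) : ℂ)) =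
      if ((2 ^ np : ℕ) : ℤ) ∣ m then 2 ^ np else 0 := by
  set N : ℕ := 2 ^ np
  have hN : (N : ℂ) ≠ 0 := by simp [N]
  set ω : ℂ := Complex.exp (2 * Real.pi * Complex.I * (m / N))
  have hterm : ∀ l : QReg np, Complex.exp (Complex.I * ((eta np R l * (m * meshP np R) : ℝ) : ℂ)) =
      Complex.exp (-(Real.pi * Complex.I * m)) * ω ^ (l : ℕ) := by
    intro l
    rw [← Complex.exp_nat_mul, ← Complex.exp_add]
    congr 1
    rw [show eta np R l * (m * meshP np R) = m * (eta np R l * meshP np R) by ring, eta_mul_meshP hR]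
    push_cast [N]
    ring
  simp only [hterm, ← Finset.mul_sum]
  rw [Fin.sum_univ_eq_sum_range (fun i => ω ^ i) (2 ^ np)]
  split_ifs with hd
  · obtain ⟨q, hq⟩ := hd
    have hω : ω = 1 := by
      rw [Complex.exp_eq_one_iff]
      refine ⟨q, ?_⟩
      rw [hq]; push_cast [N]; field_simp
    have hphase : Complex.exp (-(Real.pi * Complex.I * m)) = 1 := by
      rw [Complex.exp_eq_one_iff]
      refine ⟨-(2 ^ (np - 1) * q), ?_⟩
      have : (2 ^ np : ℂ) = 2 * 2 ^ (np - 1) := by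
        rw [← pow_succ']; congr 1; omega
      rw [hq]; push_cast; rw [this]; ring
    simp [hω, hphase]
  · have hω : ω ≠ 1 := by
      intro h
      rw [Complex.exp_eq_one_iff] at h
      obtain ⟨q, hq⟩ := h
      apply hd
      refine ⟨q, ?_⟩
      have h2 : (2 * (Real.pi : ℂ) * Complex.I) ≠ 0 := Complex.two_pi_I_ne_zero
      have h3 : (m : ℂ) / N = q := by
        apply mul_left_cancel₀ h2
        rw [hq]; ring
      rw [div_eq_iff hN] at h3
      have h4 : ((m : ℤ) : ℂ) = ((q * N : ℤ) : ℂ) := by push_cast; exact h3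
      have := Int.cast_injective h4
      rw [this]; ring
    have hωN : ω ^ (2 ^ np) = 1 := by
      rw [← Complex.exp_nat_mul, Complex.exp_eq_one_iff]
      refine ⟨m, ?_⟩
      change (N : ℂ) * _ = _
      field_simp
    rw [geom_sum_eq hω, hωN]; simp

/-- `Φ e^{iτD_η} Φ⁻¹`, translation by `τ` of trigonometric polynomials. -/
def transl (np : ℕ) (R τ : ℝ) : Matrix (QReg np) (QReg np) ℂ :=
  dft np R * (Matrix.diagonal fun k => Complex.exp (Complex.I * ((τ * eta np R k : ℝ) : ℂ))) *
    (dft np R).conjTranspose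

/-- On grid points, translation by a whole number of steps is a cyclic shift; the case `m = 0` is
the unitarity of the Fourier matrix. -/
lemma transl_int_apply (hR : 0 < R) (hnp : 1 ≤ np) (m : ℤ) (j j' : QReg np) :
    transl np R (m * meshP np R) j j' =
      if ((2 ^ np : ℕ) : ℤ) ∣ ((j : ℕ) : ℤ) + m - ((j' : ℕ) : ℤ) then 1 else 0 := by
  have hs : ((Real.sqrt (2 ^ np) : ℝ) : ℂ) * ((Real.sqrt (2 ^ np) : ℝ) : ℂ) = 2 ^ np := by
    rw [← Complex.ofReal_mul, Real.mul_self_sqrt (by positivity)]; push_cast; rfl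
  have hs0 : ((Real.sqrt (2 ^ np) : ℝ) : ℂ) ≠ 0 := by
    rw [Complex.ofReal_ne_zero]; positivity
  have hN : (2 ^ np : ℂ) ≠ 0 := by positivity
  have hp : ∀ k : QReg np, pGrid np R k + Real.pi * R = (k : ℕ) * meshP np R := fun k => by
    rw [pGrid_eq]; ring
  have hterm : ∀ l : QReg np, (dft np R * Matrix.diagonal fun k =>
      Complex.exp (Complex.I * ((m * meshP np R * eta np R k : ℝ) : ℂ))) j l *
        (dft np R).conjTranspose l j' = (2 ^ np : ℂ)⁻¹ *
        Complex.exp (Complex.I * ((eta np R l * ((((j : ℕ) : ℤ) + m - ((j' : ℕ) : ℤ) : ℤ) *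
          meshP np R) : ℝ) : ℂ)) := by
    intro l
    rw [Matrix.mul_diagonal, Matrix.conjTranspose_apply]
    simp only [dft, Matrix.of_apply, hp]
    rw [Complex.star_def, map_div₀, Complex.conj_ofReal, ← Complex.exp_conj, map_mul, Complex.conj_I,
      Complex.conj_ofReal, ← hs]
    rw [div_mul_eq_mul_div, div_mul_div_comm, ← Complex.exp_add, ← Complex.exp_add, div_eq_inv_mul]
    congr 2
    push_cast
    ring
  rw [transl, Matrix.mul_apply]
  simp only [hterm, ← Finset.mul_sum]
  rw [sum_exp_eta hR hnp]
  split_ifs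
  · rw [inv_mul_cancel₀ hN]
  · simp

lemma dft_mem_unitary (hR : 0 < R) (hnp : 1 ≤ np) :
    dft np R ∈ Matrix.unitaryGroup (QReg np) ℂ := by
  rw [Matrix.mem_unitaryGroup_iff, Matrix.star_eq_conjTranspose]
  have h : dft np R * (dft np R).conjTranspose = transl np R ((0 : ℤ) * meshP np R) := by
    have : (Matrix.diagonal fun k : QReg np => Complex.exp (Complex.I *
        ((((0 : ℤ) : ℝ) * meshP np R * eta np R k : ℝ) : ℂ))) = 1 := by
      simp
    rw [transl, this, mul_one]
  rw [h]
  ext j j'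
  rw [transl_int_apply hR hnp, Matrix.one_apply]
  refine if_congr ⟨fun hd => ?_, fun e => by simp [e]⟩ rfl rfl
  have h1 := j.2
  have h2 := j'.2
  rw [add_zero] at hd
  have := Int.eq_zero_of_abs_lt_dvd hd (by rw [abs_lt]; constructor <;> omega)
  exact Fin.ext (by omega)

lemma act_diagonal_apply {n : Type} [Fintype n] [DecidableEq n] (r : n → ℂ)
    (v : EuclideanSpace ℂ n) (k : n) : act (Matrix.diagonal r) v k = r k * v k := by
  simp [act_apply, Matrix.diagonal_apply]

lemma diagonal_exp_mem_unitary {n : Type} [Fintype n] [DecidableEq n] (r : n → ℝ) :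
    (Matrix.diagonal fun k => Complex.exp (Complex.I * (r k : ℂ))) ∈ Matrix.unitaryGroup n ℂ := by
  rw [Matrix.mem_unitaryGroup_iff, Matrix.star_eq_conjTranspose, Matrix.diagonal_conjTranspose,
    Matrix.diagonal_mul_diagonal, ← Matrix.diagonal_one]
  congr 1
  funext k
  rw [Pi.star_apply, Complex.star_def, Complex.mul_conj, Complex.normSq_eq_norm_sq, mul_comm,
    Complex.norm_exp_ofReal_mul_I]
  simp

lemma transl_mem_unitary (hR : 0 < R) (hnp : 1 ≤ np) (τ : ℝ) :
    transl np R τ ∈ Matrix.unitaryGroup (QReg np) ℂ :=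
  mul_mem (mul_mem (dft_mem_unitary hR hnp) (diagonal_exp_mem_unitary _))
    (conjTranspose_mem_unitary (dft_mem_unitary hR hnp))

lemma transl_add (hR : 0 < R) (hnp : 1 ≤ np) (σ τ : ℝ) :
    transl np R (σ + τ) = transl np R σ * transl np R τ := by
  have h1 : (dft np R).conjTranspose * dft np R = 1 :=
    Unitary.star_mul_self_of_mem (dft_mem_unitary hR hnp)
  have h2 : (Matrix.diagonal fun k => Complex.exp (Complex.I * (((σ + τ) * eta np R k : ℝ) : ℂ))) =
      (Matrix.diagonal fun k => Complex.exp (Complex.I * ((σ * eta np R k : ℝ) : ℂ))) *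
        Matrix.diagonal fun k => Complex.exp (Complex.I * ((τ * eta np R k : ℝ) : ℂ)) := by
    rw [Matrix.diagonal_mul_diagonal]
    congr 1
    funext k
    rw [← Complex.exp_add]
    congr 1
    push_cast
    ring
  rw [transl, h2, transl, transl]
  simp only [Matrix.mul_assoc]
  rw [← Matrix.mul_assoc (dft np R).conjTranspose (dft np R), h1, Matrix.one_mul]

/-- The chord `|e^{ix} - 1| = 2 |sin (x/2)|` increases with `|x|` up to `π`. -/
lemma norm_exp_sub_one_le {x θ : ℝ} (hx : |x| ≤ Real.pi) (h0 : 0 ≤ θ) (h1 : θ ≤ 1) :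
    ‖Complex.exp (Complex.I * ((θ * x : ℝ) : ℂ)) - 1‖ ≤
      ‖Complex.exp (Complex.I * (x : ℂ)) - 1‖ := by
  rw [Complex.norm_exp_I_mul_ofReal_sub_one, Complex.norm_exp_I_mul_ofReal_sub_one, norm_mul,
    norm_mul]
  refine mul_le_mul_of_nonneg_left ?_ (norm_nonneg _)
  have key : ∀ y : ℝ, |y| ≤ Real.pi → ‖Real.sin (y / 2)‖ = Real.sin (|y| / 2) := by
    intro y hy
    have hs : 0 ≤ Real.sin (|y| / 2) := Real.sin_nonneg_of_nonneg_of_le_pi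
      (by positivity) (by linarith [Real.pi_pos])
    rcases abs_choice y with e | e
    · rw [e] at hs ⊢
      rw [Real.norm_of_nonneg hs]
    · rw [e] at hs ⊢
      rw [neg_div, Real.sin_neg] at hs ⊢
      rw [Real.norm_of_nonpos (by linarith)]
  have hle : |θ * x| ≤ |x| := by
    rw [abs_mul, abs_of_nonneg h0]
    exact mul_le_of_le_one_left (abs_nonneg _) h1
  rw [key _ hx, key _ (hle.trans hx)]
  refine Real.sin_le_sin_of_le_of_le_pi_div_two ?_ (by linarith) (by linarith)
  have : 0 ≤ |θ * x| := abs_nonneg _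
  linarith [Real.pi_pos]

/-- Controls translations between grid points, where no pointwise formula is at hand. By Parseval it
suffices to compare the multipliers mode by mode, and `|η_k Δp| ≤ π` allows the chord comparison. -/
lemma norm_transl_sub_le (hR : 0 < R) (hnp : 1 ≤ np) {θ : ℝ} (h0 : 0 ≤ θ) (h1 : θ ≤ 1)
    (v : EuclideanSpace ℂ (QReg np)) :
    ‖act (transl np R (θ * meshP np R)) v - v‖ ≤ ‖act (transl np R (meshP np R)) v - v‖ := by
  have hU := dft_mem_unitary (R := R) hR hnp
  have key : ∀ τ, ‖act (transl np R τ) v - v‖ = ‖(WithLp.toLp 2 fun k =>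
      (Complex.exp (Complex.I * ((τ * eta np R k : ℝ) : ℂ)) - 1) *
        act (dft np R).conjTranspose v k : EuclideanSpace ℂ (QReg np))‖ := by
    intro τ
    refine Eq.trans ?_ (norm_act_of_mem_unitary hU _)
    congr 1
    nth_rw 2 [← act_self_mul_star hU v]
    rw [transl, act_mul, act_mul, ← act_sub]
    congr 1
    ext k
    rw [PiLp.sub_apply]
    have : act (Matrix.diagonal fun k => Complex.exp (Complex.I * ((τ * eta np R k : ℝ) : ℂ)))
        (act (dft np R).conjTranspose v) k =
        Complex.exp (Complex.I * ((τ * eta np R k : ℝ) : ℂ)) * act (dft np R).conjTranspose v k :=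
      act_diagonal_apply _ _ _
    rw [this]
    ring
  rw [key, key]
  refine (sq_le_sq₀ (norm_nonneg _) (norm_nonneg _)).1 ?_
  rw [EuclideanSpace.norm_sq_eq, EuclideanSpace.norm_sq_eq]
  refine Finset.sum_le_sum fun k _ => pow_le_pow_left₀ (norm_nonneg _) ?_ 2
  rw [norm_mul, norm_mul]
  refine mul_le_mul_of_nonneg_right ?_ (norm_nonneg _)
  have := norm_exp_sub_one_le (abs_eta_mul_meshP_le hR k) h0 h1
  rwa [show θ * (eta np R k * meshP np R) = θ * meshP np R * eta np R k by ring,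
    mul_comm (eta np R k)] at this

lemma act_transl_nat (hR : 0 < R) (hnp : 1 ≤ np) (m : ℕ) (v : EuclideanSpace ℂ (QReg np))
    (j : QReg np) : act (transl np R (m * meshP np R)) v j =
      v ⟨((j : ℕ) + m) % 2 ^ np, Nat.mod_lt _ (by positivity)⟩ := by
  have h : ∀ j', transl np R (m * meshP np R) j j' =
      if j' = ⟨((j : ℕ) + m) % 2 ^ np, Nat.mod_lt _ (by positivity)⟩ then 1 else 0 := by
    intro j'
    have := transl_int_apply (R := R) hR hnp m j j'
    rw [Int.cast_natCast] at this
    rw [this]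
    refine if_congr ?_ rfl rfl
    rw [Fin.ext_iff, ← Int.modEq_iff_dvd, ← Nat.cast_add, Int.natCast_modEq_iff]
    simp only [Nat.ModEq]
    rw [Nat.mod_eq_of_lt j'.2]
  rw [act_apply]
  simp [h]

lemma abs_exp_sub_exp_le {a b δ : ℝ} (h : |a - b| ≤ δ) :
    |Real.exp (-a) - Real.exp (-b)| ≤ (Real.exp δ - 1) * Real.exp (-b) := by
  rw [abs_le] at h
  have hb := Real.exp_pos (-b)
  have e : Real.exp (-a) = Real.exp (b - a) * Real.exp (-b) := by rw [← Real.exp_add]; ring_nf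
  have h1 : Real.exp (b - a) ≤ Real.exp δ := Real.exp_le_exp.2 (by linarith)
  have h2 : Real.exp (-δ) ≤ Real.exp (b - a) := Real.exp_le_exp.2 (by linarith)
  have h3 : Real.exp δ * Real.exp (-δ) = 1 := by rw [← Real.exp_add]; simp
  have h4 : 2 ≤ Real.exp δ + Real.exp (-δ) := by
    -- `e^δ + e^{-δ} ≥ 2` shows that the lower deviation `1 - e^{-δ}` is also at most `e^δ - 1`.
    nlinarith [sq_nonneg (Real.exp δ - 1), Real.exp_pos δ, Real.exp_pos (-δ)]
  rw [e, show Real.exp (b - a) * Real.exp (-b) - Real.exp (-b) =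
    (Real.exp (b - a) - 1) * Real.exp (-b) by ring, abs_mul, abs_of_pos hb]
  refine mul_le_mul_of_nonneg_right ?_ hb.le
  rw [abs_le]
  constructor <;> linarith

lemma expVec_apply (k : QReg np) : expVec np R k = ((Real.exp (-|pGrid np R k|) : ℝ) : ℂ) := rfl

lemma norm_expVec : ‖expVec np R‖ = Ce np R := by
  rw [EuclideanSpace.norm_eq, Ce]
  congr 1
  refine Finset.sum_congr rfl fun k _ => ?_
  rw [expVec_apply, Complex.norm_real, Real.norm_of_nonneg (Real.exp_pos _).le, ← Real.exp_nat_mul]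
  congr 1
  push_cast
  ring

lemma norm_le_of_apply_le {n : Type} [Fintype n] {v w : EuclideanSpace ℂ n} {c : ℝ} (hc : 0 ≤ c)
    (h : ∀ i, ‖v i‖ ≤ c * ‖w i‖) : ‖v‖ ≤ c * ‖w‖ := by
  refine (sq_le_sq₀ (norm_nonneg _) (by positivity)).1 ?_
  rw [mul_pow, EuclideanSpace.norm_sq_eq, EuclideanSpace.norm_sq_eq, Finset.mul_sum]
  refine Finset.sum_le_sum fun i _ => ?_
  rw [← mul_pow]
  exact pow_le_pow_left₀ (norm_nonneg _) (h i) 2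

/-- A shift by one cell changes `|p|` by at most `Δp`, so each entry changes by a relative amount of
at most `e^{Δp} - 1`. -/
lemma norm_transl_meshP_expVec_sub_le (hR : 0 < R) (hnp : 1 ≤ np) :
    ‖act (transl np R (meshP np R)) (expVec np R) - expVec np R‖ ≤
      (Real.exp (meshP np R) - 1) * Ce np R := by
  have hΔ := meshP_pos (np := np) hR
  rw [← norm_expVec]
  refine norm_le_of_apply_le (by linarith [Real.add_one_le_exp (meshP np R)]) fun j => ?_
  have hsh := act_transl_nat (R := R) hR hnp 1 (expVec np R) j
  rw [Nat.cast_one, one_mul] at hsh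
  rw [PiLp.sub_apply, hsh, expVec_apply, expVec_apply, ← Complex.ofReal_sub, Complex.norm_real,
    Complex.norm_real, Real.norm_eq_abs, Real.norm_of_nonneg (Real.exp_pos _).le]
  refine abs_exp_sub_exp_le ?_
  by_cases hj : (j : ℕ) + 1 < 2 ^ np
  · refine (abs_abs_sub_abs_le_abs_sub _ _).trans ?_
    rw [pGrid_eq, pGrid_eq]
    simp only [Nat.mod_eq_of_lt hj]
    push_cast
    rw [show (((j : ℕ) : ℝ) + 1) * meshP np R - Real.pi * R -
      (((j : ℕ) : ℝ) * meshP np R - Real.pi * R) = meshP np R by ring, abs_of_pos hΔ]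
  -- The wraparound cell: `πR - Δp` is followed by `-πR`, whose absolute value is larger by only
  -- `Δp`, so the periodic continuation of `|p|` has no jump.
  · have hj' : (j : ℕ) + 1 = 2 ^ np := by have := j.2; omega
    have hN := two_pow_mul_meshP np R
    have hjr : ((j : ℕ) : ℝ) + 1 = 2 ^ np := by exact_mod_cast hj'
    rw [pGrid_eq, pGrid_eq]
    simp only [hj', Nat.mod_self]
    have h2 : (2 : ℝ) ≤ 2 ^ np := by
      calc (2 : ℝ) = 2 ^ 1 := by norm_num
        _ ≤ 2 ^ np := pow_le_pow_right₀ (by norm_num) hnp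
    have hpR : 0 < Real.pi * R := by positivity
    have e : ((j : ℕ) : ℝ) * meshP np R - Real.pi * R = Real.pi * R - meshP np R := by
      rw [← hjr] at hN; linarith
    rw [e, abs_of_nonneg (show 0 ≤ Real.pi * R - meshP np R by nlinarith)]
    simp only [Nat.cast_zero, zero_mul, zero_sub, abs_neg, abs_of_pos hpR]
    rw [sub_sub_cancel, abs_of_pos hΔ]

end Fourier

/-! ### Recovery of a decaying mode -/

section Mode

variable {np : ℕ} {R : ℝ}

/-- The restriction of a vector on the `p` register to the labels `k` with `p_k ≥ 0`. -/
def posPart (np : ℕ) (R : ℝ) : EuclideanSpace ℂ (QReg np) →ₗ[ℂ] EuclideanSpace ℂ (QReg np) where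
  toFun q := WithLp.toLp 2 fun k => if 0 ≤ pGrid np R k then q k else 0
  map_add' q r := by
    ext k
    simp only [PiLp.add_apply]
    split_ifs <;> simp
  map_smul' c q := by
    ext k
    simp

lemma posPart_apply (q : EuclideanSpace ℂ (QReg np)) (k : QReg np) :
    posPart np R q k = if 0 ≤ pGrid np R k then q k else 0 := rfl

lemma norm_posPart_le (q : EuclideanSpace ℂ (QReg np)) : ‖posPart np R q‖ ≤ ‖q‖ := by
  rw [← one_mul ‖q‖]
  refine norm_le_of_apply_le zero_le_one fun k => ?_
  rw [posPart_apply, one_mul]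
  split_ifs
  · exact le_rfl
  · simp

lemma norm_posPart_expVec : ‖posPart np R (expVec np R)‖ = Ce0 np R := by
  rw [EuclideanSpace.norm_eq, Ce0]
  congr 1
  refine Finset.sum_congr rfl fun k _ => ?_
  rw [posPart_apply, expVec_apply]
  split_ifs
  · rw [Complex.norm_real, Real.norm_of_nonneg (Real.exp_pos _).le, ← Real.exp_nat_mul]
    congr 1
    push_cast
    ring
  · simp

lemma norm_le_sqrt_of_apply_le {v : EuclideanSpace ℂ (QReg np)} {c : ℝ} (hc : 0 ≤ c)
    (h : ∀ k, ‖v k‖ ≤ c) : ‖v‖ ≤ Real.sqrt (2 ^ np) * c := by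
  refine (sq_le_sq₀ (norm_nonneg _) (by positivity)).1 ?_
  rw [mul_pow, Real.sq_sqrt (by positivity), EuclideanSpace.norm_sq_eq]
  refine (Finset.sum_le_sum fun k _ => pow_le_pow_left₀ (norm_nonneg _) (h k) 2).trans ?_
  simp

lemma Ce_le : Ce np R ≤ Real.sqrt (2 ^ np) := by
  rw [← norm_expVec, ← mul_one (Real.sqrt _)]
  refine norm_le_sqrt_of_apply_le zero_le_one fun k => ?_
  rw [expVec_apply, Complex.norm_real, Real.norm_of_nonneg (Real.exp_pos _).le]
  exact Real.exp_le_one_iff.2 (neg_nonpos.2 (abs_nonneg _))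

lemma abs_exp_neg_sub_le {a b : ℝ} (ha : 0 ≤ a) (hab : a ≤ b) :
    |Real.exp (-a) - Real.exp (-b)| ≤ b - a := by
  have h1 : Real.exp (-b) ≤ Real.exp (-a) := Real.exp_le_exp.2 (by linarith)
  have h2 : Real.exp (-b) = Real.exp (-a) * Real.exp (-(b - a)) := by
    rw [← Real.exp_add]; ring_nf
  have h3 : Real.exp (-a) ≤ 1 := Real.exp_le_one_iff.2 (by linarith)
  have h4 := Real.add_one_le_exp (-(b - a))
  rw [abs_of_nonneg (by linarith), h2]
  nlinarith [Real.exp_pos (-a)]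

/-- Where `p ≥ 0` and the shift does not wrap, the shifted profile is exactly exponential and only
rounding `τ` down to the mesh costs up to `Δp`. Where it wraps, both compared values are at most
`e^{τ - πR}`. -/
lemma norm_shift_recovery_le (hR : 0 < R) (hnp : 1 ≤ np) {τ : ℝ} (h0 : 0 ≤ τ)
    (hτ : τ ≤ Real.pi * R) :
    ‖posPart np R (act (transl np R (⌊τ / meshP np R⌋₊ * meshP np R)) (expVec np R) -
      ((Real.exp (-τ) : ℝ) : ℂ) • expVec np R)‖ ≤
      Real.sqrt (2 ^ np) * (meshP np R + Real.exp (τ - Real.pi * R)) := by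
  have hΔ := meshP_pos (np := np) hR
  have hN := two_pow_mul_meshP np R
  set Δ := meshP np R
  set m := ⌊τ / Δ⌋₊
  have hm1 : m * Δ ≤ τ := by
    have := Nat.floor_le (div_nonneg h0 hΔ.le)
    rwa [le_div_iff₀ hΔ] at this
  have hm2 : τ < m * Δ + Δ := by
    have := Nat.lt_floor_add_one (τ / Δ)
    rw [div_lt_iff₀ hΔ] at this
    linarith
  have hmN : m < 2 ^ np := by
    have h1 : (m : ℝ) * Δ < 2 ^ np * Δ := by
      have : 0 < Real.pi * R := by positivity
      linarith
    exact_mod_cast lt_of_mul_lt_mul_right h1 hΔ.le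
  refine norm_le_sqrt_of_apply_le (by positivity) fun j => ?_
  rw [posPart_apply]
  split_ifs with hp
  swap
  · rw [norm_zero]; positivity
  rw [PiLp.sub_apply, act_transl_nat hR hnp, PiLp.smul_apply, smul_eq_mul, expVec_apply,
    expVec_apply, ← Complex.ofReal_mul, ← Complex.ofReal_sub, Complex.norm_real, Real.norm_eq_abs,
    ← Real.exp_add, abs_of_nonneg hp, ← neg_add]
  rw [pGrid_eq] at hp
  by_cases hj : (j : ℕ) + m < 2 ^ np
  · rw [pGrid_eq, pGrid_eq]
    simp only [Nat.mod_eq_of_lt hj]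
    push_cast
    have hpos : 0 ≤ (((j : ℕ) : ℝ) + m) * Δ - Real.pi * R := by nlinarith
    change |Real.exp (-|(((j : ℕ) : ℝ) + m) * Δ - Real.pi * R|) - _| ≤ _
    rw [abs_of_nonneg hpos]
    refine (abs_exp_neg_sub_le hpos (by nlinarith)).trans ?_
    nlinarith [Real.exp_pos (τ - Real.pi * R)]
  -- A single subtraction of `N_p` suffices, because `τ ≤ πR` keeps the shift below one period.
  · have hmod : ((j : ℕ) + m) % 2 ^ np = (j : ℕ) + m - 2 ^ np := by
      rw [Nat.mod_eq_sub_mod (by omega), Nat.mod_eq_of_lt]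
      have := j.2; omega
    have hjr : (2 : ℝ) ^ np ≤ ((j : ℕ) : ℝ) + m := by exact_mod_cast not_lt.1 hj
    have hjr2 : ((j : ℕ) : ℝ) ≤ 2 ^ np := by exact_mod_cast j.2.le
    rw [pGrid_eq, pGrid_eq]
    simp only [hmod]
    rw [Nat.cast_sub (not_lt.1 hj)]
    push_cast
    change |Real.exp (-|(((j : ℕ) : ℝ) + m - 2 ^ np) * Δ - Real.pi * R|) -
      Real.exp (-(τ + (((j : ℕ) : ℝ) * Δ - Real.pi * R)))| ≤ _
    have e1 : (((j : ℕ) : ℝ) + m - 2 ^ np) * Δ - Real.pi * R ≤ τ - Real.pi * R := by nlinarith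
    have e2 : Real.exp (-|(((j : ℕ) : ℝ) + m - 2 ^ np) * Δ - Real.pi * R|) ≤
        Real.exp (τ - Real.pi * R) := by
      refine Real.exp_le_exp.2 ?_
      have := neg_abs_le ((((j : ℕ) : ℝ) + m - 2 ^ np) * Δ - Real.pi * R)
      linarith
    have e3 : Real.exp (-(τ + (((j : ℕ) : ℝ) * Δ - Real.pi * R))) ≤
        Real.exp (τ - Real.pi * R) := by
      refine Real.exp_le_exp.2 ?_
      nlinarith
    have e4 := Real.exp_pos (-|(((j : ℕ) : ℝ) + m - 2 ^ np) * Δ - Real.pi * R|)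
    have e5 := Real.exp_pos (-(τ + (((j : ℕ) : ℝ) * Δ - Real.pi * R)))
    rw [abs_le]
    constructor <;> linarith

/-- Splits `τ` into whole mesh steps and a fraction of one step; the fraction costs at most as much
as one whole step. -/
lemma norm_mode_recovery_le (hR : 0 < R) (hnp : 1 ≤ np) {τ : ℝ} (h0 : 0 ≤ τ)
    (hτ : τ ≤ Real.pi * R) :
    ‖posPart np R (act (transl np R τ) (expVec np R) - ((Real.exp (-τ) : ℝ) : ℂ) • expVec np R)‖ ≤
      Real.sqrt (2 ^ np) *
        ((Real.exp (meshP np R) - 1) + (meshP np R + Real.exp (τ - Real.pi * R))) := by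
  have hΔ := meshP_pos (np := np) hR
  set m := ⌊τ / meshP np R⌋₊
  set θ := τ / meshP np R - m
  have hθ0 : 0 ≤ θ := sub_nonneg.2 (Nat.floor_le (div_nonneg h0 hΔ.le))
  have hθ1 : θ ≤ 1 := by
    have := Nat.lt_floor_add_one (τ / meshP np R)
    simp only [θ, m]; linarith
  have hτe : τ = m * meshP np R + θ * meshP np R := by
    simp only [θ]; field_simp; ring
  have h1 : ‖act (transl np R τ) (expVec np R) -
      act (transl np R (m * meshP np R)) (expVec np R)‖ ≤
      Real.sqrt (2 ^ np) * (Real.exp (meshP np R) - 1) := by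
    rw [hτe, transl_add hR hnp, act_mul, ← act_sub,
      norm_act_of_mem_unitary (transl_mem_unitary hR hnp _)]
    refine (norm_transl_sub_le hR hnp hθ0 hθ1 _).trans
      ((norm_transl_meshP_expVec_sub_le hR hnp).trans ?_)
    rw [mul_comm]
    exact mul_le_mul_of_nonneg_right Ce_le (by linarith [Real.add_one_le_exp (meshP np R)])
  have e : act (transl np R τ) (expVec np R) - ((Real.exp (-τ) : ℝ) : ℂ) • expVec np R =
      (act (transl np R τ) (expVec np R) - act (transl np R (m * meshP np R)) (expVec np R)) +
      (act (transl np R (m * meshP np R)) (expVec np R) -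
        ((Real.exp (-τ) : ℝ) : ℂ) • expVec np R) := by abel
  rw [e, map_add, mul_add]
  exact (norm_add_le _ _).trans (add_le_add ((norm_posPart_le _).trans h1)
    (norm_shift_recovery_le hR hnp h0 hτ))

/-- For `np ≥ 1` the point `p = 0` is the grid node with label `N_p / 2` and contributes `1`. -/
lemma one_le_Ce0 (hnp : 1 ≤ np) : 1 ≤ Ce0 np R := by
  rw [Ce0, Real.one_le_sqrt]
  have hlt : 2 ^ (np - 1) < 2 ^ np := Nat.pow_lt_pow_right (by norm_num) (by omega)
  have hz : pGrid np R ⟨2 ^ (np - 1), hlt⟩ = 0 := by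
    have : (2 : ℝ) ^ np = 2 * 2 ^ (np - 1) := by rw [← pow_succ']; congr 1; omega
    simp only [pGrid, this]
    push_cast
    field_simp
    ring
  refine le_trans ?_ (Finset.single_le_sum (f := fun k : QReg np =>
    if 0 ≤ pGrid np R k then Real.exp (-2 * |pGrid np R k|) else 0)
    (fun k _ => ?_) (Finset.mem_univ ⟨2 ^ (np - 1), hlt⟩))
  · simp [hz]
  · split_ifs
    · positivity
    · exact le_rfl

/-- At least `1/Δp` nodes lie in `[0, 1]`, each contributing at least `e^{-2}`, and `N_p Δp = 2πR`.
This turns the crude errors with `√N_p` into errors relative to `C_{e0}`. -/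
lemma sqrt_le_Ce0 (hnp : 1 ≤ np) (hR : 1 ≤ Real.pi * R) :
    Real.sqrt (2 ^ np) ≤ Real.exp 1 * Real.sqrt (2 * Real.pi * R) * Ce0 np R := by
  have hR0 : 0 < R := by
    by_contra h
    nlinarith [Real.pi_pos]
  have hΔ := meshP_pos (np := np) hR0
  have hN := two_pow_mul_meshP np R
  have hpow : (2 : ℝ) ^ np = 2 * 2 ^ (np - 1) := by rw [← pow_succ']; congr 1; omega
  set Δ := meshP np R
  set S : Finset (QReg np) := Finset.univ.filter fun k => 0 ≤ pGrid np R k ∧ pGrid np R k ≤ 1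
  have hcard : ⌈1 / Δ⌉₊ ≤ S.card := by
    have hi : ∀ i < ⌈1 / Δ⌉₊, (i : ℝ) * Δ < 1 := by
      intro i hi
      rw [Nat.lt_ceil, lt_div_iff₀ hΔ] at hi
      exact hi
    have hlt : ∀ i < ⌈1 / Δ⌉₊, 2 ^ (np - 1) + i < 2 ^ np := by
      intro i h
      have h1 := hi i h
      have h2 : (i : ℝ) * Δ < 2 ^ (np - 1) * Δ := by nlinarith
      have h3 : i < 2 ^ (np - 1) := by exact_mod_cast lt_of_mul_lt_mul_right h2 hΔ.le
      have h4 : 2 ^ np = 2 * 2 ^ (np - 1) := by rw [← pow_succ']; congr 1; omega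
      omega
    rw [← Finset.card_range ⌈1 / Δ⌉₊]
    refine Finset.card_le_card_of_injOn
      (fun i => if h : i < ⌈1 / Δ⌉₊ then ⟨2 ^ (np - 1) + i, hlt i h⟩ else ⟨0, by positivity⟩)
      (fun i h => ?_) fun i h j h' e => ?_
    · have h := Finset.mem_range.1 h
      simp only [h, dite_true, S, Finset.coe_filter, Finset.mem_univ, true_and, Set.mem_ofPred_eq]
      have e : pGrid np R ⟨2 ^ (np - 1) + i, hlt i h⟩ = i * Δ := by
        rw [pGrid_eq]
        push_cast
        change (2 ^ (np - 1) + (i : ℝ)) * Δ - _ = _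
        nlinarith
      rw [e]
      exact ⟨by positivity, (hi i h).le⟩
    · simp only [Finset.coe_range, Set.mem_Iio] at h h'
      simp only [h, h', dite_true, Fin.mk.injEq] at e
      omega
  have hsum : (1 / Δ) * Real.exp (-2) ≤ Ce0 np R ^ 2 := by
    have hnn : ∀ k : QReg np, 0 ≤ if 0 ≤ pGrid np R k then Real.exp (-2 * |pGrid np R k|) else 0 := by
      intro k; split_ifs
      · positivity
      · exact le_rfl
    rw [Ce0, Real.sq_sqrt (Finset.sum_nonneg fun k _ => hnn k)]
    calc (1 / Δ) * Real.exp (-2) ≤ S.card * Real.exp (-2) := by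
          refine mul_le_mul_of_nonneg_right ?_ (Real.exp_pos _).le
          exact (Nat.le_ceil _).trans (by exact_mod_cast hcard)
      _ = ∑ k ∈ S, Real.exp (-2) := by simp
      _ ≤ ∑ k ∈ S, if 0 ≤ pGrid np R k then Real.exp (-2 * |pGrid np R k|) else 0 := by
          refine Finset.sum_le_sum fun k hk => ?_
          have hk := (Finset.mem_filter.1 hk).2
          rw [if_pos hk.1, abs_of_nonneg hk.1]
          exact Real.exp_le_exp.2 (by linarith [hk.2])
      _ ≤ _ := Finset.sum_le_sum_of_subset_of_nonneg (Finset.filter_subset _ _) fun k _ _ => hnn k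
  have hc0 : 0 ≤ Ce0 np R := Real.sqrt_nonneg _
  refine Real.sqrt_le_iff.2 ⟨by positivity, ?_⟩
  rw [mul_pow, mul_pow, Real.sq_sqrt (by positivity), ← hN]
  have he : Real.exp 1 ^ 2 * Real.exp (-2) = 1 := by
    rw [← Real.exp_nat_mul, ← Real.exp_add]; norm_num
  calc (2 : ℝ) ^ np = Real.exp 1 ^ 2 * (2 ^ np * Δ) * ((1 / Δ) * Real.exp (-2)) := by
        have : Real.exp 1 ^ 2 * (2 ^ np * Δ) * ((1 / Δ) * Real.exp (-2)) =
          2 ^ np * (Real.exp 1 ^ 2 * Real.exp (-2)) * (Δ * (1 / Δ)) := by ring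
        rw [this, he, mul_one_div_cancel hΔ.ne']; ring
    _ ≤ _ := mul_le_mul_of_nonneg_left hsum (by positivity)

/-- Uniform recovery of decaying modes, relative to `C_{e0}`. -/
lemma exists_mode_recovery (τm : ℝ) {ε : ℝ} (hε : 0 < ε) :
    ∃ R₀ : ℝ, 0 < R₀ ∧ ∀ R, R₀ ≤ R → ∃ n₀ : ℕ, ∀ np, n₀ ≤ np → 1 ≤ np ∧
      ∀ τ, 0 ≤ τ → τ ≤ τm →
        ‖posPart np R (act (transl np R τ) (expVec np R) -
          ((Real.exp (-τ) : ℝ) : ℂ) • expVec np R)‖ ≤ ε * Ce0 np R := by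
  -- `R` is fixed first: the wraparound error decays like `√R e^{-πR}`, uniformly in the mesh.
  have hlim : Filter.Tendsto (fun R : ℝ => Real.exp 1 * Real.sqrt (2 * Real.pi * R) *
      Real.exp (τm - Real.pi * R)) Filter.atTop (nhds 0) := by
    have h1 : Filter.Tendsto (fun x : ℝ => x ^ (1 / 2 : ℝ) * Real.exp (-1 * x)) Filter.atTop (nhds 0) :=
      tendsto_rpow_mul_exp_neg_mul_atTop_nhds_zero _ _ one_pos
    have h2 := (h1.comp (Filter.tendsto_id.const_mul_atTop Real.pi_pos)).const_mul
      (Real.exp 1 * Real.sqrt 2 * Real.exp τm)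
    rw [mul_zero] at h2
    refine h2.congr fun R => ?_
    simp only [Function.comp, id]
    rw [← Real.sqrt_eq_rpow, mul_assoc 2, Real.sqrt_mul (by norm_num) (Real.pi * R), sub_eq_add_neg, Real.exp_add]
    ring_nf
  obtain ⟨R₁, hR₁⟩ := Filter.eventually_atTop.1 (hlim.eventually_lt_const (half_pos hε))
  refine ⟨max (max R₁ τm) 1, lt_of_lt_of_le one_pos (le_max_right _ _), fun R hR => ?_⟩
  have hRR₁ : R₁ ≤ R := (le_max_left _ _).trans ((le_max_left _ _).trans hR)
  have hRτ : τm ≤ R := (le_max_right _ _).trans ((le_max_left _ _).trans hR)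
  have hR1 : 1 ≤ R := (le_max_right _ _).trans hR
  have hR0 : 0 < R := by linarith
  have hpi : R ≤ Real.pi * R := by nlinarith [Real.pi_gt_three]
  have hmesh : Filter.Tendsto (fun np : ℕ => meshP np R) Filter.atTop (nhds 0) := by
    unfold meshP
    exact tendsto_const_nhds.div_atTop (tendsto_pow_atTop_atTop_of_one_lt (by norm_num))
  -- For this fixed `R` the remaining error depends only on the mesh size and vanishes as `np`
  -- grows.
  have hlim2 : Filter.Tendsto (fun np : ℕ => Real.exp 1 * Real.sqrt (2 * Real.pi * R) *
      ((Real.exp (meshP np R) - 1) + meshP np R)) Filter.atTop (nhds 0) := by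
    have h := ((((Real.continuous_exp.tendsto 0).comp hmesh).sub_const 1).add hmesh).const_mul
      (Real.exp 1 * Real.sqrt (2 * Real.pi * R))
    simpa using h
  obtain ⟨n₁, hn₁⟩ := Filter.eventually_atTop.1 (hlim2.eventually_lt_const (half_pos hε))
  refine ⟨max n₁ 1, fun np hnp => ⟨(le_max_right _ _).trans hnp, fun τ h0 hτ => ?_⟩⟩
  have hnp1 : 1 ≤ np := (le_max_right _ _).trans hnp
  have h1 := hR₁ R hRR₁
  have h2 := hn₁ np ((le_max_left _ _).trans hnp)
  have hΔ := meshP_pos (np := np) hR0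
  have hb : 0 ≤ (Real.exp (meshP np R) - 1) + (meshP np R + Real.exp (τ - Real.pi * R)) := by
    have := Real.add_one_le_exp (meshP np R)
    have := Real.exp_pos (τ - Real.pi * R)
    linarith
  have h3 : Real.exp (τ - Real.pi * R) ≤ Real.exp (τm - Real.pi * R) :=
    Real.exp_le_exp.2 (by linarith)
  have hC : 0 ≤ Ce0 np R := Real.sqrt_nonneg _
  have hK : 0 ≤ Real.exp 1 * Real.sqrt (2 * Real.pi * R) := by positivity
  calc _ ≤ _ := norm_mode_recovery_le hR0 hnp1 h0 (by linarith)
    _ ≤ _ := mul_le_mul_of_nonneg_right (sqrt_le_Ce0 hnp1 (hR1.trans hpi)) hb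
    _ = (Real.exp 1 * Real.sqrt (2 * Real.pi * R) * ((Real.exp (meshP np R) - 1) + meshP np R) +
        Real.exp 1 * Real.sqrt (2 * Real.pi * R) * Real.exp (τ - Real.pi * R)) * Ce0 np R := by ring
    _ ≤ ε * Ce0 np R := by
        refine mul_le_mul_of_nonneg_right ?_ hC
        nlinarith [mul_le_mul_of_nonneg_left h3 hK]

end Mode

/-! ### Variation of constants -/

section Duhamel

variable {X : Type} [Fintype X] [DecidableEq X]

/-- `act` as a continuous bilinear map. -/
def actBil (X : Type) [Fintype X] [DecidableEq X] :
    Matrix X X ℂ →L[ℝ] EuclideanSpace ℂ X →L[ℝ] EuclideanSpace ℂ X :=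
  LinearMap.mkContinuous₂
    (LinearMap.mk₂ ℝ act add_act
      (fun c M v => by simpa only [Complex.coe_smul] using smul_act (c : ℂ) M v)
      act_add (fun c M v => by simpa only [Complex.coe_smul] using act_smul M (c : ℂ) v)) 1
    fun M v => by rw [one_mul]; exact norm_act_le M v

@[simp] lemma actBil_apply (M : Matrix X X ℂ) (v : EuclideanSpace ℂ X) :
    actBil X M v = act M v := rfl

lemma continuousOn_act {s : Set ℝ} {M : ℝ → Matrix X X ℂ} {v : ℝ → EuclideanSpace ℂ X}
    (hM : ContinuousOn M s) (hv : ContinuousOn v s) : ContinuousOn (fun t => act (M t) (v t)) s :=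
  ((actBil X).continuous.comp_continuousOn hM).clm_apply hv

lemma hasDerivAt_act {M : ℝ → Matrix X X ℂ} {M' : Matrix X X ℂ} {v : ℝ → EuclideanSpace ℂ X}
    {v' : EuclideanSpace ℂ X} {t : ℝ} (hM : HasDerivAt M M' t) (hv : HasDerivAt v v' t) :
    HasDerivAt (fun t => act (M t) (v t)) (act (M t) v' + act M' (v t)) t := by
  have h := (actBil X).hasDerivWithinAt_of_bilinear hM.hasDerivWithinAt
    (hv.hasDerivWithinAt (s := Set.univ))
  rw [hasDerivWithinAt_univ] at h
  exact h

/-- `e^{tA}`. -/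
def expA (A : Matrix X X ℂ) (t : ℝ) : Matrix X X ℂ := NormedSpace.exp (t • A)

lemma hasDerivAt_expA (A : Matrix X X ℂ) (t : ℝ) :
    HasDerivAt (expA A) (expA A t * A) t := hasDerivAt_exp_smul_const (𝕂 := ℝ) A t

lemma continuous_expA (A : Matrix X X ℂ) : Continuous (expA A) :=
  continuous_iff_continuousAt.2 fun t => (hasDerivAt_expA A t).continuousAt

lemma expA_zero (A : Matrix X X ℂ) : expA A 0 = 1 := by
  simp [expA, NormedSpace.exp_zero]

lemma continuousOn_const_sub {Y : Type*} [TopologicalSpace Y] {T : ℝ} {g : ℝ → Y}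
    (hg : Continuous g) (s : Set ℝ) : ContinuousOn (fun t => g (T - t)) s :=
  (hg.comp (continuous_const.sub continuous_id)).continuousOn

/-- Integrates the derivative of `e^{(T-s)A} u(s)`, in which the terms with `A u` cancel. One-sided
derivatives at the end points are harmless, since continuity suffices there. -/
lemma SolvesODE.eq_duhamel {A : Matrix X X ℂ} {f u : ℝ → EuclideanSpace ℂ X} {T : ℝ} (hT : 0 ≤ T)
    (hf : ContinuousOn f (Set.Icc 0 T)) (hu : SolvesODE A f T u) :
    u T = act (expA A T) (u 0) + ∫ s in (0 : ℝ)..T, act (expA A (T - s)) (f s) := by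
  have huc : ContinuousOn u (Set.Icc 0 T) := fun t ht => (hu t ht).continuousWithinAt
  have h := intervalIntegral.integral_eq_sub_of_hasDerivAt_of_le
    (f := fun s => act (expA A (T - s)) (u s)) (f' := fun s => act (expA A (T - s)) (f s)) hT
    (continuousOn_act (continuousOn_const_sub (continuous_expA A) _) huc) (fun s hs => by
      have h1 : HasDerivAt (fun s => expA A (T - s)) (-(expA A (T - s) * A)) s := by
        have := (hasDerivAt_expA A (T - s)).scomp s ((hasDerivAt_id s).const_sub T)
        rw [neg_one_smul] at this
        exact this
      have h2 := (hu s (Set.Ioo_subset_Icc_self hs)).hasDerivAt (Icc_mem_nhds hs.1 hs.2)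
      refine (hasDerivAt_act h1 h2).congr_deriv ?_
      rw [act_add, ← neg_one_smul ℂ, smul_act, act_mul]
      simp)
    ((continuousOn_act (continuousOn_const_sub (continuous_expA A) _) hf).intervalIntegrable_of_Icc
      hT)
  rw [h]
  simp [expA_zero]

lemma act_exp_of_eigenvector {M : Matrix X X ℂ} {v : EuclideanSpace ℂ X} {μ : ℂ}
    (h : act M v = μ • v) : act (NormedSpace.exp M) v = Complex.exp μ • v := by
  have hpow : ∀ n : ℕ, act (M ^ n) v = μ ^ n • v := by
    intro n
    induction n with
    | zero => simp
    | succ n ih => rw [pow_succ, act_mul, h, act_smul, ih, smul_smul, pow_succ, mul_comm]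
  let L : Matrix X X ℂ →ₗ[ℂ] EuclideanSpace ℂ X :=
    { toFun := fun M => act M v
      map_add' := fun M N => add_act M N v
      map_smul' := fun c M => smul_act c M v }
  have h1 := (NormedSpace.exp_series_hasSum_exp' (𝕂 := ℂ) M).mapL L.toContinuousLinearMap
  have h2 : HasSum (fun n : ℕ => ((n.factorial : ℂ)⁻¹ • μ ^ n) • v) (Complex.exp μ • v) := by
    rw [Complex.exp_eq_exp_ℂ]
    exact (NormedSpace.exp_series_hasSum_exp' (𝕂 := ℂ) μ).smul_const v
  refine h1.unique ?_
  convert h2 using 2 with n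
  change act ((n.factorial : ℂ)⁻¹ • M ^ n) v = _
  rw [smul_act, hpow, smul_smul, smul_eq_mul]

end Duhamel

/-! ### Resolution by large intervals and fine meshes -/

section Resolution

variable {X : Type} [Fintype X] [DecidableEq X] {np : ℕ} {R : ℝ}

lemma lift_eq_tens (v : EuclideanSpace ℂ X) :
    lift np R v = tens v (act (dft np R).conjTranspose (expVec np R)) := by
  rw [lift, fourierX, Matrix.conjTranspose_kronecker, act_kronecker_tens, Matrix.conjTranspose_one,
    act_one]

/-- `lift` as a continuous linear map. -/
def liftL (X : Type) [Fintype X] [DecidableEq X] (np : ℕ) (R : ℝ) :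
    EuclideanSpace ℂ X →L[ℂ] EuclideanSpace ℂ (X × QReg np) :=
  tensL (act (dft np R).conjTranspose (expVec np R))

@[simp] lemma liftL_apply (v : EuclideanSpace ℂ X) : liftL X np R v = lift np R v :=
  (lift_eq_tens v).symm

lemma norm_lift (hR : 0 < R) (hnp : 1 ≤ np) (v : EuclideanSpace ℂ X) :
    ‖lift np R v‖ = Ce np R * ‖v‖ := by
  rw [lift_eq_tens, norm_tens,
    norm_act_of_mem_unitary (conjTranspose_mem_unitary (dft_mem_unitary hR hnp)), norm_expVec,
    mul_comm]

lemma fourierX_mem_unitary (hR : 0 < R) (hnp : 1 ≤ np) :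
    fourierX X np R ∈ Matrix.unitaryGroup (X × QReg np) ℂ :=
  Matrix.kronecker_mem_unitary (one_mem _) (dft_mem_unitary hR hnp)

/-- `restrictPos` as a continuous linear map. -/
def restrictPosL (X : Type) [Fintype X] (np : ℕ) (R : ℝ) :
    EuclideanSpace ℂ (X × QReg np) →L[ℂ] EuclideanSpace ℂ (X × QReg np) :=
  LinearMap.toContinuousLinearMap
    { toFun := restrictPos np R
      map_add' := fun v w => by
        ext i
        simp only [restrictPos, PiLp.add_apply]
        split_ifs <;> simp
      map_smul' := fun c v => by
        ext i
        simp [restrictPos] }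

@[simp] lemma restrictPosL_apply (w : EuclideanSpace ℂ (X × QReg np)) :
    restrictPosL X np R w = restrictPos np R w := rfl

lemma restrictPos_sub (v w : EuclideanSpace ℂ (X × QReg np)) :
    restrictPos np R (v - w) = restrictPos np R v - restrictPos np R w :=
  map_sub (restrictPosL X np R) v w

lemma restrictPos_tens (v : EuclideanSpace ℂ X) (q : EuclideanSpace ℂ (QReg np)) :
    restrictPos np R (tens v q) = tens v (posPart np R q) := by
  ext i
  simp [restrictPos, tens, posPart_apply]

lemma norm_restrictPos_le (w : EuclideanSpace ℂ (X × QReg np)) : ‖restrictPos np R w‖ ≤ ‖w‖ := by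
  rw [← one_mul ‖w‖]
  refine norm_le_of_apply_le zero_le_one fun i => ?_
  simp only [restrictPos]
  rw [one_mul]
  split_ifs
  · exact le_rfl
  · simp

/-- On an eigenvector of `A` the flow leaves the space register alone and only puts phases on the
Fourier modes. -/
lemma act_evolH_tens {A : Matrix X X ℂ} {v : EuclideanSpace ℂ X} {μ : ℝ}
    (h : act A v = (μ : ℂ) • v) (s : ℝ) (q : EuclideanSpace ℂ (QReg np)) :
    act (evolH A np R s) (tens v q) = tens v (act (Matrix.diagonal fun k =>
      Complex.exp (Complex.I * ((-μ * s * eta np R k : ℝ) : ℂ))) q) := by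
  ext ⟨x, k⟩
  have h1 : act (NormedSpace.exp ((Complex.I * ((-(s * eta np R k) : ℝ) : ℂ)) • A)) v =
      Complex.exp (Complex.I * ((-μ * s * eta np R k : ℝ) : ℂ)) • v := by
    apply act_exp_of_eigenvector
    rw [smul_act, h, smul_smul]
    congr 1
    push_cast
    ring
  have h2 := congrArg (fun w : EuclideanSpace ℂ X => w x) h1
  simp only [act_apply, PiLp.smul_apply, smul_eq_mul] at h2
  rw [evolH_eq_blockDiagonal, act_apply]
  simp only [tens, act_diagonal_apply, Matrix.blockDiagonal_apply, Fintype.sum_prod_type, ite_mul,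
    zero_mul, Finset.sum_ite_eq, Finset.mem_univ, if_true]
  simp only [← mul_assoc]
  rw [← Finset.sum_mul, h2]
  ring

/-- The deviation from the recovery relation for the homogeneous problem. -/
def recoveryDefect (A : Matrix X X ℂ) (np : ℕ) (R t : ℝ) :
    EuclideanSpace ℂ X →L[ℂ] EuclideanSpace ℂ (X × QReg np) :=
  restrictPosL X np R ∘L (actL (fourierX X np R) ∘L actL (evolH A np R t) ∘L liftL X np R -
    tensL (expVec np R) ∘L actL (expA A t))

lemma recoveryDefect_apply (A : Matrix X X ℂ) (t : ℝ) (v : EuclideanSpace ℂ X) :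
    recoveryDefect A np R t v = restrictPos np R (act (fourierX X np R)
      (act (evolH A np R t) (lift np R v))) -
        restrictPos np R (tens (act (expA A t) v) (expVec np R)) := by
  simp [recoveryDefect]

/-- Conjugated by `Φ`, the phases are a translation by `τ = -μt`, while `e^{tA}` multiplies by
`e^{-τ}`. The defect is therefore that of the single profile `e^{-|p|}`. -/
lemma recoveryDefect_eigenvector {A : Matrix X X ℂ} {v : EuclideanSpace ℂ X} {μ : ℝ}
    (h : act A v = (μ : ℂ) • v) (t : ℝ) :
    recoveryDefect A np R t v = tens v (posPart np R (act (transl np R (-μ * t)) (expVec np R) -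
      ((Real.exp (-(-μ * t)) : ℝ) : ℂ) • expVec np R)) := by
  have h1 : act (expA A t) v = ((Real.exp (-(-μ * t)) : ℝ) : ℂ) • v := by
    rw [Complex.ofReal_exp]
    apply act_exp_of_eigenvector
    rw [← Complex.coe_smul, smul_act, h, smul_smul]
    congr 1
    push_cast
    ring
  rw [recoveryDefect_apply, h1, lift_eq_tens, act_evolH_tens h, fourierX, act_kronecker_tens,
    act_one, tens_smul_left, ← tens_smul_right, ← restrictPos_sub, ← tens_sub_right,
    restrictPos_tens, transl, act_mul, act_mul]

lemma neg_act (M : Matrix X X ℂ) (v : EuclideanSpace ℂ X) : act (-M) v = -act M v := by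
  simp [act]

/-- Expansion in an orthonormal eigenbasis of `-A`, whose eigenvalues lie in `[0, ‖A‖]`. The crude
factor `Fintype.card X` is harmless, since `R` and `np` are chosen after `A`. -/
lemma norm_recoveryDefect_le {A : Matrix X X ℂ} (hA : (-A).PosSemidef) {T t c : ℝ}
    (ht : t ∈ Set.Icc 0 T) (hc : 0 ≤ c)
    (h : ∀ τ, 0 ≤ τ → τ ≤ ‖A‖ * T → ‖posPart np R (act (transl np R τ) (expVec np R) -
      ((Real.exp (-τ) : ℝ) : ℂ) • expVec np R)‖ ≤ c) (v : EuclideanSpace ℂ X) :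
    ‖recoveryDefect A np R t v‖ ≤ Fintype.card X * c * ‖v‖ := by
  have hH := hA.isHermitian
  set b := hH.eigenvectorBasis
  have hb : ∀ i, ‖b i‖ = 1 := b.orthonormal.1
  have heig : ∀ i, act A (b i) = ((-hH.eigenvalues i : ℝ) : ℂ) • b i := by
    intro i
    have h1 : act (-A) (b i) = ((hH.eigenvalues i : ℝ) : ℂ) • b i := by
      ext x
      have := congrFun (hH.mulVec_eigenvectorBasis i) x
      change (-A).mulVec (hH.eigenvectorBasis i).ofLp x = _
      simpa using this
    rw [neg_act] at h1
    rw [Complex.ofReal_neg, neg_smul, ← h1, neg_neg]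
  have hbound : ∀ i, ‖recoveryDefect A np R t (b i)‖ ≤ c := by
    intro i
    have h0 := hA.eigenvalues_nonneg i
    have h1 : hH.eigenvalues i ≤ ‖A‖ := by
      have := norm_act_le A (b i)
      rw [heig, norm_smul, hb, mul_one, mul_one, Complex.norm_real, norm_neg,
        Real.norm_of_nonneg h0] at this
      exact this
    rw [recoveryDefect_eigenvector (heig i), norm_tens, hb, one_mul, neg_neg]
    exact h _ (mul_nonneg h0 ht.1) (mul_le_mul h1 ht.2 ht.1 (norm_nonneg _))
  conv_lhs => rw [← b.sum_repr v, map_sum]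
  refine (norm_sum_le _ _).trans ?_
  have : ∀ i ∈ Finset.univ, ‖recoveryDefect A np R t (b.repr v i • b i)‖ ≤ c * ‖v‖ := by
    intro i _
    rw [map_smul, norm_smul, mul_comm]
    refine mul_le_mul (hbound i) ?_ (norm_nonneg _) hc
    rw [← b.repr.norm_map v]
    exact PiLp.norm_apply_le _ i
  refine (Finset.sum_le_sum this).trans ?_
  simp [mul_assoc]

/-- `w̃(T)` and `u(T)` are given by variation of constants with the same data, so linearity reduces
the inhomogeneous recovery error to homogeneous ones with running times `T` and `T - s`. -/
lemma recovery_eq {A : Matrix X X ℂ} {f u : ℝ → EuclideanSpace ℂ X} {T : ℝ} (hT : 0 ≤ T)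
    (hf : ContinuousOn f (Set.Icc 0 T)) (hu : SolvesODE A f T u) :
    restrictPos np R (act (fourierX X np R) (wTilde A f (u 0) np R T)) -
      restrictPos np R (tens (u T) (expVec np R)) =
    recoveryDefect A np R T (u 0) + ∫ s in (0 : ℝ)..T, recoveryDefect A np R (T - s) (f s) := by
  have hc1 : ContinuousOn (fun s => act (evolH A np R (T - s)) (lift np R (f s))) (Set.Icc 0 T) := by
    refine continuousOn_act (continuousOn_const_sub (continuous_evolH A np R) _) ?_
    simpa [Function.comp_def] using (liftL X np R).continuous.comp_continuousOn hf
  have hc2 : ContinuousOn (fun s => act (expA A (T - s)) (f s)) (Set.Icc 0 T) :=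
    continuousOn_act (continuousOn_const_sub (continuous_expA A) _) hf
  have hi1 := hc1.intervalIntegrable_of_Icc (μ := MeasureTheory.volume) hT
  have hi2 := hc2.intervalIntegrable_of_Icc (μ := MeasureTheory.volume) hT
  set L1 := restrictPosL X np R ∘L actL (fourierX X np R)
  set L2 := restrictPosL X np R ∘L tensL (expVec np R)
  have e1 : restrictPos np R (act (fourierX X np R) (wTilde A f (u 0) np R T)) =
      L1 (act (evolH A np R T) (lift np R (u 0))) +
        ∫ s in (0 : ℝ)..T, L1 (act (evolH A np R (T - s)) (lift np R (f s))) := by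
    rw [L1.intervalIntegral_comp_comm hi1, ← map_add]; rfl
  have e2 : restrictPos np R (tens (u T) (expVec np R)) =
      L2 (act (expA A T) (u 0)) + ∫ s in (0 : ℝ)..T, L2 (act (expA A (T - s)) (f s)) := by
    rw [L2.intervalIntegral_comp_comm hi2, ← map_add, ← hu.eq_duhamel hT hf]; rfl
  have hint := intervalIntegral.integral_sub
    ((L1.continuous.comp_continuousOn hc1).intervalIntegrable_of_Icc (μ := MeasureTheory.volume) hT)
    ((L2.continuous.comp_continuousOn hc2).intervalIntegrable_of_Icc (μ := MeasureTheory.volume) hT)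
  simp only [Function.comp_def] at hint
  rw [e1, e2, add_sub_add_comm, ← hint]
  simp only [recoveryDefect_apply]
  rfl

lemma exists_resolved {A : Matrix X X ℂ} {f u : ℝ → EuclideanSpace ℂ X} {T ε : ℝ}
    (hA : (-A).PosSemidef) (hT : 0 < T) (hε : 0 < ε) (hf : ContinuousOn f (Set.Icc 0 T))
    (hu : SolvesODE A f T u) (huT : u T ≠ 0) :
    ∃ R₀ : ℝ, 0 < R₀ ∧ ∀ R, R₀ ≤ R → ∃ n₀ : ℕ, ∀ np, n₀ ≤ np → Resolved A f u np R T ε := by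
  set I : ℝ := ‖u 0‖ + ∫ s in (0 : ℝ)..T, ‖f s‖
  have hI : 0 ≤ I := add_nonneg (norm_nonneg _)
    (intervalIntegral.integral_nonneg hT.le fun s _ => norm_nonneg _)
  have huT' : 0 < ‖u T‖ := norm_pos_iff.2 huT
  set c : ℝ := (Fintype.card X : ℝ)
  have hc : 0 ≤ c := Nat.cast_nonneg _
  -- Compensates the dimension factor `c` and the size `I` of the data; the `+ 1` keeps the
  -- denominator positive.
  set ε' : ℝ := ε * ‖u T‖ / (c * I + 1)
  have hden : 0 < c * I + 1 := by positivity
  have hε' : 0 < ε' := by positivity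
  obtain ⟨R₀, hR₀, h⟩ := exists_mode_recovery (‖A‖ * T) hε'
  refine ⟨R₀, hR₀, fun R hR => ?_⟩
  obtain ⟨n₀, hn₀⟩ := h R hR
  refine ⟨n₀, fun np hnp => ?_⟩
  obtain ⟨-, hm⟩ := hn₀ np hnp
  have hC : 0 ≤ Ce0 np R := Real.sqrt_nonneg _
  set κ := c * (ε' * Ce0 np R)
  have hdef : ∀ t ∈ Set.Icc 0 T, ∀ v, ‖recoveryDefect A np R t v‖ ≤ κ * ‖v‖ := fun t ht v =>
    norm_recoveryDefect_le hA ht (by positivity) hm v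
  rw [Resolved, recovery_eq hT.le hf hu]
  have hfi : IntervalIntegrable (fun s => κ * ‖f s‖) MeasureTheory.volume 0 T :=
    (continuousOn_const.mul hf.norm).intervalIntegrable_of_Icc hT.le
  have h1 : ‖∫ s in (0 : ℝ)..T, recoveryDefect A np R (T - s) (f s)‖ ≤
      ∫ s in (0 : ℝ)..T, κ * ‖f s‖ := by
    refine intervalIntegral.norm_integral_le_of_norm_le hT.le
      (Filter.Eventually.of_forall fun s hs => hdef _ ⟨?_, ?_⟩ _) hfi
    · linarith [hs.2]
    · linarith [hs.1]
  rw [intervalIntegral.integral_const_mul] at h1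
  calc _ ≤ _ := norm_add_le _ _
    _ ≤ κ * ‖u 0‖ + κ * ∫ s in (0 : ℝ)..T, ‖f s‖ := add_le_add (hdef T ⟨hT.le, le_rfl⟩ _) h1
    _ = (c * I) / (c * I + 1) * (ε * (Ce0 np R * ‖u T‖)) := by
        simp only [κ, ε', I]; ring
    _ ≤ 1 * (ε * (Ce0 np R * ‖u T‖)) := by
        refine mul_le_mul_of_nonneg_right ?_ (by positivity)
        rw [div_le_one hden]
        linarith
    _ = _ := one_mul _

end Resolution

/-! ### Discretisation errors of the time integral -/

section Riemann

variable {E : Type*} [NormedAddCommGroup E] [NormedSpace ℝ E] [CompleteSpace E]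

/-- Left end point rule: on each cell of width `T/K` the integrand deviates from its left value by
at most `L T/K`. -/
lemma norm_integral_sub_riemann_le {F : ℝ → E} {T L : ℝ} (hT : 0 ≤ T) (K : ℕ) (hK : 0 < K)
    (hF : ContinuousOn F (Set.Icc 0 T))
    (hL : ∀ s ∈ Set.Icc 0 T, ∀ t ∈ Set.Icc 0 T, ‖F s - F t‖ ≤ L * |s - t|) :
    ‖(∫ s in (0 : ℝ)..T, F s) - ∑ j : Fin K, (T / K) • F ((j : ℕ) * (T / K))‖ ≤ L * T ^ 2 / K := by
  have hK' : (0 : ℝ) < K := by exact_mod_cast hK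
  set h : ℝ := T / K
  have hh : 0 ≤ h := by positivity
  have hKh : K * h = T := by simp only [h]; field_simp
  have hmem : ∀ j : ℕ, j ≤ K → (j : ℝ) * h ∈ Set.Icc 0 T := by
    intro j hj
    refine ⟨by positivity, ?_⟩
    rw [← hKh]
    exact mul_le_mul_of_nonneg_right (by exact_mod_cast hj) hh
  have hsub : ∀ j < K, Set.Icc ((j : ℝ) * h) ((j + 1 : ℕ) * h) ⊆ Set.Icc 0 T := fun j hj =>
    Set.Icc_subset_Icc (hmem j hj.le).1 (hmem (j + 1) hj).2
  have hle : ∀ j : ℕ, (j : ℝ) * h ≤ (j + 1 : ℕ) * h := fun j =>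
    mul_le_mul_of_nonneg_right (by push_cast; linarith) hh
  have hint : ∀ j < K, IntervalIntegrable F MeasureTheory.volume ((j : ℝ) * h) ((j + 1 : ℕ) * h) :=
    fun j hj => (hF.mono (hsub j hj)).intervalIntegrable_of_Icc (hle j)
  have e1 : ∫ s in (0 : ℝ)..T, F s =
      ∑ j ∈ Finset.range K, ∫ s in ((j : ℝ) * h)..((j + 1 : ℕ) * h), F s := by
    rw [intervalIntegral.sum_integral_adjacent_intervals (a := fun j : ℕ => (j : ℝ) * h)
      (fun j hj => hint j hj)]
    simp [hKh]
  rw [e1, Fin.sum_univ_eq_sum_range (fun j => h • F ((j : ℝ) * h)) K, ← Finset.sum_sub_distrib]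
  have hterm : ∀ j ∈ Finset.range K,
      ‖(∫ s in ((j : ℝ) * h)..((j + 1 : ℕ) * h), F s) - h • F ((j : ℝ) * h)‖ ≤ L * h * h := by
    intro j hj
    have hj := Finset.mem_range.1 hj
    have hw : ((j + 1 : ℕ) : ℝ) * h - (j : ℝ) * h = h := by push_cast; ring
    have e2 : h • F ((j : ℝ) * h) = ∫ s in ((j : ℝ) * h)..((j + 1 : ℕ) * h), F ((j : ℝ) * h) := by
      rw [intervalIntegral.integral_const, hw]
    rw [e2, ← intervalIntegral.integral_sub (hint j hj) intervalIntegrable_const]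
    -- The sign of `L` is not assumed; comparing two distinct nodes forces `L ≥ 0` unless the cells
    -- are degenerate.
    have hL0 : 0 ≤ L ∨ h = 0 := by
      by_cases h0 : h = 0
      · exact Or.inr h0
      · left
        have h1 := hL _ (hmem (j + 1) hj) _ (hmem j hj.le)
        rw [hw, abs_of_nonneg hh] at h1
        have h2 : 0 < h := lt_of_le_of_ne hh (Ne.symm h0)
        exact nonneg_of_mul_nonneg_left ((norm_nonneg _).trans h1) h2
    refine (intervalIntegral.norm_integral_le_of_norm_le_const (C := L * h) fun s hs => ?_).trans ?_
    · rw [Set.uIoc_of_le (hle j)] at hs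
      refine (hL _ (hsub j hj ⟨hs.1.le, hs.2⟩) _ (hmem j hj.le)).trans ?_
      have h1 : |s - (j : ℝ) * h| ≤ h := by
        rw [abs_of_nonneg (by linarith [hs.1])]
        linarith [hs.2, hw]
      rcases hL0 with h0 | h0
      · exact mul_le_mul_of_nonneg_left h1 h0
      · rw [h0] at h1 ⊢
        rw [le_antisymm h1 (abs_nonneg _)]
    · rw [hw, abs_of_nonneg hh]
  refine (norm_sum_le_of_le _ hterm).trans_eq ?_
  rw [Finset.sum_const, Finset.card_range, nsmul_eq_mul, ← hKh]
  simp only [h]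
  field_simp

end Riemann

/-! ### Regularity of the source term and of the Duhamel integrand -/

section SupTerm

variable {X : Type} [Fintype X] [DecidableEq X] {A : Matrix X X ℂ} {f : ℝ → EuclideanSpace ℂ X}
  {np : ℕ} {R T : ℝ}

lemma le_supTerm (hT : 0 < T) (hf : ContDiffOn ℝ 1 f (Set.Icc 0 T)) {t : ℝ}
    (ht : t ∈ Set.Icc 0 T) :
    2 ^ np / (2 * R) * ‖A‖ * ‖f t‖ + ‖derivWithin f (Set.Icc 0 T) t‖ ≤ supTerm A f np R T := by
  have hc : ContinuousOn (fun t => 2 ^ np / (2 * R) * ‖A‖ * ‖f t‖ +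
      ‖derivWithin f (Set.Icc 0 T) t‖) (Set.Icc 0 T) :=
    (continuousOn_const.mul hf.continuousOn.norm).add
      (hf.continuousOn_derivWithin (uniqueDiffOn_Icc hT) le_rfl).norm
  -- A real supremum is an upper bound only of a bounded family; here continuity of `f` and `f'` on
  -- a compact interval provides boundedness.
  have hb := (isCompact_range (continuousOn_iff_continuous_domRestrict.1 hc)).bddAbove
  exact le_ciSup (f := fun t : Set.Icc (0 : ℝ) T => 2 ^ np / (2 * R) * ‖A‖ * ‖f t‖ +
    ‖derivWithin f (Set.Icc 0 T) t‖) hb ⟨t, ht⟩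

lemma hasDerivWithinAt_of_contDiffOn (hf : ContDiffOn ℝ 1 f (Set.Icc 0 T)) {t : ℝ}
    (ht : t ∈ Set.Icc 0 T) :
    HasDerivWithinAt f (derivWithin f (Set.Icc 0 T) t) (Set.Icc 0 T) t :=
  ((hf.differentiableOn one_ne_zero) t ht).hasDerivWithinAt

lemma supTerm_nonneg (hT : 0 < T) (hR : 0 < R) (hf : ContDiffOn ℝ 1 f (Set.Icc 0 T)) :
    0 ≤ supTerm A f np R T :=
  le_trans (by positivity) (le_supTerm (A := A) (np := np) (R := R) hT hf ⟨le_rfl, hT.le⟩)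

/-- `‖f‖_avg` is the left Riemann sum of `‖f‖`, which is Lipschitz with constant `sup ‖f'‖`. -/
lemma abs_integral_norm_sub_fAvg_le (A : Matrix X X ℂ) (np : ℕ) (hT : 0 < T) (hR : 0 < R)
    (hf : ContDiffOn ℝ 1 f (Set.Icc 0 T)) (ns : ℕ) :
    |(∫ s in (0 : ℝ)..T, ‖f s‖) - fAvg f T ns| ≤ supTerm A f np R T * T ^ 2 / 2 ^ ns := by
  have h := norm_integral_sub_riemann_le (F := fun s => ‖f s‖) (L := supTerm A f np R T) hT.le
    (2 ^ ns) (by positivity) hf.continuousOn.norm (fun s hs t ht => by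
      refine (abs_norm_sub_norm_le _ _).trans ?_
      refine (convex_Icc 0 T).norm_image_sub_le_of_norm_hasDerivWithin_le
        (fun r hr => hasDerivWithinAt_of_contDiffOn hf hr) (fun r hr => ?_) ht hs
      refine le_trans ?_ (le_supTerm (A := A) (np := np) (R := R) hT hf hr)
      exact le_add_of_nonneg_left (by positivity))
  rw [Real.norm_eq_abs] at h
  push_cast at h
  rw [fAvg, Finset.mul_sum]
  exact h

lemma norm_schrH_le (A : Matrix X X ℂ) (np : ℕ) (hR : 0 < R) :
    ‖schrH A np R‖ ≤ 2 ^ np / (2 * R) * ‖A‖ := by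
  have e : schrH A np R = Matrix.blockDiagonal fun k => ((-eta np R k : ℝ) : ℂ) • A := by
    ext i j
    simp only [schrH, Matrix.neg_apply, Matrix.kroneckerMap_apply, Matrix.diagonal_apply,
      Matrix.blockDiagonal_apply, Matrix.smul_apply]
    split_ifs <;> simp
    ring
  rw [e]
  refine norm_blockDiagonal_le (by positivity) fun k => ?_
  rw [norm_smul, Complex.norm_real, norm_neg, Real.norm_eq_abs]
  refine mul_le_mul_of_nonneg_right ?_ (norm_nonneg _)
  have h0 : (0 : ℝ) ≤ ((k : ℕ) : ℝ) := Nat.cast_nonneg _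
  have h1 : ((k : ℕ) : ℝ) ≤ 2 ^ np := by exact_mod_cast k.2.le
  have h2 : (2 : ℝ) ^ np / (2 * R) = (2 ^ np / 2) / R := by field_simp
  rw [eta, abs_div, abs_of_pos hR, h2]
  refine div_le_div_of_nonneg_right ?_ hR.le
  rw [abs_le]
  constructor <;> linarith

/-- The integrand of the variation of constants formula of the Schrödingerised system. -/
def duhamelIntegrand (A : Matrix X X ℂ) (f : ℝ → EuclideanSpace ℂ X) (np : ℕ) (R T s : ℝ) :
    EuclideanSpace ℂ (X × QReg np) :=
  act (evolH A np R (T - s)) (lift np R (f s))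

lemma continuousOn_duhamelIntegrand (A : Matrix X X ℂ) (np : ℕ) (R : ℝ)
    (hf : ContinuousOn f (Set.Icc 0 T)) :
    ContinuousOn (duhamelIntegrand A f np R T) (Set.Icc 0 T) := by
  refine continuousOn_act (continuousOn_const_sub (continuous_evolH A np R) _) ?_
  simpa [Function.comp_def] using (liftL X np R).continuous.comp_continuousOn hf

/-- The derivative of the integrand is `e^{iH(T-s)} (b̃' - iH b̃)`. With `‖H‖ ≤ N_p ‖A‖ / (2R)` and
`‖b̃‖ = C_e ‖f‖` this is where both summands of `supTerm` come from. -/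
lemma norm_duhamelIntegrand_sub_le (hA : A.IsHermitian) (hR : 0 < R) (hnp : 1 ≤ np) (hT : 0 < T)
    (hf : ContDiffOn ℝ 1 f (Set.Icc 0 T)) {s t : ℝ} (hs : s ∈ Set.Icc 0 T)
    (ht : t ∈ Set.Icc 0 T) :
    ‖duhamelIntegrand A f np R T s - duhamelIntegrand A f np R T t‖ ≤
      Ce np R * supTerm A f np R T * |s - t| := by
  have hC : 0 ≤ Ce np R := Real.sqrt_nonneg _
  refine (convex_Icc 0 T).norm_image_sub_le_of_norm_hasDerivWithin_le
    (f' := fun r => act (evolH A np R (T - r)) (lift np R (derivWithin f (Set.Icc 0 T) r)) +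
      act (-(evolH A np R (T - r) * (Complex.I • schrH A np R))) (lift np R (f r)))
    (fun r hr => ?_) (fun r hr => ?_) ht hs
  · have h1 : HasDerivAt (fun s => evolH A np R (T - s))
        (-(evolH A np R (T - r) * (Complex.I • schrH A np R))) r := by
      have := (hasDerivAt_evolH A np R (T - r)).scomp r ((hasDerivAt_id r).const_sub T)
      rw [neg_one_smul] at this
      exact this
    have h2 : HasDerivWithinAt (fun s => lift np R (f s))
        (lift np R (derivWithin f (Set.Icc 0 T) r)) (Set.Icc 0 T) r := by
      have := ((liftL X np R).restrictScalars ℝ).hasFDerivAt.comp_hasDerivWithinAt r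
        (hasDerivWithinAt_of_contDiffOn hf hr)
      simpa [Function.comp_def] using this
    exact (actBil (X × QReg np)).hasDerivWithinAt_of_bilinear h1.hasDerivWithinAt h2
  · refine (norm_add_le _ _).trans ?_
    have hU := evolH_mem_unitary hA np R (T - r)
    have h3 : ‖-(evolH A np R (T - r) * (Complex.I • schrH A np R))‖ ≤ 2 ^ np / (2 * R) * ‖A‖ := by
      rw [norm_neg]
      refine (norm_mul_le _ _).trans ((mul_le_of_le_one_left (norm_nonneg _)
        (norm_le_one_of_mem_unitary hU)).trans ?_)
      rw [norm_smul, Complex.norm_I, one_mul]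
      exact norm_schrH_le A np hR
    rw [norm_act_of_mem_unitary hU, norm_lift hR hnp]
    refine (add_le_add le_rfl ((norm_act_le _ _).trans
      (mul_le_mul_of_nonneg_right h3 (norm_nonneg _)))).trans ?_
    rw [norm_lift hR hnp]
    refine le_trans (le_of_eq ?_) (mul_le_mul_of_nonneg_left
      (le_supTerm (A := A) (np := np) (R := R) hT hf hr) hC)
    ring

end SupTerm

/-! ### The linear combination of unitaries -/

section LCU

variable {X : Type} [Fintype X] [DecidableEq X] {A : Matrix X X ℂ} {f : ℝ → EuclideanSpace ℂ X}
  {u₀ : EuclideanSpace ℂ X} {np ns : ℕ} {R T : ℝ} {V : Matrix (X × QReg np) (X × QReg np) ℂ}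

/-- `V^K w̃(0) + ∑_j Δs V^{K - j} b̃(s_j)`. -/
def lcuSum (V : Matrix (X × QReg np) (X × QReg np) ℂ) (f : ℝ → EuclideanSpace ℂ X)
    (u₀ : EuclideanSpace ℂ X) (R T : ℝ) (ns : ℕ) : EuclideanSpace ℂ (X × QReg np) :=
  act (V ^ 2 ^ ns) (lift np R u₀) + ∑ j : QReg ns,
    ((T / 2 ^ ns : ℝ) : ℂ) • act (V ^ (2 ^ ns - (j : ℕ))) (lift np R (f ((j : ℕ) * (T / 2 ^ ns))))

/-- Two errors: the Riemann sum contributes `supTerm`, and replacing `e^{iHkΔs}` by `V^k` with `k ≤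
K` costs `K · C_heat Δs² = C_heat T²/K` times the norms of the initial value and of the weighted
sources. -/
lemma norm_wTilde_sub_lcuSum_le (hA : A.IsHermitian) (hR : 0 < R) (hnp : 1 ≤ np) (hT : 0 < T)
    (hf : ContDiffOn ℝ 1 f (Set.Icc 0 T)) {Cheat : ℝ}
    (hV : V ∈ Matrix.unitaryGroup (X × QReg np) ℂ)
    (hVe : ApproxEvol A np R Cheat (T / 2 ^ ns) V) :
    ‖wTilde A f u₀ np R T - lcuSum V f u₀ R T ns‖ ≤
      Ce np R * (T ^ 2 / 2 ^ ns) * (supTerm A f np R T + Cheat * (‖u₀‖ + fAvg f T ns)) := by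
  have hC : 0 ≤ Ce np R := Real.sqrt_nonneg _
  set K : ℕ := 2 ^ ns
  have hKr : ((K : ℕ) : ℝ) = 2 ^ ns := by simp [K]
  set h : ℝ := T / 2 ^ ns
  have hh : 0 ≤ h := by positivity
  have hKh : (K : ℝ) * h = T := by rw [hKr]; simp only [h]; field_simp
  have hpow : ∀ k ≤ K, ∀ x : EuclideanSpace ℂ (X × QReg np),
      ‖act (evolH A np R (k * h)) x - act (V ^ k) x‖ ≤ Cheat * (T ^ 2 / 2 ^ ns) * ‖x‖ := by
    intro k hk x
    rw [← sub_act, evolH_nat_mul]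
    refine (norm_act_le _ _).trans (mul_le_mul_of_nonneg_right ?_ (norm_nonneg _))
    calc _ ≤ (k : ℝ) * ‖evolH A np R h - V‖ := norm_pow_sub_pow_le (evolH_mem_unitary hA np R h) hV k
      _ ≤ K * (Cheat * h ^ 2) := mul_le_mul (by exact_mod_cast hk) hVe (norm_nonneg _) (by positivity)
      _ = Cheat * (T * h) := by rw [← hKh]; ring
      _ = _ := by simp only [h]; ring
  set D : EuclideanSpace ℂ (X × QReg np) := ∑ j : QReg ns,
    h • duhamelIntegrand A f np R T ((j : ℕ) * h)
  have hRie : ‖(∫ s in (0 : ℝ)..T, duhamelIntegrand A f np R T s) - D‖ ≤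
      Ce np R * supTerm A f np R T * T ^ 2 / 2 ^ ns := by
    have := norm_integral_sub_riemann_le (F := duhamelIntegrand A f np R T)
      (L := Ce np R * supTerm A f np R T) hT.le K (by positivity)
      (continuousOn_duhamelIntegrand A np R hf.continuousOn)
      (fun s hs t ht => norm_duhamelIntegrand_sub_le hA hR hnp hT hf hs ht)
    rw [hKr] at this
    exact this
  have hinit : ‖act (evolH A np R T) (lift np R u₀) - act (V ^ K) (lift np R u₀)‖ ≤
      Cheat * (T ^ 2 / 2 ^ ns) * (Ce np R * ‖u₀‖) := by
    have := hpow K le_rfl (lift np R u₀)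
    rwa [hKh, norm_lift hR hnp] at this
  have hsum : ‖D - ∑ j : QReg ns, ((h : ℝ) : ℂ) •
      act (V ^ (K - (j : ℕ))) (lift np R (f ((j : ℕ) * h)))‖ ≤
      Cheat * (T ^ 2 / 2 ^ ns) * (Ce np R * fAvg f T ns) := by
    rw [← Finset.sum_sub_distrib]
    refine (norm_sum_le_of_le _ (f := fun j : QReg ns => _)
      (n := fun j : QReg ns => h * (Cheat * (T ^ 2 / 2 ^ ns) * (Ce np R * ‖f ((j : ℕ) * h)‖)))
      fun j _ => ?_).trans_eq ?_
    · rw [Complex.coe_smul, ← smul_sub, norm_smul, Real.norm_of_nonneg hh]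
      refine mul_le_mul_of_nonneg_left ?_ hh
      have := hpow (K - (j : ℕ)) (Nat.sub_le _ _) (lift np R (f ((j : ℕ) * h)))
      rw [norm_lift hR hnp] at this
      have e : ((K - (j : ℕ) : ℕ) : ℝ) * h = T - (j : ℕ) * h := by
        rw [Nat.cast_sub j.2.le, sub_mul, hKh]
      rwa [e] at this
    · rw [fAvg, Finset.mul_sum, Finset.mul_sum, Finset.mul_sum]
      refine Finset.sum_congr rfl fun j _ => ?_
      change h * _ = _ * (_ * (h * ‖f ((j : ℕ) * h)‖))
      ring
  have e : wTilde A f u₀ np R T - lcuSum V f u₀ R T ns =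
      (act (evolH A np R T) (lift np R u₀) - act (V ^ K) (lift np R u₀)) +
      (((∫ s in (0 : ℝ)..T, duhamelIntegrand A f np R T s) - D) +
      (D - ∑ j : QReg ns, ((h : ℝ) : ℂ) •
        act (V ^ (K - (j : ℕ))) (lift np R (f ((j : ℕ) * h))))) := by
    simp only [wTilde, lcuSum, duhamelIntegrand, K, h]
    abel
  rw [e]
  refine (norm_add_le _ _).trans ((add_le_add hinit
    ((norm_add_le _ _).trans (add_le_add hRie hsum))).trans_eq ?_)
  ring

lemma norm_wTilde_le (hA : A.IsHermitian) (hR : 0 < R) (hnp : 1 ≤ np) (hT : 0 < T)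
    (hf : ContinuousOn f (Set.Icc 0 T)) :
    ‖wTilde A f u₀ np R T‖ ≤ Ce np R * (‖u₀‖ + ∫ s in (0 : ℝ)..T, ‖f s‖) := by
  have h1 : ‖∫ s in (0 : ℝ)..T, act (evolH A np R (T - s)) (lift np R (f s))‖ ≤
      ∫ s in (0 : ℝ)..T, Ce np R * ‖f s‖ := by
    refine intervalIntegral.norm_integral_le_of_norm_le hT.le
      (Filter.Eventually.of_forall fun s _ => ?_)
      ((continuousOn_const.mul hf.norm).intervalIntegrable_of_Icc hT.le)
    rw [norm_act_of_mem_unitary (evolH_mem_unitary hA np R _), norm_lift hR hnp]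
  rw [intervalIntegral.integral_const_mul] at h1
  refine (norm_add_le _ _).trans ?_
  rw [norm_act_of_mem_unitary (evolH_mem_unitary hA np R _), norm_lift hR hnp, mul_add]
  exact add_le_add le_rfl h1

end LCU

/-! ### Circuits -/

section Circuit

lemma submatrix_mem_unitary {m n : Type} [Fintype m] [DecidableEq m] [Fintype n] [DecidableEq n]
    {U : Matrix n n ℂ} (hU : U ∈ Matrix.unitaryGroup n ℂ) (e : m ≃ n) :
    U.submatrix e e ∈ Matrix.unitaryGroup m ℂ := by
  rw [Matrix.mem_unitaryGroup_iff, Matrix.star_eq_conjTranspose, Matrix.conjTranspose_submatrix,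
    Matrix.submatrix_mul_equiv, ← Matrix.star_eq_conjTranspose, Unitary.mul_star_self_of_mem hU,
    Matrix.submatrix_one_equiv]

lemma act_submatrix {m n : Type} [Fintype m] [DecidableEq m] [Fintype n] [DecidableEq n]
    (M : Matrix n n ℂ) (e : m ≃ n) (φ : EuclideanSpace ℂ m) (i : m) :
    act (M.submatrix e e) φ i = act M (WithLp.toLp 2 fun k => φ (e.symm k)) (e i) := by
  simp only [act_apply, Matrix.submatrix_apply]
  exact Fintype.sum_equiv e _ _ fun j => by simp

variable {C Y : Type} [Fintype C] [DecidableEq C] [Fintype Y] [DecidableEq Y]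

/-- `U` or its adjoint. -/
def flipAdjoint (inverse : Bool) (U : Matrix Y Y ℂ) : Matrix Y Y ℂ :=
  if inverse then U.conjTranspose else U

/-- Controlled operations are block diagonal in the control label, which reduces unitarity and
adjoints to the single blocks. -/
lemma controlled_eq_submatrix (inverse : Bool) (ctrl : C → Bool) (U : Matrix Y Y ℂ) :
    controlled inverse ctrl U = (Matrix.blockDiagonal fun c =>
      if ctrl c then flipAdjoint inverse U else 1).submatrix (Equiv.prodComm C Y)
        (Equiv.prodComm C Y) := rfl

lemma controlled_mem_unitary (inverse : Bool) (ctrl : C → Bool) {U : Matrix Y Y ℂ}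
    (hU : U ∈ Matrix.unitaryGroup Y ℂ) :
    controlled inverse ctrl U ∈ Matrix.unitaryGroup (C × Y) ℂ := by
  rw [controlled_eq_submatrix]
  refine submatrix_mem_unitary (blockDiagonal_mem_unitary fun c => ?_) _
  unfold flipAdjoint
  split_ifs
  exacts [conjTranspose_mem_unitary hU, hU, one_mem _]

lemma controlled_conjTranspose (inverse : Bool) (ctrl : C → Bool) (U : Matrix Y Y ℂ) :
    (controlled inverse ctrl U).conjTranspose = controlled (!inverse) ctrl U := by
  rw [controlled_eq_submatrix, controlled_eq_submatrix, Matrix.conjTranspose_submatrix,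
    Matrix.blockDiagonal_conjTranspose]
  congr 2
  funext c
  unfold flipAdjoint
  cases inverse <;> split_ifs <;> simp_all

lemma act_controlled (inverse : Bool) (ctrl : C → Bool) (U : Matrix Y Y ℂ)
    (φ : EuclideanSpace ℂ (C × Y)) (c : C) (y : Y) :
    act (controlled inverse ctrl U) φ (c, y) =
      if ctrl c then act (flipAdjoint inverse U) (WithLp.toLp 2 fun z => φ (c, z)) y
      else φ (c, y) := by
  have h : act (controlled inverse ctrl U) φ (c, y) =
      ∑ z, (if ctrl c then flipAdjoint inverse U else 1) y z * φ (c, z) := by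
    rw [act_apply, Fintype.sum_prod_type, Finset.sum_eq_single c]
    · simp [controlled, flipAdjoint]
    · intro b _ hb
      simp [controlled, Ne.symm hb]
    · simp
  rw [h]
  split_ifs
  · rfl
  · simp [Matrix.one_apply]

end Circuit

/-! ### Steps as unitaries and the inversion of circuits -/

section Steps

variable {d nx np nw ns : ℕ}

/-- `timeLast` as an equivalence. -/
def timeLastEquiv (d nx np nw ns : ℕ) :
    Mem d nx np nw ns ≃ (QReg nw × (XReg d nx × QReg np)) × QReg ns where
  toFun := timeLast d nx np nw ns
  invFun i := (i.1.1, i.2, i.1.2)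
  left_inv _ := rfl
  right_inv _ := rfl

/-- `spaceLast` as an equivalence. -/
def spaceLastEquiv (d nx np nw ns : ℕ) :
    Mem d nx np nw ns ≃ (QReg nw × QReg ns) × (XReg d nx × QReg np) where
  toFun := spaceLast d nx np nw ns
  invFun i := (i.1.1, i.1.2, i.2)
  left_inv _ := rfl
  right_inv _ := rfl

/-- The inverse of a step. -/
def Step.inv : Step d nx np nw ns → Step d nx np nw ns
  | .gate G => .gate G⁻¹
  | .evol inverse ctrl => .evol (!inverse) ctrl
  | .prep inverse ctrl => .prep (!inverse) ctrl
  | .source inverse ctrl => .source (!inverse) ctrl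
  | .coef inverse ctrl => .coef (!inverse) ctrl

lemma Step.matrix_inv (O : Oracles d nx np ns) (s : Step d nx np nw ns) :
    s.inv.matrix O = (s.matrix O).conjTranspose := by
  cases s with
  | gate G => rfl
  | evol i c =>
    simp only [Step.inv, Step.matrix, Matrix.conjTranspose_submatrix, controlled_conjTranspose]
  | prep i c =>
    simp only [Step.inv, Step.matrix, Matrix.conjTranspose_submatrix, controlled_conjTranspose]
  | source i c => simp only [Step.inv, Step.matrix, controlled_conjTranspose]
  | coef i c =>
    simp only [Step.inv, Step.matrix, Matrix.conjTranspose_submatrix, controlled_conjTranspose]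

lemma Step.matrix_mem_unitary (O : Oracles d nx np ns) (s : Step d nx np nw ns) :
    s.matrix O ∈ Matrix.unitaryGroup (Mem d nx np nw ns) ℂ := by
  cases s with
  | gate G => exact G.2
  | evol i c =>
    exact submatrix_mem_unitary (controlled_mem_unitary i c O.evol.2) (spaceLastEquiv d nx np nw ns)
  | prep i c =>
    exact submatrix_mem_unitary (controlled_mem_unitary i c O.prep.2) (spaceLastEquiv d nx np nw ns)
  | source i c => exact controlled_mem_unitary i c O.source.2
  | coef i c =>
    exact submatrix_mem_unitary (controlled_mem_unitary i c O.coef.2) (timeLastEquiv d nx np nw ns)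

/-- The matrix of a list of steps. -/
def listMatrix (O : Oracles d nx np ns) :
    List (Step d nx np nw ns) → Matrix (Mem d nx np nw ns) (Mem d nx np nw ns) ℂ
  | [] => 1
  | s :: L => listMatrix O L * s.matrix O

lemma listMatrix_append (O : Oracles d nx np ns) (L L' : List (Step d nx np nw ns)) :
    listMatrix O (L ++ L') = listMatrix O L' * listMatrix O L := by
  induction L with
  | nil => simp [listMatrix]
  | cons s L ih => rw [List.cons_append, listMatrix, ih, listMatrix, Matrix.mul_assoc]

lemma listMatrix_mem_unitary (O : Oracles d nx np ns) (L : List (Step d nx np nw ns)) :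
    listMatrix O L ∈ Matrix.unitaryGroup (Mem d nx np nw ns) ℂ := by
  induction L with
  | nil => exact one_mem _
  | cons s L ih => exact mul_mem ih (s.matrix_mem_unitary O)

lemma foldl_act (O : Oracles d nx np ns) (L : List (Step d nx np nw ns))
    (ψ : EuclideanSpace ℂ (Mem d nx np nw ns)) :
    L.foldl (fun ψ s => act (s.matrix O) ψ) ψ = act (listMatrix O L) ψ := by
  induction L generalizing ψ with
  | nil => simp [listMatrix]
  | cons s L ih => rw [List.foldl_cons, ih, listMatrix, act_mul]

/-- The steps that undo a list of steps. -/
def invSteps (L : List (Step d nx np nw ns)) : List (Step d nx np nw ns) :=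
  (L.map Step.inv).reverse

lemma listMatrix_invSteps (O : Oracles d nx np ns) (L : List (Step d nx np nw ns)) :
    listMatrix O (invSteps L) = (listMatrix O L).conjTranspose := by
  induction L with
  | nil => simp [listMatrix, invSteps]
  | cons s L ih =>
    have : invSteps (s :: L) = invSteps L ++ [s.inv] := by simp [invSteps]
    rw [this, listMatrix_append, ih, listMatrix, listMatrix, listMatrix, Matrix.one_mul,
      Step.matrix_inv, Matrix.conjTranspose_mul]

lemma countP_invSteps (p : Step d nx np nw ns → Bool) (hp : ∀ s, p s.inv = p s)
    (L : List (Step d nx np nw ns)) : (invSteps L).countP p = L.countP p := by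
  rw [invSteps, List.countP_reverse, List.countP_map]
  congr 1
  funext s
  exact hp s

end Steps

/-! ### Amplitude amplification -/

section Amplification

variable {d nx np nw ns : ℕ}

/-- The diagonal gate with signs `-1` on the labels with `p` and `1` elsewhere. -/
def signGate (p : Mem d nx np nw ns → Bool) : Matrix.unitaryGroup (Mem d nx np nw ns) ℂ :=
  ⟨Matrix.diagonal fun i => if p i then -1 else 1, by
    rw [Matrix.mem_unitaryGroup_iff, Matrix.star_eq_conjTranspose, Matrix.diagonal_conjTranspose,
      Matrix.diagonal_mul_diagonal, ← Matrix.diagonal_one]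
    congr 1
    funext i
    rw [Pi.star_apply]
    split_ifs <;> simp⟩

/-- `m` rounds of amplitude amplification of the labels with flag `F`, for the circuit `L`. -/
def amplify (F : QReg nw → Bool) (L : List (Step d nx np nw ns)) :
    ℕ → List (Step d nx np nw ns)
  | 0 => L
  | m + 1 => amplify F L m ++ (.gate (signGate fun i => F i.1) ::
      (invSteps L ++ (.gate (signGate fun i => decide (i ≠ 0)) :: L)))

/-- Each round runs the circuit twice, once backwards; an inverted query counts like a query and the
reflections need none. -/
lemma countP_amplify (p : Step d nx np nw ns → Bool) (hp : ∀ s, p s.inv = p s)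
    (hg : ∀ G, p (.gate G) = false) (F : QReg nw → Bool) (L : List (Step d nx np nw ns)) (m : ℕ) :
    (amplify F L m).countP p = (2 * m + 1) * L.countP p := by
  induction m with
  | zero => simp [amplify]
  | succ m ih =>
    rw [amplify, List.countP_append, ih, List.countP_cons, List.countP_append, List.countP_cons,
      countP_invSteps p hp, hg, hg]
    simp
    ring

/-- The part of a state on the labels with flag `F`. -/
def flagPart (F : QReg nw → Bool) (ψ : EuclideanSpace ℂ (Mem d nx np nw ns)) :
    EuclideanSpace ℂ (Mem d nx np nw ns) :=
  WithLp.toLp 2 fun i => if F i.1 then ψ i else 0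

lemma flagPart_apply (F : QReg nw → Bool) (ψ : EuclideanSpace ℂ (Mem d nx np nw ns))
    (i : Mem d nx np nw ns) : flagPart F ψ i = if F i.1 then ψ i else 0 := rfl

lemma inner_flagPart (F : QReg nw → Bool) (ψ : EuclideanSpace ℂ (Mem d nx np nw ns)) :
    inner ℂ ψ (flagPart F ψ) = ((‖flagPart F ψ‖ ^ 2 : ℝ) : ℂ) := by
  rw [EuclideanSpace.norm_sq_eq, PiLp.inner_apply, Complex.ofReal_sum]
  refine Finset.sum_congr rfl fun i _ => ?_
  rw [flagPart_apply]
  split_ifs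
  · rw [RCLike.inner_apply, RCLike.mul_conj]
    simp
  · simp

lemma act_signGate_flag (F : QReg nw → Bool) (ψ : EuclideanSpace ℂ (Mem d nx np nw ns)) (x y : ℂ) :
    act (signGate fun i : Mem d nx np nw ns => F i.1).1 (x • flagPart F ψ + y • (ψ - flagPart F ψ)) =
      (-x) • flagPart F ψ + y • (ψ - flagPart F ψ) := by
  ext i
  simp only [signGate, act_diagonal_apply, PiLp.add_apply, PiLp.smul_apply, PiLp.sub_apply,
    flagPart_apply, smul_eq_mul]
  split_ifs <;> ring

/-- The sign gate is `2|0⟩⟨0| - 1`, so its conjugate by the circuit is the reflection `2|ψ⟩⟨ψ| - 1`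
in the circuit's output `ψ`. -/
lemma act_reflection (L : List (Step d nx np nw ns)) (O : Oracles d nx np ns)
    (v : EuclideanSpace ℂ (Mem d nx np nw ns)) :
    act (listMatrix O L) (act (signGate fun i : Mem d nx np nw ns => decide (i ≠ 0)).1
      (act (listMatrix O L).conjTranspose v)) =
      (2 * inner ℂ (act (listMatrix O L) (ket 0)) v) • act (listMatrix O L) (ket 0) - v := by
  have hU := listMatrix_mem_unitary O L
  set z := act (listMatrix O L).conjTranspose v
  have h1 : act (signGate fun i : Mem d nx np nw ns => decide (i ≠ 0)).1 z =
      (2 * z 0) • ket 0 - z := by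
    ext i
    simp only [signGate, act_diagonal_apply, PiLp.sub_apply, PiLp.smul_apply, ket,
      smul_eq_mul, PiLp.single_apply]
    by_cases hi : i = 0
    · subst hi; simp; ring
    · simp [hi]
  have h2 : inner ℂ (act (listMatrix O L) (ket 0)) v = z 0 := by
    rw [inner_act_left, ket, EuclideanSpace.inner_single_left]
    simp [z]
  rw [h1, act_sub, act_smul, act_self_mul_star hU, h2]

lemma norm_sub_flagPart (F : QReg nw → Bool) (ψ : EuclideanSpace ℂ (Mem d nx np nw ns)) :
    ‖flagPart F ψ‖ ^ 2 + ‖ψ - flagPart F ψ‖ ^ 2 = ‖ψ‖ ^ 2 := by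
  rw [EuclideanSpace.norm_sq_eq, EuclideanSpace.norm_sq_eq, EuclideanSpace.norm_sq_eq,
    ← Finset.sum_add_distrib]
  refine Finset.sum_congr rfl fun i _ => ?_
  rw [PiLp.sub_apply, flagPart_apply]
  split_ifs <;> simp

/-- The coefficients of the good and the bad part after each round. -/
def ampCoeff (s : ℝ) : ℕ → ℝ × ℝ
  | 0 => (1, 1)
  | m + 1 => (2 * ((ampCoeff s m).2 * (1 - s ^ 2) - (ampCoeff s m).1 * s ^ 2) + (ampCoeff s m).1,
      2 * ((ampCoeff s m).2 * (1 - s ^ 2) - (ampCoeff s m).1 * s ^ 2) - (ampCoeff s m).2)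

/-- One round is a rotation by `2θ` in the plane of the good and the bad component, where `sin θ` is
the initial good amplitude. -/
lemma ampCoeff_sin (θ : ℝ) (m : ℕ) :
    (ampCoeff (Real.sin θ) m).1 * Real.sin θ = Real.sin ((2 * m + 1) * θ) ∧
      (ampCoeff (Real.sin θ) m).2 * Real.cos θ = Real.cos ((2 * m + 1) * θ) := by
  induction m with
  | zero => simp [ampCoeff]
  | succ m ih =>
    obtain ⟨h1, h2⟩ := ih
    have e : (2 * ((m + 1 : ℕ) : ℝ) + 1) * θ = (2 * m + 1) * θ + 2 * θ := by push_cast; ring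
    have hc : Real.sin θ ^ 2 = 1 - Real.cos θ ^ 2 := Real.sin_sq θ
    rw [e, Real.sin_add, Real.cos_add, ← h1, ← h2, Real.cos_two_mul, Real.sin_two_mul, ampCoeff]
    constructor
    · simp only
      linear_combination ((-2) * (ampCoeff (Real.sin θ) m).1 * Real.sin θ -
        2 * (ampCoeff (Real.sin θ) m).2 * Real.sin θ) * hc
    · simp only
      linear_combination (-2) * (ampCoeff (Real.sin θ) m).2 * Real.cos θ * hc

/-- Both reflections preserve the span of the good and the bad component of `ψ`, so only two real
coefficients evolve. -/
lemma act_amplify (O : Oracles d nx np ns) (F : QReg nw → Bool) (L : List (Step d nx np nw ns))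
    (m : ℕ) :
    let ψ := act (listMatrix O L) (ket 0)
    act (listMatrix O (amplify F L m)) (ket 0) =
      ((ampCoeff ‖flagPart F ψ‖ m).1 : ℂ) • flagPart F ψ +
        ((ampCoeff ‖flagPart F ψ‖ m).2 : ℂ) • (ψ - flagPart F ψ) := by
  intro ψ
  have hψ : ‖ψ‖ = 1 := by
    rw [norm_act_of_mem_unitary (listMatrix_mem_unitary O L)]
    simp [ket]
  induction m with
  | zero => simp [amplify, ampCoeff, ψ]
  | succ m ih =>
    have hin : ∀ x y : ℂ, inner ℂ ψ (x • flagPart F ψ + y • (ψ - flagPart F ψ)) =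
        x * ((‖flagPart F ψ‖ ^ 2 : ℝ) : ℂ) + y * (1 - ((‖flagPart F ψ‖ ^ 2 : ℝ) : ℂ)) := by
      intro x y
      rw [inner_add_right, inner_smul_right, inner_smul_right, inner_sub_right, inner_flagPart,
        inner_self_eq_norm_sq_to_K, hψ]
      simp
    rw [amplify, listMatrix_append, act_mul, ih, listMatrix, act_mul, listMatrix_append, act_mul,
      listMatrix, act_mul, listMatrix_invSteps]
    change act (listMatrix O L) (act (signGate fun i : Mem d nx np nw ns => decide (i ≠ 0)).1
      (act (listMatrix O L).conjTranspose (act (signGate fun i : Mem d nx np nw ns => F i.1).1 _))) = _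
    rw [act_signGate_flag, act_reflection]
    change (2 * inner ℂ ψ _) • ψ - _ = _
    rw [hin, ampCoeff]
    push_cast
    have e : ∀ a : ℂ, a • ψ = a • flagPart F ψ + a • (ψ - flagPart F ψ) := by
      intro a; rw [← smul_add]; congr 1; abel
    rw [e]
    module

/-- Amplification multiplies the flagged component by a scalar: its direction, and with it the
relative error, is unchanged. -/
lemma flagPart_amplify (O : Oracles d nx np ns) (F : QReg nw → Bool)
    (L : List (Step d nx np nw ns)) (m : ℕ) :
    flagPart F (act (listMatrix O (amplify F L m)) (ket 0)) =
      ((ampCoeff ‖flagPart F (act (listMatrix O L) (ket 0))‖ m).1 : ℂ) •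
        flagPart F (act (listMatrix O L) (ket 0)) := by
  rw [act_amplify]
  ext i
  simp only [flagPart_apply, PiLp.add_apply, PiLp.smul_apply, PiLp.sub_apply, smul_eq_mul]
  split_ifs <;> simp

lemma norm_flagPart_le_one (O : Oracles d nx np ns) (F : QReg nw → Bool)
    (L : List (Step d nx np nw ns)) : ‖flagPart F (act (listMatrix O L) (ket 0))‖ ≤ 1 := by
  have h := norm_sub_flagPart F (act (listMatrix O L) (ket 0))
  rw [norm_act_of_mem_unitary (listMatrix_mem_unitary O L) (ket 0)] at h
  have h1 : ‖(ket 0 : EuclideanSpace ℂ (Mem d nx np nw ns))‖ = 1 := by simp [ket]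
  rw [h1] at h
  nlinarith [sq_nonneg ‖act (listMatrix O L) (ket 0) - flagPart F (act (listMatrix O L) (ket 0))‖,
    norm_nonneg (flagPart F (act (listMatrix O L) (ket 0)))]

/-- If the rotation by `2m + 1` angles does not overshoot, the amplitude grows proportionally. -/
lemma le_ampCoeff_mul {s : ℝ} (h0 : 0 ≤ s) (h1 : s ≤ 1) (m : ℕ)
    (h : (2 * m + 1) * s ≤ 1) : 2 / Real.pi * ((2 * m + 1) * s) ≤ (ampCoeff s m).1 * s := by
  have hs : Real.sin (Real.arcsin s) = s := Real.sin_arcsin (by linarith) h1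
  set θ := Real.arcsin s
  have hθ0 : 0 ≤ θ := Real.arcsin_nonneg.2 h0
  have hθ2 : θ ≤ Real.pi / 2 := Real.arcsin_le_pi_div_two s
  have hθs : s ≤ θ := by rw [← hs]; exact Real.sin_le hθ0
  have hθ : 2 / Real.pi * θ ≤ s := by rw [← hs]; exact Real.mul_le_sin hθ0 hθ2
  have hpi := Real.pi_pos
  have hθ' : θ ≤ Real.pi / 2 * s := by
    rw [div_mul_eq_mul_div, div_le_iff₀ hpi] at hθ
    linarith
  have h2 := (ampCoeff_sin θ m).1
  rw [hs] at h2
  rw [h2]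
  have hm : (0 : ℝ) ≤ 2 * m + 1 := by positivity
  -- From `θ ≤ (π/2) s` and `(2m + 1) s ≤ 1`: the rotation stays in the first quarter turn, where
  -- `sin x ≥ 2x/π`.
  have h3 : (2 * m + 1) * θ ≤ Real.pi / 2 := by nlinarith
  refine le_trans ?_ (Real.mul_le_sin (by positivity) h3)
  exact mul_le_mul_of_nonneg_left (mul_le_mul_of_nonneg_left hθs hm) (by positivity)

end Amplification


/-! ### The circuit for the linear combination of unitaries -/

section Slices

variable {d nx np nw ns : ℕ}

/-- The part of a state of the memory in the registers of `x` and `p`, for fixed labels of the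
work register and of the time register. -/
def slice (φ : EuclideanSpace ℂ (Mem d nx np nw ns)) (w : QReg nw) (j : QReg ns) :
    EuclideanSpace ℂ (XReg d nx × QReg np) :=
  WithLp.toLp 2 fun y => φ (w, j, y)

lemma slice_apply (φ : EuclideanSpace ℂ (Mem d nx np nw ns)) (w : QReg nw) (j : QReg ns)
    (y : XReg d nx × QReg np) : slice φ w j y = φ (w, j, y) := rfl

lemma slice_evol (O : Oracles d nx np ns) (inverse : Bool) (ctrl : QReg nw × QReg ns → Bool)
    (φ : EuclideanSpace ℂ (Mem d nx np nw ns)) (w : QReg nw) (j : QReg ns) :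
    slice (act ((Step.evol inverse ctrl).matrix O) φ) w j =
      if ctrl (w, j) then act (flipAdjoint inverse O.evol.1) (slice φ w j) else slice φ w j := by
  ext y
  have h := act_submatrix (controlled inverse ctrl O.evol.1) (spaceLastEquiv d nx np nw ns) φ
    (w, j, y)
  refine h.trans ((act_controlled inverse ctrl O.evol.1 _ (w, j) y).trans ?_)
  split_ifs <;> rfl

lemma slice_prep (O : Oracles d nx np ns) (inverse : Bool) (ctrl : QReg nw × QReg ns → Bool)
    (φ : EuclideanSpace ℂ (Mem d nx np nw ns)) (w : QReg nw) (j : QReg ns) :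
    slice (act ((Step.prep inverse ctrl).matrix O) φ) w j =
      if ctrl (w, j) then act (flipAdjoint inverse O.prep.1) (slice φ w j) else slice φ w j := by
  ext y
  have h := act_submatrix (controlled inverse ctrl O.prep.1) (spaceLastEquiv d nx np nw ns) φ
    (w, j, y)
  refine h.trans ((act_controlled inverse ctrl O.prep.1 _ (w, j) y).trans ?_)
  split_ifs <;> rfl

lemma act_source_apply (O : Oracles d nx np ns) (inverse : Bool) (ctrl : QReg nw → Bool)
    (φ : EuclideanSpace ℂ (Mem d nx np nw ns)) (w : QReg nw)
    (i : QReg ns × (XReg d nx × QReg np)) :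
    act ((Step.source inverse ctrl).matrix O) φ (w, i) =
      if ctrl w then act (flipAdjoint inverse O.source.1) (WithLp.toLp 2 fun k => φ (w, k)) i
      else φ (w, i) :=
  act_controlled inverse ctrl O.source.1 φ w i

lemma act_coef_apply (O : Oracles d nx np ns) (inverse : Bool)
    (ctrl : QReg nw × (XReg d nx × QReg np) → Bool)
    (φ : EuclideanSpace ℂ (Mem d nx np nw ns)) (w : QReg nw) (j : QReg ns)
    (y : XReg d nx × QReg np) :
    act ((Step.coef inverse ctrl).matrix O) φ (w, j, y) =
      if ctrl (w, y) then
        act (flipAdjoint inverse O.coef.1) (WithLp.toLp 2 fun k => φ (w, k, y)) j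
      else φ (w, j, y) := by
  have h := act_submatrix (controlled inverse ctrl O.coef.1) (timeLastEquiv d nx np nw ns) φ
    (w, j, y)
  refine h.trans ((act_controlled inverse ctrl O.coef.1 _ (w, y) j).trans ?_)
  split_ifs <;> rfl

lemma act_kronecker_one_apply {m n : Type} [Fintype m] [DecidableEq m] [Fintype n] [DecidableEq n]
    (M : Matrix m m ℂ) (φ : EuclideanSpace ℂ (m × n)) (a : m) (b : n) :
    act (M ⊗ₖ (1 : Matrix n n ℂ)) φ (a, b) = ∑ a', M a a' * φ (a', b) := by
  rw [act_apply, Fintype.sum_prod_type]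
  refine Finset.sum_congr rfl fun a' _ => ?_
  simp [Matrix.kroneckerMap_apply, Matrix.one_apply]

lemma act_one_kronecker_apply {m n : Type} [Fintype m] [DecidableEq m] [Fintype n] [DecidableEq n]
    (M : Matrix n n ℂ) (φ : EuclideanSpace ℂ (m × n)) (a : m) (b : n) :
    act ((1 : Matrix m m ℂ) ⊗ₖ M) φ (a, b) = act M (WithLp.toLp 2 fun b' => φ (a, b')) b := by
  rw [act_apply, Fintype.sum_prod_type, act_apply, Finset.sum_eq_single a]
  · simp [Matrix.kroneckerMap_apply]
  · intro a' _ ha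
    simp [Matrix.kroneckerMap_apply, Matrix.one_apply_ne (Ne.symm ha)]
  · simp

/-- The evolution steps with the control `j ≤ r`, `r < n`, act by `V ^ (n - j)` on the label `j`
of the time register. -/
lemma slice_evol_range (O : Oracles d nx np ns) (n : ℕ)
    (φ : EuclideanSpace ℂ (Mem d nx np nw ns)) (w : QReg nw) (j : QReg ns) :
    slice (act (listMatrix O ((List.range n).map fun r =>
      Step.evol false fun c => decide ((c.2 : ℕ) ≤ r))) φ) w j =
      act (O.evol.1 ^ (n - (j : ℕ))) (slice φ w j) := by
  induction n with
  | zero => simp [listMatrix]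
  | succ n ih =>
    rw [List.range_succ, List.map_append, listMatrix_append, act_mul]
    simp only [List.map_cons, List.map_nil, listMatrix, Matrix.one_mul]
    rw [slice_evol, ih]
    by_cases h : (j : ℕ) ≤ n
    · rw [if_pos (by simpa using h), Nat.sub_add_comm h, pow_succ', act_mul]
      rfl
    · rw [if_neg (by simpa using h), Nat.sub_eq_zero_of_le (by omega),
        Nat.sub_eq_zero_of_le (by omega)]

end Slices

/-! ### The fixed gates: rotation, Fourier transform and flag -/

section Gates

variable (d nx np ns : ℕ)

/-- Rotation by the angle `θ` of the first two labels of two work qubits. -/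
def rotMatrix (θ : ℝ) : Matrix (QReg 2) (QReg 2) ℂ :=
  !![(Real.cos θ : ℂ), -(Real.sin θ : ℂ), 0, 0; (Real.sin θ : ℂ), (Real.cos θ : ℂ), 0, 0;
    0, 0, 1, 0; 0, 0, 0, 1]

lemma rotMatrix_conjTranspose (θ : ℝ) : (rotMatrix θ).conjTranspose = rotMatrix (-θ) := by
  ext i j
  change Fin 4 at i j
  fin_cases i <;> fin_cases j <;>
    simp [rotMatrix, Matrix.conjTranspose_apply, Complex.conj_ofReal, -Complex.ofReal_cos,
      -Complex.ofReal_sin]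

lemma rotMatrix_mem_unitary (θ : ℝ) : rotMatrix θ ∈ Matrix.unitaryGroup (QReg 2) ℂ := by
  rw [Matrix.mem_unitaryGroup_iff, Matrix.star_eq_conjTranspose, rotMatrix_conjTranspose]
  have h := Complex.sin_sq_add_cos_sq θ
  ext i j
  rw [Matrix.mul_apply]
  change ∑ k : Fin 4, _ = _
  rw [Fin.sum_univ_four]
  change Fin 4 at i j
  fin_cases i <;> fin_cases j <;> simp [rotMatrix] <;>
    first | ring1 | linear_combination h

/-- The rotation of the work register. -/
def rotGate (θ : ℝ) : Matrix.unitaryGroup (Mem d nx np 2 ns) ℂ :=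
  ⟨rotMatrix θ ⊗ₖ 1, Matrix.kronecker_mem_unitary (rotMatrix_mem_unitary θ) (one_mem _)⟩

open Classical in
/-- The Fourier transform in the auxiliary variable. -/
def fourierGate (R : ℝ) : Matrix.unitaryGroup (Mem d nx np 2 ns) ℂ :=
  -- The circuit has to be defined for all inputs, also meaningless values of `R`; the identity is
  -- the default there. For `R > 0` and `np ≥ 1` the condition holds.
  if h : fourierX (XReg d nx) np R ∈ Matrix.unitaryGroup (XReg d nx × QReg np) ℂ then
    ⟨1 ⊗ₖ (1 ⊗ₖ fourierX (XReg d nx) np R),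
      Matrix.kronecker_mem_unitary (one_mem _) (Matrix.kronecker_mem_unitary (one_mem _) h)⟩
  else 1

/-- Exchange of the labels `0` and `2` of the work register, where the time register is in the
label `0` and `p ≥ 0`. -/
def flagSwap (R : ℝ) (i : Mem d nx np 2 ns) : Mem d nx np 2 ns :=
  if i.2.1 = 0 ∧ 0 ≤ pGrid np R i.2.2.2 then (Equiv.swap 0 2 i.1, i.2) else i

lemma flagSwap_flagSwap (R : ℝ) (i : Mem d nx np 2 ns) :
    flagSwap d nx np ns R (flagSwap d nx np ns R i) = i := by
  by_cases h : i.2.1 = 0 ∧ 0 ≤ pGrid np R i.2.2.2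
  · have e : flagSwap d nx np ns R i = (Equiv.swap 0 2 i.1, i.2) := if_pos h
    rw [e, flagSwap, if_pos h]
    simp
  · have e : flagSwap d nx np ns R i = i := if_neg h
    rw [e, e]

/-- The gate that raises the flag. -/
def flagGate (R : ℝ) : Matrix.unitaryGroup (Mem d nx np 2 ns) ℂ :=
  ⟨(1 : Matrix (Mem d nx np 2 ns) (Mem d nx np 2 ns) ℂ).submatrix (flagSwap d nx np ns R) id, by
    have e := submatrix_mem_unitary (one_mem (Matrix.unitaryGroup (Mem d nx np 2 ns) ℂ))
      (Function.Involutive.toPerm _ (flagSwap_flagSwap d nx np ns R))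
    rw [Matrix.mem_unitaryGroup_iff, Matrix.star_eq_conjTranspose, Matrix.conjTranspose_submatrix,
      Matrix.conjTranspose_one]
    ext i j
    rw [Matrix.mul_apply]
    simp only [Matrix.submatrix_apply, id, Matrix.one_apply, mul_ite, mul_one, mul_zero]
    rw [Finset.sum_eq_single (flagSwap d nx np ns R j)]
    · simp only [if_true]
      congr 1
      exact propext (Function.LeftInverse.injective (flagSwap_flagSwap d nx np ns R)).eq_iff
    · intro b _ hb
      rw [if_neg hb]
    · simp⟩

variable {d nx np ns}

lemma act_rotGate (θ : ℝ) (φ : EuclideanSpace ℂ (Mem d nx np 2 ns))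
    (i : QReg ns × (XReg d nx × QReg np)) :
    act (rotGate d nx np ns θ).1 φ (0, i) = Real.cos θ * φ (0, i) - Real.sin θ * φ (1, i) ∧
    act (rotGate d nx np ns θ).1 φ (1, i) = Real.sin θ * φ (0, i) + Real.cos θ * φ (1, i) ∧
    act (rotGate d nx np ns θ).1 φ (2, i) = φ (2, i) := by
  have h : ∀ w, act (rotGate d nx np ns θ).1 φ (w, i) =
      ∑ w' : Fin 4, rotMatrix θ w w' * φ ((w' : QReg 2), i) :=
    fun w => act_kronecker_one_apply (rotMatrix θ) φ w i
  refine ⟨?_, ?_, ?_⟩ <;> rw [h, Fin.sum_univ_four] <;> simp [rotMatrix]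
  ring

lemma slice_fourierGate {R : ℝ} (hR : 0 < R) (hnp : 1 ≤ np)
    (φ : EuclideanSpace ℂ (Mem d nx np 2 ns)) (w : QReg 2) (j : QReg ns) :
    slice (act (fourierGate d nx np ns R).1 φ) w j =
      act (fourierX (XReg d nx) np R) (slice φ w j) := by
  rw [fourierGate, dif_pos (fourierX_mem_unitary hR hnp)]
  ext y
  rw [slice_apply, act_one_kronecker_apply, act_one_kronecker_apply]
  rfl

lemma act_flagGate (R : ℝ) (φ : EuclideanSpace ℂ (Mem d nx np 2 ns)) (i : Mem d nx np 2 ns) :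
    act (flagGate d nx np ns R).1 φ i = φ (flagSwap d nx np ns R i) := by
  rw [act_apply]
  change ∑ j, (1 : Matrix (Mem d nx np 2 ns) (Mem d nx np 2 ns) ℂ) (flagSwap d nx np ns R i) j *
    φ j = _
  simp [Matrix.one_apply]

end Gates


/-! ### The flagged component of the circuit -/

section LCU

variable {d nx np ns : ℕ}

/-- The first steps of the circuit: they load the initial value into the label `0` of the work
register and the source terms into the label `1`. -/
def loadSteps (d nx np ns : ℕ) (θ : ℝ) : List (Step d nx np 2 ns) :=
  [.gate (rotGate d nx np ns θ), .coef false fun c => decide (c.1 = 1),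
    .source false fun w => decide (w = 1), .prep false fun c => decide (c.1 = 0)]

/-- The evolution steps of the circuit. -/
def evolSteps (d nx np ns : ℕ) : List (Step d nx np 2 ns) :=
  (List.range (2 ^ ns)).map fun r => Step.evol false fun c => decide ((c.2 : ℕ) ≤ r)

/-- The last steps of the circuit: they add up the terms and raise the flag. -/
def mergeSteps (d nx np ns : ℕ) (θ R : ℝ) : List (Step d nx np 2 ns) :=
  [.coef true fun c => decide (c.1 = 1), .gate (rotGate d nx np ns (-θ)),
    .gate (fourierGate d nx np ns R), .gate (flagGate d nx np ns R)]

/-- The circuit for the linear combination of unitaries. -/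
def lcuSteps (d nx np ns : ℕ) (θ R : ℝ) : List (Step d nx np 2 ns) :=
  loadSteps d nx np ns θ ++ (evolSteps d nx np ns ++ mergeSteps d nx np ns θ R)

lemma act_ket {m n : Type} [Fintype m] [DecidableEq m] [Fintype n] [DecidableEq n] (M : Matrix m n ℂ)
    (i : m) (j : n) : act M (ket j) i = M i j := by
  rw [act_apply, Finset.sum_eq_single j]
  · simp [ket]
  · intro b _ hb
    simp [ket, hb]
  · simp

lemma ket_apply {n : Type} [Fintype n] [DecidableEq n] (i j : n) :
    (ket i : EuclideanSpace ℂ n) j = if j = i then 1 else 0 := by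
  simp [ket, PiLp.single_apply]

/-- The initial value is left at time label `0`, so that the evolution steps apply `O_H` to it all
`K` times. The sources are described by an abstract family `β`: where `b̃(s_j) = 0` the oracle `O_b`
is unconstrained and only its product with the coefficient matters. -/
lemma slice_loadSteps (O : Oracles d nx np ns) (θ : ℝ)
    (β : QReg ns → EuclideanSpace ℂ (XReg d nx × QReg np))
    (hβ : ∀ j, ((Real.sin θ : ℂ) * act O.coef.1 (ket 0) j) • act O.source.1 (ket (j, 0)) =
      tens (ket j) (β j)) :
    let φ := act (listMatrix O (loadSteps d nx np ns θ)) (ket 0)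
    (∀ j, slice φ 0 j = if j = 0 then (Real.cos θ : ℂ) • act O.prep.1 (ket 0) else 0) ∧
      (∀ j, slice φ 1 j = β j) ∧ ∀ j, slice φ 2 j = 0 := by
  have h01 : (0 : QReg 2) ≠ 1 := by decide
  have h02 : (0 : QReg 2) ≠ 2 := by decide
  have h12 : (1 : QReg 2) ≠ 2 := by decide
  intro φ
  obtain ⟨φ₁, hφ₁⟩ : ∃ x, x = act (rotGate d nx np ns θ).1 (ket 0) := ⟨_, rfl⟩
  obtain ⟨φ₂, hφ₂⟩ : ∃ x, x = act ((Step.coef false fun c => decide (c.1 = 1)).matrix O) φ₁ := ⟨_, rfl⟩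
  obtain ⟨φ₃, hφ₃⟩ : ∃ x, x = act ((Step.source false fun w => decide (w = 1)).matrix O) φ₂ := ⟨_, rfl⟩
  have hφ : φ = act ((Step.prep false fun c => decide (c.1 = 0)).matrix O) φ₃ := by
    simp only [φ, hφ₃, hφ₂, hφ₁, loadSteps, listMatrix, Matrix.one_mul, act_mul]
    rfl
  have a0 : ∀ i, φ₁ (0, i) = if i = 0 then (Real.cos θ : ℂ) else 0 := by
    intro i
    rw [hφ₁, (act_rotGate θ _ i).1, ket_apply, ket_apply, if_neg (c := ((1 : QReg 2), i) = 0)]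
    · by_cases h : i = 0
      · rw [if_pos h, if_pos (by rw [h]; rfl)]; simp
      · rw [if_neg h, if_neg (fun h' => h (congrArg Prod.snd h'))]; simp
    · exact fun h' => h01 (congrArg Prod.fst h').symm
  have a1 : ∀ i, φ₁ (1, i) = if i = 0 then (Real.sin θ : ℂ) else 0 := by
    intro i
    rw [hφ₁, (act_rotGate θ _ i).2.1, ket_apply, ket_apply, if_neg (c := ((1 : QReg 2), i) = 0)]
    · by_cases h : i = 0
      · rw [if_pos h, if_pos (by rw [h]; rfl)]; simp
      · rw [if_neg h, if_neg (fun h' => h (congrArg Prod.snd h'))]; simp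
    · exact fun h' => h01 (congrArg Prod.fst h').symm
  have a2 : ∀ i, φ₁ (2, i) = 0 := by
    intro i
    rw [hφ₁, (act_rotGate θ _ i).2.2, ket_apply, if_neg]
    exact fun h' => h02 (congrArg Prod.fst h').symm
  have b0 : ∀ i, φ₂ (0, i) = φ₁ (0, i) := by
    rintro ⟨j, y⟩
    rw [hφ₂, act_coef_apply, if_neg (by simp)]
  have b1 : ∀ i, φ₂ (1, i) = if i.2 = 0 then Real.sin θ * act O.coef.1 (ket 0) i.1 else 0 := by
    rintro ⟨j, y⟩
    rw [hφ₂, act_coef_apply, if_pos (by simp), act_apply, Finset.sum_eq_single 0, act_ket]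
    · change O.coef.1 j 0 * φ₁ (1, 0, y) = _
      rw [a1]
      by_cases h : y = 0
      · rw [if_pos (by rw [h]; rfl), if_pos h, mul_comm]
      · rw [if_neg (fun h' => h (congrArg Prod.snd h')), if_neg h, mul_zero]
    · intro k _ hk
      change O.coef.1 j k * φ₁ (1, k, y) = _
      rw [a1, if_neg (fun h' => hk (congrArg Prod.fst h')), mul_zero]
    · simp
  have b2 : ∀ i, φ₂ (2, i) = 0 := by
    rintro ⟨j, y⟩
    rw [hφ₂, act_coef_apply, if_neg (by simp), a2]
  have c0 : ∀ i, φ₃ (0, i) = φ₁ (0, i) := by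
    intro i
    rw [hφ₃, act_source_apply, if_neg (by simp), b0]
  have c1 : ∀ i, φ₃ (1, i) = β i.1 i.2 := by
    intro i
    have e : (WithLp.toLp 2 fun k => φ₂ (1, k) :
        EuclideanSpace ℂ (QReg ns × (XReg d nx × QReg np))) =
        ∑ j, ((Real.sin θ : ℂ) * act O.coef.1 (ket 0) j) • ket (j, 0) := by
      ext k
      rw [WithLp.ofLp_sum, Finset.sum_apply, Finset.sum_eq_single k.1]
      · change φ₂ (1, k) = _ * (ket _ : EuclideanSpace ℂ _) k
        rw [b1, ket_apply]
        by_cases h : k.2 = 0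
        · rw [if_pos h, if_pos (c := k = (k.1, 0)) (Prod.ext rfl h), mul_one]
        · rw [if_neg h, if_neg (fun h' => h (congrArg Prod.snd h')), mul_zero]
      · intro j _ hj
        change _ * (ket _ : EuclideanSpace ℂ _) k = _
        rw [ket_apply, if_neg (fun h' => hj (congrArg Prod.fst h').symm), mul_zero]
      · simp
    rw [hφ₃, act_source_apply, if_pos (by simp), e, act_sum]
    simp only [act_smul]
    change (∑ j, ((Real.sin θ : ℂ) * act O.coef.1 (ket 0) j) • act O.source.1 (ket (j, 0)) :
      EuclideanSpace ℂ _) i = _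
    rw [Finset.sum_congr rfl fun j _ => hβ j, WithLp.ofLp_sum, Finset.sum_apply,
      Finset.sum_eq_single i.1]
    · simp [tens, ket_apply]
    · intro j _ hj
      simp [tens, ket_apply, Ne.symm hj]
    · simp
  have c2 : ∀ i, φ₃ (2, i) = 0 := by
    intro i
    rw [hφ₃, act_source_apply, if_neg (by simp), b2]
  refine ⟨fun j => ?_, fun j => ?_, fun j => ?_⟩
  · rw [hφ, slice_prep, if_pos (by simp)]
    have e : slice φ₃ 0 j = if j = 0 then (Real.cos θ : ℂ) • ket 0 else 0 := by
      ext y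
      rw [slice_apply, c0, a0]
      by_cases h : j = 0
      · rw [if_pos h, PiLp.smul_apply, ket_apply]
        by_cases h2 : y = 0
        · rw [if_pos (by rw [h, h2]; rfl), if_pos h2]; simp
        · rw [if_neg (fun h' => h2 (congrArg Prod.snd h')), if_neg h2]; simp
      · rw [if_neg h, if_neg (fun h' => h (congrArg Prod.fst h'))]; rfl
    rw [e]
    split_ifs
    · rw [act_smul]; rfl
    · simp [act]
  · rw [hφ, slice_prep, if_neg (by simp)]
    ext y
    rw [slice_apply, c1]
  · rw [hφ, slice_prep, if_neg (by simp)]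
    ext y
    rw [slice_apply, c2]
    rfl

/-- Row `0` of the inverse of `O_coef` sums the time labels with conjugate coefficients, and the
backward rotation adds the two branches at work label `0`. The swap moves there only time label `0`
and `p ≥ 0` into label `2`; this label was empty before, so nothing else is flagged. -/
lemma flagPart_mergeSteps {R : ℝ} (hR : 0 < R) (hnp : 1 ≤ np) (O : Oracles d nx np ns) (θ : ℝ)
    (φ : EuclideanSpace ℂ (Mem d nx np 2 ns)) (h2 : ∀ j, slice φ 2 j = 0) :
    flagPart (fun w => decide (w = 2)) (act (listMatrix O (mergeSteps d nx np ns θ R)) φ) =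
      tens (ket 2) (tens (ket 0) (restrictPos np R (act (fourierX (XReg d nx) np R)
        ((Real.cos θ : ℂ) • slice φ 0 0 + (Real.sin θ : ℂ) •
          ∑ j, (starRingEnd ℂ) (act O.coef.1 (ket 0) j) • slice φ 1 j)))) := by
  have h01 : (0 : QReg 2) ≠ 1 := by decide
  have h12 : (1 : QReg 2) ≠ 2 := by decide
  simp only [mergeSteps, listMatrix, Matrix.one_mul, act_mul]
  change flagPart _ (act (flagGate d nx np ns R).1 (act (fourierGate d nx np ns R).1
    (act (rotGate d nx np ns (-θ)).1
      (act ((Step.coef true fun c => decide (c.1 = 1)).matrix O) φ)))) = _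
  set φ₁ := act ((Step.coef true fun c => decide (c.1 = 1)).matrix O) φ with hφ₁
  set φ₂ := act (rotGate d nx np ns (-θ)).1 φ₁ with hφ₂
  set φ₃ := act (fourierGate d nx np ns R).1 φ₂ with hφ₃
  have a0 : slice φ₁ 0 0 = slice φ 0 0 := by
    ext y
    rw [slice_apply, hφ₁, act_coef_apply, if_neg (by simp)]
    rfl
  have a1 : slice φ₁ 1 0 = ∑ j, (starRingEnd ℂ) (act O.coef.1 (ket 0) j) • slice φ 1 j := by
    ext y
    rw [slice_apply, hφ₁, act_coef_apply, if_pos (by simp), act_apply, WithLp.ofLp_sum,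
      Finset.sum_apply]
    refine Finset.sum_congr rfl fun j _ => ?_
    rw [act_ket]
    rfl
  have a2 : ∀ j, slice φ₁ 2 j = 0 := by
    intro j
    rw [← h2 j]
    ext y
    rw [slice_apply, hφ₁, act_coef_apply, if_neg (by simp)]
    rfl
  -- The rotation by `-θ` turns the minus sign of the rotation matrix into the plus sign needed for
  -- a sum.
  have b0 : slice φ₂ 0 0 = (Real.cos θ : ℂ) • slice φ₁ 0 0 + (Real.sin θ : ℂ) • slice φ₁ 1 0 := by
    ext y
    rw [slice_apply, hφ₂, (act_rotGate (-θ) φ₁ _).1]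
    simp [slice_apply]
  have b2 : ∀ j, slice φ₂ 2 j = 0 := by
    intro j
    rw [← a2 j]
    ext y
    rw [slice_apply, hφ₂, (act_rotGate (-θ) φ₁ _).2.2]
    rfl
  have c2 : ∀ j y, φ₃ (2, j, y) = 0 := by
    intro j y
    rw [← slice_apply, hφ₃, slice_fourierGate hR hnp, b2]
    simp [act]
  ext ⟨w, j, y⟩
  rw [flagPart_apply, act_flagGate, flagSwap]
  by_cases hw : w = 2
  · subst hw
    rw [if_pos (by simp)]
    by_cases hj : j = 0
    · subst hj
      have e : tens (ket (2 : QReg 2)) (tens (ket (0 : QReg ns)) (restrictPos np R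
          (act (fourierX (XReg d nx) np R) (slice φ₂ 0 0)))) (2, 0, y) =
          restrictPos np R (act (fourierX (XReg d nx) np R) (slice φ₂ 0 0)) y := by
        simp [tens, ket_apply]
      rw [← a0, ← a1, ← b0, e, restrictPos]
      by_cases hp : 0 ≤ pGrid np R y.2
      · rw [if_pos ⟨rfl, hp⟩, Equiv.swap_apply_right, ← slice_fourierGate hR hnp]
        exact (if_pos hp).symm
      · rw [if_neg (fun h => hp h.2), c2]
        exact (if_neg hp).symm
    · rw [if_neg (fun h => hj h.1), c2]
      simp [tens, ket_apply, hj]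
  · rw [if_neg (by simpa using hw)]
    simp [tens, ket_apply, hw]

lemma flagPart_lcuSteps {R : ℝ} (hR : 0 < R) (hnp : 1 ≤ np) (O : Oracles d nx np ns) (θ : ℝ)
    (β : QReg ns → EuclideanSpace ℂ (XReg d nx × QReg np))
    (hβ : ∀ j, ((Real.sin θ : ℂ) * act O.coef.1 (ket 0) j) • act O.source.1 (ket (j, 0)) =
      tens (ket j) (β j)) :
    flagPart (fun w => decide (w = 2)) (act (listMatrix O (lcuSteps d nx np ns θ R)) (ket 0)) =
      tens (ket 2) (tens (ket 0) (restrictPos np R (act (fourierX (XReg d nx) np R)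
        ((Real.cos θ : ℂ) • act (O.evol.1 ^ 2 ^ ns) ((Real.cos θ : ℂ) • act O.prep.1 (ket 0)) +
          (Real.sin θ : ℂ) • ∑ j : QReg ns, (starRingEnd ℂ) (act O.coef.1 (ket 0) j) •
            act (O.evol.1 ^ (2 ^ ns - (j : ℕ))) (β j))))) := by
  obtain ⟨h0, h1, h2⟩ := slice_loadSteps O θ β hβ
  rw [lcuSteps, listMatrix_append, listMatrix_append, act_mul, act_mul, flagPart_mergeSteps hR hnp]
  · simp only [evolSteps, slice_evol_range, h0, h1]
    simp
  · intro j
    rw [evolSteps, slice_evol_range, h2]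
    simp [act]

end LCU


/-! ### Normalisation of the flagged component for encoded problems -/

section Encode

variable {d nx np ns : ℕ} {A : Matrix (XReg d nx) (XReg d nx) ℂ}
  {f : ℝ → EuclideanSpace ℂ (XReg d nx)} {u₀ : EuclideanSpace ℂ (XReg d nx)} {R T Cheat : ℝ}

/-- The rotation angle for the weights `a` and `b` of the initial value and of the source. -/
def lcuAngle (a b : ℝ) : ℝ := Real.arccos (Real.sqrt (a / (a + b)))

lemma cos_lcuAngle {a b : ℝ} (ha : 0 ≤ a) (hb : 0 ≤ b) :
    Real.cos (lcuAngle a b) = Real.sqrt (a / (a + b)) :=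
  Real.cos_arccos (le_trans (by norm_num) (Real.sqrt_nonneg _))
    (Real.sqrt_le_one.2 (div_le_one_of_le₀ (by linarith) (by positivity)))

lemma sin_lcuAngle {a b : ℝ} (ha : 0 ≤ a) (hab : 0 < a + b) :
    Real.sin (lcuAngle a b) = Real.sqrt (b / (a + b)) := by
  rw [lcuAngle, Real.sin_arccos, Real.sq_sqrt (by positivity)]
  congr 1
  field_simp
  ring

lemma fAvg_nonneg (hT : 0 < T) (ns : ℕ) : 0 ≤ fAvg f T ns :=
  mul_nonneg (by positivity) (Finset.sum_nonneg fun _ _ => norm_nonneg _)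

/-- Every amplitude enters twice, at loading and at merging, so the square roots in the angle and in
`O_coef` become the weights themselves. All terms of `lcuSum` then carry the same factor `1 / (C_e
(‖u(0)‖ + ‖f‖_avg))`. -/
lemma flagPart_lcuSteps_of_encode (hR : 0 < R) (hnp : 1 ≤ np) (hT : 0 < T)
    (hS : 0 < ‖u₀‖ + fAvg f T ns) (O : Oracles d nx np ns) (hO : O.Encode A f u₀ R T Cheat) :
    flagPart (fun w => decide (w = 2)) (act (listMatrix O
      (lcuSteps d nx np ns (lcuAngle ‖u₀‖ (fAvg f T ns)) R)) (ket 0)) =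
      (((Ce np R * (‖u₀‖ + fAvg f T ns))⁻¹ : ℝ) : ℂ) • tens (ket 2) (tens (ket 0)
        (restrictPos np R (act (fourierX (XReg d nx) np R) (lcuSum O.evol.1 f u₀ R T ns)))) := by
  obtain ⟨-, hprep, hsource, hcoef⟩ := hO
  have hCe : 0 < Ce np R := by
    rw [← norm_expVec, norm_pos_iff]
    intro h
    have h0 : expVec np R 0 = 0 := by rw [h]; rfl
    rw [expVec_apply, Complex.ofReal_eq_zero] at h0
    exact (Real.exp_pos _).ne' h0
  set F := fAvg f T ns with hF
  have hF0 : 0 ≤ F := fAvg_nonneg hT ns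
  set S := ‖u₀‖ + F with hSdef
  set b : QReg ns → EuclideanSpace ℂ (XReg d nx × QReg np) :=
    fun j => lift np R (f ((j : ℕ) * (T / 2 ^ ns))) with hb
  have hα : ∑ j, T / 2 ^ ns * ‖b j‖ = Ce np R * F := by
    simp only [hb, norm_lift hR hnp]
    rw [hF, fAvg, Finset.mul_sum, Finset.mul_sum]
    exact Finset.sum_congr rfl fun j _ => by ring
  set c := act O.coef.1 (ket 0) with hc
  have hcj : ∀ j, ((Real.sqrt (Ce np R * F) : ℝ) : ℂ) * c j =
      ((Real.sqrt (T / 2 ^ ns * ‖b j‖) : ℝ) : ℂ) := by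
    intro j
    have := congrArg (fun v : EuclideanSpace ℂ (QReg ns) => v j) hcoef
    rw [← hα]
    exact this
  have hcos := cos_lcuAngle (norm_nonneg u₀) hF0
  have hsin := sin_lcuAngle (norm_nonneg u₀) hS
  set θ := lcuAngle ‖u₀‖ F
  rw [← hSdef] at hcos hsin
  -- For a vanishing source either `O_coef` gives this label amplitude `0`, or all sources vanish
  -- and the rotation never enters the source branch.
  have hzero : ∀ j, b j = 0 → (Real.sin θ : ℂ) * c j = 0 := by
    intro j hj
    have h := hcj j
    rw [hj, norm_zero, mul_zero, Real.sqrt_zero, Complex.ofReal_zero, mul_eq_zero] at h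
    rcases h with h | h
    · rw [Complex.ofReal_eq_zero, Real.sqrt_eq_zero (by positivity), mul_eq_zero] at h
      have : F = 0 := h.resolve_left hCe.ne'
      rw [hsin, this]; simp
    · rw [h, mul_zero]
  -- With `F = ‖f‖_avg`, `S = ‖u(0)‖ + F`: `sin²θ = F/S` and `|c_j|² = Δs ‖b_j‖ / (C_e F)`, so after
  -- division by `‖b_j‖` the weight `Δs / (C_e S)` no longer depends on `j`.
  have hweight : ∀ j, b j ≠ 0 → (Real.sin θ : ℂ) * ((starRingEnd ℂ) (c j) *
      ((Real.sin θ : ℂ) * c j / (‖b j‖ : ℝ))) = (((Ce np R * S)⁻¹ * (T / 2 ^ ns) : ℝ) : ℂ) := by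
    intro j hj
    have hbj : 0 < ‖b j‖ := norm_pos_iff.2 hj
    have hle : T / 2 ^ ns * ‖b j‖ ≤ Ce np R * F := by
      rw [← hα]
      exact Finset.single_le_sum (f := fun j => T / 2 ^ ns * ‖b j‖)
        (fun _ _ => by positivity) (Finset.mem_univ j)
    have hpos : 0 < Ce np R * F := lt_of_lt_of_le (by positivity) hle
    have hFpos : 0 < F := pos_of_mul_pos_right hpos hCe.le
    have h1 : Ce np R * F * Complex.normSq (c j) = T / 2 ^ ns * ‖b j‖ := by
      have h := congrArg Complex.normSq (hcj j)
      rw [Complex.normSq_mul, Complex.normSq_ofReal, Complex.normSq_ofReal,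
        Real.mul_self_sqrt hpos.le, Real.mul_self_sqrt (by positivity)] at h
      exact h
    have h2 : Complex.normSq (c j) = T / 2 ^ ns * ‖b j‖ / (Ce np R * F) := by
      rw [← h1]; field_simp
    have h3 : Real.sin θ * Real.sin θ = F / S := by
      rw [hsin, Real.mul_self_sqrt (by positivity)]
    have h4 : (starRingEnd ℂ) (c j) * c j = (Complex.normSq (c j) : ℂ) := by
      rw [mul_comm, Complex.mul_conj]
    calc (Real.sin θ : ℂ) * ((starRingEnd ℂ) (c j) * ((Real.sin θ : ℂ) * c j / (‖b j‖ : ℝ)))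
        = ((Real.sin θ : ℂ) * Real.sin θ) * ((starRingEnd ℂ) (c j) * c j) / (‖b j‖ : ℝ) := by ring
      _ = ((Real.sin θ * Real.sin θ * Complex.normSq (c j) / ‖b j‖ : ℝ) : ℂ) := by
        rw [h4]; push_cast; ring
      _ = _ := by
        rw [h2, h3]
        congr 1
        field_simp
  have hβ : ∀ j, ((Real.sin θ : ℂ) * c j) • act O.source.1 (ket (j, 0)) =
      tens (ket j) (((Real.sin θ : ℂ) * c j / (‖b j‖ : ℝ)) • b j) := by
    intro j
    by_cases hj : b j = 0
    · rw [hzero j hj, hj, zero_smul, smul_zero]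
      ext i; simp [tens]
    · have hbj : ((‖b j‖ : ℝ) : ℂ) ≠ 0 := by exact_mod_cast norm_ne_zero_iff.2 hj
      rw [tens_smul_right, ← hsource j, smul_smul, div_mul_cancel₀ _ hbj]
  rw [flagPart_lcuSteps hR hnp O θ _ hβ, ← tens_smul_right, ← tens_smul_right]
  congr 2
  have e1 : (Real.cos θ : ℂ) • act (O.evol.1 ^ 2 ^ ns) ((Real.cos θ : ℂ) • act O.prep.1 (ket 0)) =
      (((Ce np R * S)⁻¹ : ℝ) : ℂ) • act (O.evol.1 ^ 2 ^ ns) (lift np R u₀) := by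
    rw [← hprep, act_smul, act_smul, smul_smul, smul_smul, norm_lift hR hnp, ← Complex.ofReal_mul,
      ← Complex.ofReal_mul, hcos, Real.mul_self_sqrt (by positivity)]
    congr 2
    field_simp
  have e2 : (Real.sin θ : ℂ) • ∑ j : QReg ns, (starRingEnd ℂ) (c j) •
      act (O.evol.1 ^ (2 ^ ns - (j : ℕ))) (((Real.sin θ : ℂ) * c j / (‖b j‖ : ℝ)) • b j) =
      (((Ce np R * S)⁻¹ : ℝ) : ℂ) • ∑ j : QReg ns, ((T / 2 ^ ns : ℝ) : ℂ) •
        act (O.evol.1 ^ (2 ^ ns - (j : ℕ))) (b j) := by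
    rw [Finset.smul_sum, Finset.smul_sum]
    refine Finset.sum_congr rfl fun j _ => ?_
    by_cases hj : b j = 0
    · rw [hj, smul_zero]
      simp [act]
    · rw [act_smul, smul_smul, smul_smul, smul_smul, ← Complex.ofReal_mul, mul_assoc, hweight j hj]
  rw [e1, e2, ← smul_add]
  change restrictPosL _ np R (act _ (_ • lcuSum O.evol.1 f u₀ R T ns)) = _
  rw [act_smul, map_smul]
  rfl

end Encode


/-! ### The algorithm -/

section Algorithm

variable {d nx np : ℕ}

/-- Amplitude amplification with `m` rounds of the circuit for the linear combination of unitaries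
with the rotation angle `θ`. -/
def lcuAlgorithm (d nx np ns m : ℕ) (θ R : ℝ) : Algorithm d nx np where
  nw := 2
  ns := ns
  steps := amplify (fun w => decide (w = 2)) (lcuSteps d nx np ns θ R) m
  flag := fun w => decide (w = 2)

lemma countP_evolSteps_isEvol (ns : ℕ) :
    (evolSteps d nx np ns).countP Step.isEvol = 2 ^ ns := by
  rw [evolSteps, List.countP_map, List.countP_eq_length.2, List.length_range]
  intro _ _
  rfl

lemma countP_evolSteps_eq_zero {ns : ℕ} {p : Step d nx np 2 ns → Bool}
    (hp : ∀ i c, p (.evol i c) = false) : (evolSteps d nx np ns).countP p = 0 := by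
  rw [evolSteps, List.countP_map, List.countP_eq_zero]
  intro r _
  simp [hp]

lemma countP_lcuAlgorithm {p : ∀ {nw ns : ℕ}, Step d nx np nw ns → Bool} {ns : ℕ}
    (hp : ∀ s : Step d nx np 2 ns, p s.inv = p s) (hg : ∀ G, p (.gate G : Step d nx np 2 ns) = false)
    (m : ℕ) (θ R : ℝ) :
    (lcuAlgorithm d nx np ns m θ R).steps.countP p =
      (2 * m + 1) * ((loadSteps d nx np ns θ).countP p + ((evolSteps d nx np ns).countP p +
        (mergeSteps d nx np ns θ R).countP p)) := by
  refine (countP_amplify p hp hg _ _ m).trans ?_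
  rw [lcuSteps, List.countP_append, List.countP_append]

lemma evolQueries_lcuAlgorithm (ns m : ℕ) (θ R : ℝ) :
    (lcuAlgorithm d nx np ns m θ R).evolQueries = (2 * m + 1) * 2 ^ ns := by
  have h1 : (loadSteps d nx np ns θ).countP Step.isEvol = 0 := rfl
  have h2 : (mergeSteps d nx np ns θ R).countP Step.isEvol = 0 := rfl
  rw [Algorithm.evolQueries, countP_lcuAlgorithm (p := Step.isEvol) (by intro s; cases s <;> rfl)
    (fun _ => rfl), h1, h2, countP_evolSteps_isEvol]
  ring

lemma prepQueries_lcuAlgorithm (ns m : ℕ) (θ R : ℝ) :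
    (lcuAlgorithm d nx np ns m θ R).prepQueries = 2 * m + 1 := by
  have h1 : (loadSteps d nx np ns θ).countP Step.isPrep = 1 := rfl
  have h2 : (mergeSteps d nx np ns θ R).countP Step.isPrep = 0 := rfl
  rw [Algorithm.prepQueries, countP_lcuAlgorithm (p := Step.isPrep) (by intro s; cases s <;> rfl)
    (fun _ => rfl), h1, h2, countP_evolSteps_eq_zero (p := Step.isPrep) (fun _ _ => rfl)]
  ring

lemma sourceQueries_lcuAlgorithm (ns m : ℕ) (θ R : ℝ) :
    (lcuAlgorithm d nx np ns m θ R).sourceQueries = 2 * m + 1 := by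
  have h1 : (loadSteps d nx np ns θ).countP Step.isSource = 1 := rfl
  have h2 : (mergeSteps d nx np ns θ R).countP Step.isSource = 0 := rfl
  rw [Algorithm.sourceQueries, countP_lcuAlgorithm (p := Step.isSource) (by intro s; cases s <;> rfl)
    (fun _ => rfl), h1, h2, countP_evolSteps_eq_zero (p := Step.isSource) (fun _ _ => rfl)]
  ring

lemma coefQueries_lcuAlgorithm (ns m : ℕ) (θ R : ℝ) :
    (lcuAlgorithm d nx np ns m θ R).coefQueries = (2 * m + 1) * 2 := by
  have h1 : (loadSteps d nx np ns θ).countP Step.isCoef = 1 := rfl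
  have h2 : (mergeSteps d nx np ns θ R).countP Step.isCoef = 1 := rfl
  rw [Algorithm.coefQueries, countP_lcuAlgorithm (p := Step.isCoef) (by intro s; cases s <;> rfl)
    (fun _ => rfl), h1, h2, countP_evolSteps_eq_zero (p := Step.isCoef) (fun _ _ => rfl)]

lemma successState_lcuAlgorithm (ns m : ℕ) (θ R : ℝ) (O : Oracles d nx np ns) :
    (lcuAlgorithm d nx np ns m θ R).successState O =
      flagPart (fun w => decide (w = 2)) (act (listMatrix O
        (amplify (fun w => decide (w = 2)) (lcuSteps d nx np ns θ R) m)) (ket 0)) := by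
  rw [← foldl_act]
  rfl

lemma lcuAlgorithm_prepares_of {ns m : ℕ} {θ R δ p₀ : ℝ} {O : Oracles d nx np ns}
    {v : EuclideanSpace ℂ (XReg d nx)} {ψ : EuclideanSpace ℂ (Mem d nx np 2 ns)}
    (hψ : flagPart (fun w => decide (w = 2)) (act (listMatrix O
      (amplify (fun w => decide (w = 2)) (lcuSteps d nx np ns θ R) m)) (ket 0)) = ψ)
    (hp : p₀ ≤ ‖ψ‖ ^ 2) (g : EuclideanSpace ℂ (QReg 2 × QReg ns × QReg np)) (hg : ‖g‖ = 1)
    (h : ‖((‖ψ‖⁻¹ : ℝ) : ℂ) • ψ - Algorithm.withSpace (((‖v‖⁻¹ : ℝ) : ℂ) • v) g‖ ≤ δ) :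
    (lcuAlgorithm d nx np ns m θ R).Prepares O v δ p₀ := by
  rw [← successState_lcuAlgorithm] at hψ
  subst hψ
  exact ⟨hp, g, hg, h⟩

/-- Normalisation at most doubles relative errors. -/
lemma norm_normalize_sub_le {E : Type*} [NormedAddCommGroup E] [NormedSpace ℂ E] {x y : E}
    (hx : x ≠ 0) (hy : y ≠ 0) :
    ‖((‖x‖⁻¹ : ℝ) : ℂ) • x - ((‖y‖⁻¹ : ℝ) : ℂ) • y‖ ≤ 2 * ‖x - y‖ / ‖y‖ := by
  have hx' : 0 < ‖x‖ := norm_pos_iff.2 hx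
  have hy' : 0 < ‖y‖ := norm_pos_iff.2 hy
  have e : ((‖x‖⁻¹ : ℝ) : ℂ) • x - ((‖y‖⁻¹ : ℝ) : ℂ) • y =
      ((‖x‖⁻¹ - ‖y‖⁻¹ : ℝ) : ℂ) • x + ((‖y‖⁻¹ : ℝ) : ℂ) • (x - y) := by
    rw [Complex.ofReal_sub, sub_smul, smul_sub]; abel
  have h1 : |‖x‖⁻¹ - ‖y‖⁻¹| * ‖x‖ ≤ ‖x - y‖ / ‖y‖ := by
    have e2 : ‖x‖⁻¹ - ‖y‖⁻¹ = (‖y‖ - ‖x‖) / (‖x‖ * ‖y‖) := by field_simp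
    rw [e2, abs_div, abs_of_pos (mul_pos hx' hy'), div_mul_eq_mul_div, ← div_div,
      mul_div_assoc, div_self hx'.ne', mul_one]
    · gcongr
      rw [norm_sub_rev]
      exact abs_norm_sub_norm_le y x
  rw [e]
  refine (norm_add_le _ _).trans ?_
  rw [norm_smul, norm_smul, Complex.norm_real, Complex.norm_real, Real.norm_eq_abs,
    Real.norm_of_nonneg (inv_nonneg.2 hy'.le), inv_mul_eq_div, two_mul, add_div]
  exact add_le_add_left h1 _

lemma withSpace_tens {nw ns : ℕ} (v : EuclideanSpace ℂ (XReg d nx))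
    (a : EuclideanSpace ℂ (QReg nw)) (b : EuclideanSpace ℂ (QReg ns))
    (q : EuclideanSpace ℂ (QReg np)) :
    Algorithm.withSpace v (tens a (tens b q)) = tens a (tens b (tens v q)) := by
  ext i
  simp only [Algorithm.withSpace, tens]
  ring

lemma norm_ket {n : Type} [Fintype n] [DecidableEq n] (i : n) :
    ‖(ket i : EuclideanSpace ℂ n)‖ = 1 := by simp [ket]

/-- If the linear combination of unitaries is accurate, then the amplified algorithm succeeds. -/
lemma lcuAlgorithm_prepares {ns : ℕ} {A : Matrix (XReg d nx) (XReg d nx) ℂ}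
    {f : ℝ → EuclideanSpace ℂ (XReg d nx)} {u₀ uT : EuclideanSpace ℂ (XReg d nx)}
    {R T δ Cheat B : ℝ} (hR : 0 < R) (hnp : 1 ≤ np) (hT : 0 < T) (hδ1 : δ ≤ 1)
    (hS : 0 < ‖u₀‖ + fAvg f T ns) (huT : uT ≠ 0) (hB : 0 < B)
    (hBe : Ce np R * (‖u₀‖ + fAvg f T ns) = B * (Ce0 np R * ‖uT‖))
    (O : Oracles d nx np ns) (hO : O.Encode A f u₀ R T Cheat)
    (herr : ‖restrictPos np R (act (fourierX (XReg d nx) np R) (lcuSum O.evol.1 f u₀ R T ns)) -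
      restrictPos np R (tens uT (expVec np R))‖ ≤ 3 / 8 * δ * (Ce0 np R * ‖uT‖)) :
    (lcuAlgorithm d nx np ns ⌊B / 8⌋₊ (lcuAngle ‖u₀‖ (fAvg f T ns)) R).Prepares O uT δ
      (1 / 1000) := by
  set x := restrictPos np R (act (fourierX (XReg d nx) np R) (lcuSum O.evol.1 f u₀ R T ns))
  set y := restrictPos np R (tens uT (expVec np R)) with hy
  set θ := lcuAngle ‖u₀‖ (fAvg f T ns)
  set m := ⌊B / 8⌋₊
  have hC0 : 0 < Ce0 np R := lt_of_lt_of_le one_pos (one_le_Ce0 hnp)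
  have huT' : 0 < ‖uT‖ := norm_pos_iff.2 huT
  have hyn : ‖y‖ = Ce0 np R * ‖uT‖ := by
    rw [hy, restrictPos_tens, norm_tens, norm_posPart_expVec, mul_comm]
  have hy0 : 0 < ‖y‖ := by rw [hyn]; positivity
  rw [← hyn] at herr hBe
  have hxy := abs_le.1 (abs_norm_sub_norm_le x y)
  have hδy : δ * ‖y‖ ≤ 1 * ‖y‖ := mul_le_mul_of_nonneg_right hδ1 hy0.le
  -- `δ ≤ 1` makes the error at most `3/8` of `‖y‖`.
  have hx1 : 5 / 8 * ‖y‖ ≤ ‖x‖ := by linarith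
  have hx2 : ‖x‖ ≤ 11 / 8 * ‖y‖ := by linarith
  have hx0 : 0 < ‖x‖ := by linarith
  set g := flagPart (fun w => decide (w = 2)) (act (listMatrix O (lcuSteps d nx np ns θ R)) (ket 0))
    with hg
  have hg' : g = (((B * ‖y‖)⁻¹ : ℝ) : ℂ) • tens (ket 2) (tens (ket 0) x) := by
    rw [hg, flagPart_lcuSteps_of_encode hR hnp hT hS O hO, hBe]
  have hBy : 0 < B * ‖y‖ := mul_pos hB hy0
  have hgn : ‖g‖ = ‖x‖ / (B * ‖y‖) := by
    rw [hg', norm_smul, norm_tens, norm_tens, norm_ket, norm_ket, Complex.norm_real,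
      Real.norm_of_nonneg (inv_nonneg.2 hBy.le), one_mul, one_mul, inv_mul_eq_div]
  have hg1 : ‖g‖ ≤ 1 := norm_flagPart_le_one O _ _
  have hg5 : 5 / 8 ≤ B * ‖g‖ := by
    rw [hgn]
    have : B * (‖x‖ / (B * ‖y‖)) = ‖x‖ / ‖y‖ := by field_simp
    rw [this, le_div_iff₀ hy0]
    exact hx1
  have hg11 : B * ‖g‖ ≤ 11 / 8 := by
    rw [hgn]
    have : B * (‖x‖ / (B * ‖y‖)) = ‖x‖ / ‖y‖ := by field_simp
    rw [this, div_le_iff₀ hy0]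
    exact hx2
  have hmB : (m : ℝ) ≤ B / 8 := Nat.floor_le (by positivity)
  have hBm : B / 8 < m + 1 := Nat.lt_floor_add_one _
  -- No overshooting: for `m ≥ 1`, `2m + 1 ≤ 3m ≤ 3B/8`, and `B ‖g‖ ≤ 11/8`; for `m = 0` the
  -- amplitude is at most `1` anyway.
  have hm1 : (2 * (m : ℝ) + 1) * ‖g‖ ≤ 1 := by
    by_cases h8 : m = 0
    · rw [h8]; simpa using hg1
    · have h1 : (1 : ℝ) ≤ m := by exact_mod_cast Nat.one_le_iff_ne_zero.2 h8
      have h2 := mul_le_mul_of_nonneg_right (show 2 * (m : ℝ) + 1 ≤ 3 / 8 * B by linarith)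
        (norm_nonneg g)
      linarith
  have hamp := le_ampCoeff_mul (norm_nonneg g) hg1 m hm1
  have hm0 : (0 : ℝ) ≤ m := Nat.cast_nonneg m
  -- `2m + 1 ≥ B/8` and `B ‖g‖ ≥ 5/8` give `5/64`, and the sine bound costs the factor `2/π ≥ 1/2`.
  -- The square of `5/128` exceeds `1/1000`.
  have hlow : 5 / 128 ≤ (ampCoeff ‖g‖ m).1 * ‖g‖ := by
    refine le_trans ?_ hamp
    have h1 : 5 / 64 ≤ (2 * (m : ℝ) + 1) * ‖g‖ := by
      have := mul_le_mul_of_nonneg_right (show B / 8 ≤ 2 * (m : ℝ) + 1 by linarith) (norm_nonneg g)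
      linarith
    have h2 : 1 / 2 ≤ 2 / Real.pi := by
      rw [div_le_div_iff₀ two_pos Real.pi_pos]
      linarith [Real.pi_le_four]
    calc (5 / 128 : ℝ) = 1 / 2 * (5 / 64) := by norm_num
      _ ≤ _ := mul_le_mul h2 h1 (by norm_num) (by positivity)
  have hg0 : 0 < ‖g‖ := by rw [hgn]; positivity
  have ha : 0 < (ampCoeff ‖g‖ m).1 := pos_of_mul_pos_left (lt_of_lt_of_le (by norm_num) hlow) hg0.le
  refine lcuAlgorithm_prepares_of (flagPart_amplify O _ _ m) ?_
    (tens (ket 2) (tens (ket 0) (((Ce0 np R)⁻¹ : ℝ) • posPart np R (expVec np R)))) ?_ ?_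
  · rw [← hg, norm_smul, Complex.norm_real, Real.norm_of_nonneg ha.le]
    exact le_trans (by norm_num) (pow_le_pow_left₀ (by norm_num) hlow 2)
  · rw [norm_tens, norm_tens, norm_ket, norm_ket, norm_smul, norm_posPart_expVec, Real.norm_of_nonneg
      (inv_nonneg.2 hC0.le), inv_mul_cancel₀ hC0.ne']
    norm_num
  · have e1 : ((‖((ampCoeff ‖g‖ m).1 : ℂ) • g‖⁻¹ : ℝ) : ℂ) • ((ampCoeff ‖g‖ m).1 : ℂ) • g =
        tens (ket 2) (tens (ket 0) (((‖x‖⁻¹ : ℝ) : ℂ) • x)) := by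
      rw [norm_smul, Complex.norm_real, Real.norm_of_nonneg ha.le, smul_smul, ← Complex.ofReal_mul,
        mul_inv, mul_comm, mul_inv_cancel_left₀ ha.ne', hgn, hg', smul_smul, tens_smul_right,
        tens_smul_right, ← Complex.ofReal_mul]
      congr 2
      field_simp
    rw [← hg, e1, withSpace_tens, ← tens_sub_right, ← tens_sub_right, norm_tens, norm_tens, norm_ket,
      norm_ket, one_mul, one_mul, ← Complex.coe_smul (Ce0 np R)⁻¹, tens_smul_left, tens_smul_right _ uT,
      smul_smul, ← Complex.ofReal_mul, ← mul_inv, mul_comm ‖uT‖, ← hyn, ← restrictPos_tens]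
    -- Normalisation doubles the relative error `3δ/8`, which leaves `3δ/4 ≤ δ`.
    refine (norm_normalize_sub_le (norm_pos_iff.1 hx0) (norm_pos_iff.1 hy0)).trans ?_
    rw [div_le_iff₀ hy0]
    linarith

end Algorithm


/-! ### The choice of the parameters -/

section Parameters

/-- Rounding up to an integer and then to a power of two each costs at most a factor `2`, because `x
≥ 1`. -/
lemma pow_clog_ceil_bounds {x : ℝ} (hx : 1 ≤ x) :
    x ≤ 2 ^ Nat.clog 2 ⌈x⌉₊ ∧ (2 : ℝ) ^ Nat.clog 2 ⌈x⌉₊ ≤ 4 * x := by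
  have hceil : (⌈x⌉₊ : ℝ) < x + 1 := Nat.ceil_lt_add_one (by linarith)
  constructor
  · have h : ((⌈x⌉₊ : ℕ) : ℝ) ≤ ((2 ^ Nat.clog 2 ⌈x⌉₊ : ℕ) : ℝ) :=
      Nat.cast_le.2 (Nat.le_pow_clog one_lt_two _)
    push_cast at h
    exact (Nat.le_ceil x).trans h
  · by_cases h1 : ⌈x⌉₊ ≤ 1
    · rw [Nat.clog_of_right_le_one h1]
      norm_num
      linarith
    · have h2 : 1 < ⌈x⌉₊ := not_le.1 h1
      have h3 : ((2 ^ (Nat.clog 2 ⌈x⌉₊ - 1) : ℕ) : ℝ) < ((⌈x⌉₊ : ℕ) : ℝ) :=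
        Nat.cast_lt.2 (Nat.pow_pred_clog_lt_self one_lt_two h2)
      have h4 : 0 < Nat.clog 2 ⌈x⌉₊ := Nat.clog_pos one_lt_two h2
      have h5 : (2 : ℝ) ^ Nat.clog 2 ⌈x⌉₊ = 2 * 2 ^ (Nat.clog 2 ⌈x⌉₊ - 1) := by
        rw [← pow_succ']
        congr 1
        omega
      push_cast at h3
      rw [h5]
      linarith

variable {d nx : ℕ} (np : ℕ)

/-- `max {1, C_LCU T² / δ}`. -/
def lcuMax (x : Inputs) : ℝ := max 1 ((x.Cheat + x.sup) * x.T ^ 2 / x.δ)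

/-- The ratio `C_e (‖u(0)‖ + ‖f‖_avg) / (C_{e0} ‖u(T)‖)`, for a time register of `ns` qubits. -/
def lcuRatio (x : Inputs) (ns : ℕ) : ℝ :=
  Ce np x.R * (x.normInit + x.avg ns) / (Ce0 np x.R * x.normFinal)

/-- A size of the time register for which `‖f‖_avg` is close to the integral of `‖f‖`. -/
def coarseTime (x : Inputs) : ℕ := Nat.clog 2 ⌈2 * lcuMax x⌉₊

/-- The size of the time register. -/
def lcuTime (x : Inputs) : ℕ :=
  Nat.clog 2 ⌈400 * lcuRatio np x (coarseTime x) ^ 2 * Ce0 np x.R * lcuMax x⌉₊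

/-- The algorithm for given inputs. -/
def lcuAlg (d nx : ℕ) (x : Inputs) : Algorithm d nx np :=
  lcuAlgorithm d nx np (lcuTime np x) ⌊lcuRatio np x (lcuTime np x) / 8⌋₊
    (lcuAngle x.normInit (x.avg (lcuTime np x))) x.R

variable {np} {A : Matrix (XReg d nx) (XReg d nx) ℂ} {f u : ℝ → EuclideanSpace ℂ (XReg d nx)}
  {R T δ Cheat : ℝ}

/-- Resolution makes the exact vector on `p ≥ 0` nearly as large as `C_{e0} ‖u(T)‖`, while unitarity
bounds it by the data. Hence the ratio `B` cannot be small, which is used for the accuracy and for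
all query counts. -/
lemma Ce0_mul_norm_le_of_resolved (hA : A.IsHermitian) (hR : 0 < R) (hnp : 1 ≤ np) (hT : 0 < T)
    (hδ1 : δ ≤ 1) (hf : ContinuousOn f (Set.Icc 0 T)) (hres : Resolved A f u np R T (δ / 4)) :
    3 / 4 * (Ce0 np R * ‖u T‖) ≤ Ce np R * (‖u 0‖ + ∫ s in (0 : ℝ)..T, ‖f s‖) := by
  have hC0 : 0 ≤ Ce0 np R := zero_le_one.trans (one_le_Ce0 hnp)
  have h1 := norm_wTilde_le (u₀ := u 0) hA hR hnp hT hf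
  rw [← norm_act_of_mem_unitary (fourierX_mem_unitary hR hnp)] at h1
  have h2 := (norm_restrictPos_le (R := R) _).trans h1
  have h3 : ‖restrictPos np R (tens (u T) (expVec np R))‖ = Ce0 np R * ‖u T‖ := by
    rw [restrictPos_tens, norm_tens, norm_posPart_expVec, mul_comm]
  have h4 := norm_sub_norm_le (restrictPos np R (tens (u T) (expVec np R)))
    (restrictPos np R (act (fourierX (XReg d nx) np R) (wTilde A f (u 0) np R T)))
  rw [norm_sub_rev, h3] at h4
  have h5 : δ / 4 * (Ce0 np R * ‖u T‖) ≤ 1 / 4 * (Ce0 np R * ‖u T‖) :=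
    mul_le_mul_of_nonneg_right (by linarith) (by positivity)
  have h6 := hres
  unfold Resolved at h6
  linarith

/-- With sufficiently many nodes, `‖f‖_avg` can be replaced by the integral of `‖f‖`. -/
lemma lcu_weight_bounds (hR : 0 < R) (hT : 0 < T) (hδ : 0 < δ) (hδ1 : δ ≤ 1) (hC : 0 ≤ Cheat)
    (hf : ContDiffOn ℝ 1 f (Set.Icc 0 T)) (hI : 1 ≤ ‖u 0‖ + ∫ t in (0 : ℝ)..T, ‖f t‖) {n : ℕ}
    (hn : 2 * lcuMax (inputs A f u np R T δ Cheat) ≤ 2 ^ n) :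
    (‖u 0‖ + ∫ t in (0 : ℝ)..T, ‖f t‖) / 2 ≤ ‖u 0‖ + fAvg f T n ∧
      ‖u 0‖ + fAvg f T n ≤ 3 / 2 * (‖u 0‖ + ∫ t in (0 : ℝ)..T, ‖f t‖) := by
  have h := abs_le.1 (abs_integral_norm_sub_fAvg_le A np hT hR hf n)
  have hM : (Cheat + supTerm A f np R T) * T ^ 2 / δ ≤ lcuMax (inputs A f u np R T δ Cheat) :=
    le_max_right _ _
  rw [div_le_iff₀ hδ] at hM
  have hM1 : 1 ≤ lcuMax (inputs A f u np R T δ Cheat) := le_max_left _ _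
  -- The Riemann error is at most `1/2`, hence at most half of the data norm, which is assumed to be
  -- at least `1`.
  have h2 : supTerm A f np R T * T ^ 2 / 2 ^ n ≤ 1 / 2 := by
    rw [div_le_iff₀ (by positivity)]
    have h3 : lcuMax (inputs A f u np R T δ Cheat) * δ ≤
        lcuMax (inputs A f u np R T δ Cheat) * 1 :=
      mul_le_mul_of_nonneg_left hδ1 (by linarith)
    have h4 : 0 ≤ Cheat * T ^ 2 := by positivity
    linarith
  constructor <;> linarith

/-- The bounds on the parameters that give the accuracy and the query counts. -/
lemma lcu_parameter_bounds (hA : A.IsHermitian) (hR : 0 < R) (hnp : 1 ≤ np) (hT : 0 < T)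
    (hδ : 0 < δ) (hδ1 : δ ≤ 1) (hC : 0 ≤ Cheat) (hf : ContDiffOn ℝ 1 f (Set.Icc 0 T))
    (huT : u T ≠ 0) (hI : 1 ≤ ‖u 0‖ + ∫ t in (0 : ℝ)..T, ‖f t‖)
    (hres : Resolved A f u np R T (δ / 4)) :
    let x := inputs A f u np R T δ Cheat
    let B := lcuRatio np x (lcuTime np x)
    let N := B ^ 2 * Ce0 np R * lcuMax x
    3 / 8 ≤ B ∧ 1 / 2 ≤ ‖u 0‖ + fAvg f T (lcuTime np x) ∧ 400 / 9 * N ≤ 2 ^ lcuTime np x ∧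
      2 ^ lcuTime np x ≤ 14400 * N := by
  intro x B N
  set I := ‖u 0‖ + ∫ t in (0 : ℝ)..T, ‖f t‖ with hIdef
  have hM1 : 1 ≤ lcuMax x := le_max_left _ _
  have hC0 : 1 ≤ Ce0 np R := one_le_Ce0 hnp
  have hCe : 0 ≤ Ce np R := Real.sqrt_nonneg _
  have huT' : 0 < ‖u T‖ := norm_pos_iff.2 huT
  have hres' := Ce0_mul_norm_le_of_resolved hA hR hnp hT hδ1 hf.continuousOn hres
  set y := Ce0 np R * ‖u T‖ with hy
  have hy0 : 0 < y := by positivity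
  set Q := Ce np R * I / y with hQ
  have hQ34 : 3 / 4 ≤ Q := by rw [hQ, le_div_iff₀ hy0]; exact hres'
  have hratio : ∀ n, 2 * lcuMax x ≤ 2 ^ n → Q / 2 ≤ lcuRatio np x n ∧ lcuRatio np x n ≤ 3 / 2 * Q := by
    intro n hn
    obtain ⟨h1, h2⟩ := lcu_weight_bounds hR hT hδ hδ1 hC hf hI hn
    have e : lcuRatio np x n = Ce np R * (‖u 0‖ + fAvg f T n) / y := rfl
    rw [e, hQ]
    constructor
    · rw [div_div, mul_comm y, ← div_div]
      refine div_le_div_of_nonneg_right ?_ hy0.le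
      rw [mul_div_assoc]
      exact mul_le_mul_of_nonneg_left h1 hCe
    · rw [← mul_div_assoc]
      refine div_le_div_of_nonneg_right ?_ hy0.le
      rw [mul_left_comm]
      exact mul_le_mul_of_nonneg_left h2 hCe
  -- The coarse ratio `B₁` and the final ratio `B` both lie in `[Q/2, 3Q/2]`, so each is at most
  -- three times the other.
  obtain ⟨hB1l, hB1u⟩ := hratio (coarseTime x) (pow_clog_ceil_bounds (by linarith)).1
  set B₁ := lcuRatio np x (coarseTime x) with hB1
  have hB138 : 3 / 8 ≤ B₁ := by linarith
  have hCM : 1 ≤ Ce0 np R * lcuMax x := one_le_mul_of_one_le_of_one_le hC0 hM1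
  have hCM' : lcuMax x ≤ Ce0 np R * lcuMax x := le_mul_of_one_le_left (by linarith) hC0
  have hB1sq : (3 / 8 : ℝ) ^ 2 ≤ B₁ ^ 2 := pow_le_pow_left₀ (by norm_num) hB138 2
  -- Since `400 · (3/8)² ≥ 2`, the final time grid is fine enough for `hratio` as well.
  have hX2 : 2 * lcuMax x ≤ 400 * B₁ ^ 2 * Ce0 np R * lcuMax x := by
    have := mul_le_mul_of_nonneg_right hB1sq (show 0 ≤ Ce0 np R * lcuMax x by linarith)
    linarith
  obtain ⟨hKl, hKu⟩ := pow_clog_ceil_bounds (show 1 ≤ 400 * B₁ ^ 2 * Ce0 np R * lcuMax x by linarith)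
  have hK : lcuTime np x = Nat.clog 2 ⌈400 * B₁ ^ 2 * Ce0 np R * lcuMax x⌉₊ := rfl
  rw [← hK] at hKl hKu
  have hn := hX2.trans hKl
  obtain ⟨hBl, hBu⟩ := hratio _ hn
  have hB38 : 3 / 8 ≤ B := by linarith
  refine ⟨hB38, ?_, ?_, ?_⟩
  · have := (lcu_weight_bounds hR hT hδ hδ1 hC hf hI hn).1
    linarith
  -- Replacing `B₁` by `B` costs a factor `9` in each direction; with the rounding factor `4` this
  -- gives `400/9` and `4 · 400 · 9 = 14400`.
  · have h1 : B ^ 2 ≤ (3 * B₁) ^ 2 := pow_le_pow_left₀ (by linarith) (by linarith) 2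
    have h2 := mul_le_mul_of_nonneg_right h1 (show 0 ≤ Ce0 np R * lcuMax x by linarith)
    have e : N = B ^ 2 * (Ce0 np R * lcuMax x) := mul_assoc _ _ _
    rw [e]
    linarith
  · have h1 : B₁ ^ 2 ≤ (3 * B) ^ 2 := pow_le_pow_left₀ (by linarith) (by linarith) 2
    have h2 := mul_le_mul_of_nonneg_right h1 (show 0 ≤ Ce0 np R * lcuMax x by linarith)
    have e : N = B ^ 2 * (Ce0 np R * lcuMax x) := mul_assoc _ _ _
    rw [e]
    linarith

/-- `S ≥ 1/2` allows to factor `2S` out of `s + C_heat S`; then `e S = B y` expresses the error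
through `B M / K`, which is at most `1/16`. -/
lemma lcu_error_bound {e S B M K y s : ℝ} (he : 0 ≤ e) (hS : 1 / 2 ≤ S) (hs : 0 ≤ s)
    (hC : 0 ≤ Cheat) (hK : 0 < K) (hB : 0 ≤ B) (hy : 0 ≤ y) (heS : e * S = B * y)
    (hM : (Cheat + s) * T ^ 2 ≤ M * δ) (hδ : 0 ≤ δ) (hBM : 16 * (B * M) ≤ K) :
    e * (T ^ 2 / K) * (s + Cheat * S) ≤ 1 / 8 * δ * y := by
  have h1 : s + Cheat * S ≤ 2 * S * (Cheat + s) := by nlinarith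
  have h2 : e * (T ^ 2 / K) * (s + Cheat * S) ≤ e * (T ^ 2 / K) * (2 * S * (Cheat + s)) :=
    mul_le_mul_of_nonneg_left h1 (by positivity)
  have h3 : e * (T ^ 2 / K) * (2 * S * (Cheat + s)) =
      2 * (B * y) * ((Cheat + s) * T ^ 2) / K := by
    rw [← heS]; ring
  rw [h3] at h2
  refine h2.trans ?_
  rw [div_le_iff₀ hK]
  have h4 : 2 * (B * y) * ((Cheat + s) * T ^ 2) ≤ 2 * (B * y) * (M * δ) :=
    mul_le_mul_of_nonneg_left hM (by positivity)
  have h5 := mul_le_mul_of_nonneg_left hBM (show 0 ≤ δ * y by positivity)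
  linarith

/-- The linear combination of unitaries recovers the solution up to `3 δ / 8`. -/
lemma norm_restrictPos_lcuSum_sub_le {ns : ℕ} {B M : ℝ} (hA : A.IsHermitian) (hR : 0 < R)
    (hnp : 1 ≤ np) (hT : 0 < T) (hδ : 0 < δ) (hC : 0 ≤ Cheat)
    (hf : ContDiffOn ℝ 1 f (Set.Icc 0 T)) (hS : 1 / 2 ≤ ‖u 0‖ + fAvg f T ns) (hB : 0 ≤ B)
    (hBe : Ce np R * (‖u 0‖ + fAvg f T ns) = B * (Ce0 np R * ‖u T‖))
    (hM : (Cheat + supTerm A f np R T) * T ^ 2 ≤ M * δ) (hBM : 16 * (B * M) ≤ 2 ^ ns)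
    (hres : Resolved A f u np R T (δ / 4)) {V : Matrix (XReg d nx × QReg np) (XReg d nx × QReg np) ℂ}
    (hV : V ∈ Matrix.unitaryGroup (XReg d nx × QReg np) ℂ)
    (hVe : ApproxEvol A np R Cheat (T / 2 ^ ns) V) :
    ‖restrictPos np R (act (fourierX (XReg d nx) np R) (lcuSum V f (u 0) R T ns)) -
      restrictPos np R (tens (u T) (expVec np R))‖ ≤ 3 / 8 * δ * (Ce0 np R * ‖u T‖) := by
  have hC0 : 1 ≤ Ce0 np R := one_le_Ce0 hnp
  have herr := (norm_wTilde_sub_lcuSum_le (u₀ := u 0) (ns := ns) hA hR hnp hT hf hV hVe).trans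
    (lcu_error_bound (Real.sqrt_nonneg _) hS (supTerm_nonneg hT hR hf) hC (by positivity) hB
      (show 0 ≤ Ce0 np R * ‖u T‖ by positivity) hBe hM hδ.le hBM)
  set w := wTilde A f (u 0) np R T
  set z := lcuSum V f (u 0) R T ns
  have h1 : ‖restrictPos np R (act (fourierX (XReg d nx) np R) z) -
      restrictPos np R (act (fourierX (XReg d nx) np R) w)‖ ≤ ‖w - z‖ := by
    rw [← restrictPos_sub, ← act_sub, norm_sub_rev w z]
    refine (norm_restrictPos_le _).trans_eq ?_
    exact norm_act_of_mem_unitary (fourierX_mem_unitary hR hnp) _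
  have h2 : ‖restrictPos np R (act (fourierX (XReg d nx) np R) w) -
      restrictPos np R (tens (u T) (expVec np R))‖ ≤ δ / 4 * (Ce0 np R * ‖u T‖) := hres
  refine (norm_sub_le_norm_sub_add_norm_sub _
    (restrictPos np R (act (fourierX (XReg d nx) np R) w)) _).trans ?_
  -- `δ/4` from the resolution of the mesh and `δ/8` from time discretisation and `O_H` add up to
  -- `3δ/8`.
  linarith

lemma lcuAlg_prepares (hA : A.IsHermitian) (hR : 0 < R) (hnp : 1 ≤ np) (hT : 0 < T)
    (hδ : 0 < δ) (hδ1 : δ ≤ 1) (hC : 0 ≤ Cheat) (hf : ContDiffOn ℝ 1 f (Set.Icc 0 T))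
    (huT : u T ≠ 0) (hI : 1 ≤ ‖u 0‖ + ∫ t in (0 : ℝ)..T, ‖f t‖)
    (hres : Resolved A f u np R T (δ / 4))
    (O : Oracles d nx np (lcuTime np (inputs A f u np R T δ Cheat)))
    (hO : O.Encode A f (u 0) R T Cheat) :
    (lcuAlg np d nx (inputs A f u np R T δ Cheat)).Prepares O (u T) δ (1 / 1000) := by
  obtain ⟨hB, hS, hKl, -⟩ := lcu_parameter_bounds hA hR hnp hT hδ hδ1 hC hf huT hI hres
  have hC0 : 1 ≤ Ce0 np R := one_le_Ce0 hnp
  have hy0 : 0 < Ce0 np R * ‖u T‖ := mul_pos (by linarith) (norm_pos_iff.2 huT)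
  have hM : (Cheat + supTerm A f np R T) * T ^ 2 / δ ≤ lcuMax (inputs A f u np R T δ Cheat) :=
    le_max_right _ _
  have hM1 : 1 ≤ lcuMax (inputs A f u np R T δ Cheat) := le_max_left _ _
  rw [div_le_iff₀ hδ] at hM
  unfold lcuAlg
  generalize hns : lcuTime np (inputs A f u np R T δ Cheat) = ns at *
  generalize lcuMax (inputs A f u np R T δ Cheat) = M at *
  have hBe : Ce np R * (‖u 0‖ + fAvg f T ns) =
      lcuRatio np (inputs A f u np R T δ Cheat) ns * (Ce0 np R * ‖u T‖) :=
    (div_mul_cancel₀ _ hy0.ne').symm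
  generalize lcuRatio np (inputs A f u np R T δ Cheat) ns = B at *
  -- From `C_{e0} ≥ 1` and `B ≥ 3/8`; the constant `400` was chosen so that `400/9 · 3/8 ≥ 16`.
  have hBM : 16 * (B * M) ≤ 2 ^ ns := by
    refine le_trans ?_ hKl
    have h1 : B * M ≤ B * (Ce0 np R * M) :=
      mul_le_mul_of_nonneg_left (le_mul_of_one_le_left (by linarith) hC0) (by linarith)
    have h0 : 0 ≤ B * M := mul_nonneg (by linarith) (by linarith)
    have h2 := mul_le_mul_of_nonneg_right hB (h0.trans h1)
    have e : B ^ 2 * Ce0 np R * M = B * (B * (Ce0 np R * M)) := by ring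
    rw [e]
    linarith
  exact lcuAlgorithm_prepares hR hnp hT hδ1 (by linarith) huT (by linarith) hBe O hO
    (norm_restrictPos_lcuSum_sub_le hA hR hnp hT hδ hC hf hS (by linarith) hBe hM hBM hres
      O.evol.2 hO.1)

/-- The rounds of amplitude amplification are proportional to the ratio. -/
lemma rounds_bounds {B : ℝ} (hB : 3 / 8 ≤ B) :
    B / 8 ≤ 2 * (⌊B / 8⌋₊ : ℝ) + 1 ∧ 2 * (⌊B / 8⌋₊ : ℝ) + 1 ≤ 3 * B := by
  have h1 : (⌊B / 8⌋₊ : ℝ) ≤ B / 8 := Nat.floor_le (by linarith)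
  have h2 : B / 8 < ⌊B / 8⌋₊ + 1 := Nat.lt_floor_add_one _
  have h3 : (0 : ℝ) ≤ ⌊B / 8⌋₊ := Nat.cast_nonneg _
  constructor <;> linarith

/-- `O_H` is queried `(2m + 1) K` times, with `2m + 1` of order `B` and `K` of order `B² C_{e0} M`;
the upper constant is `3 · 14400`. The other oracles are queried at most `2(2m + 1) ≤ 6B` times, and
`B ≤ (8/3) B²`. -/
lemma lcuAlg_counts (hA : A.IsHermitian) (hR : 0 < R) (hnp : 1 ≤ np) (hT : 0 < T)
    (hδ : 0 < δ) (hδ1 : δ ≤ 1) (hC : 0 ≤ Cheat) (hf : ContDiffOn ℝ 1 f (Set.Icc 0 T))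
    (huT : u T ≠ 0) (hI : 1 ≤ ‖u 0‖ + ∫ t in (0 : ℝ)..T, ‖f t‖)
    (hres : Resolved A f u np R T (δ / 4)) :
    let 𝒜 := lcuAlg np d nx (inputs A f u np R T δ Cheat)
    1 * evolBound A f u np R T δ Cheat 𝒜.ns ≤ 𝒜.evolQueries ∧
      𝒜.evolQueries ≤ 43200 * evolBound A f u np R T δ Cheat 𝒜.ns ∧
      𝒜.prepQueries ≤ 43200 * stateBound f u np R T 𝒜.ns ∧
      𝒜.sourceQueries ≤ 43200 * stateBound f u np R T 𝒜.ns ∧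
      𝒜.coefQueries ≤ 43200 * stateBound f u np R T 𝒜.ns := by
  intro 𝒜
  obtain ⟨hB, -, hKl, hKu⟩ := lcu_parameter_bounds hA hR hnp hT hδ hδ1 hC hf huT hI hres
  set x := inputs A f u np R T δ Cheat
  set ns := lcuTime np x with hns
  set B := lcuRatio np x ns with hBdef
  have hC0 : 1 ≤ Ce0 np R := one_le_Ce0 hnp
  have huT' : 0 < ‖u T‖ := norm_pos_iff.2 huT
  have hM1 : 1 ≤ lcuMax x := le_max_left _ _
  obtain ⟨hml, hmu⟩ := rounds_bounds hB
  set m := ⌊B / 8⌋₊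
  have hBe : B = Ce np R * (‖u 0‖ + fAvg f T ns) / (Ce0 np R * ‖u T‖) := rfl
  have hs : stateBound f u np R T 𝒜.ns = B ^ 2 := by
    change Ce np R ^ 2 / Ce0 np R ^ 2 * ((‖u 0‖ + fAvg f T ns) / ‖u T‖) ^ 2 = _
    rw [hBe]
    field_simp
  -- `C_e³ / C_{e0}²` is not `(C_e / C_{e0})³`: the surplus factor `C_{e0}` is the reason for the
  -- `C_{e0}` in the choice of `K`.
  have he : evolBound A f u np R T δ Cheat 𝒜.ns = B * (B ^ 2 * Ce0 np R * lcuMax x) := by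
    change Ce np R ^ 3 / Ce0 np R ^ 2 * ((‖u 0‖ + fAvg f T ns) / ‖u T‖) ^ 3 * lcuMax x = _
    rw [hBe]
    field_simp
  have hq : (𝒜.evolQueries : ℝ) = (2 * m + 1) * 2 ^ ns := by
    exact_mod_cast evolQueries_lcuAlgorithm (d := d) (nx := nx) (np := np) ns m _ _
  have hp : (𝒜.prepQueries : ℝ) = 2 * m + 1 := by
    exact_mod_cast prepQueries_lcuAlgorithm (d := d) (nx := nx) (np := np) ns m _ _
  have hso : (𝒜.sourceQueries : ℝ) = 2 * m + 1 := by
    exact_mod_cast sourceQueries_lcuAlgorithm (d := d) (nx := nx) (np := np) ns m _ _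
  have hco : (𝒜.coefQueries : ℝ) = (2 * m + 1) * 2 := by
    exact_mod_cast coefQueries_lcuAlgorithm (d := d) (nx := nx) (np := np) ns m _ _
  have hN : 0 ≤ B ^ 2 * Ce0 np R * lcuMax x := by positivity
  have hB0 : 0 ≤ B := by linarith
  have hBB : 3 / 8 * B ≤ B ^ 2 := by rw [sq]; exact mul_le_mul_of_nonneg_right hB hB0
  rw [hq, hp, hso, hco, hs, he]
  refine ⟨?_, ?_, ?_, ?_, ?_⟩
  · have h := mul_le_mul hml hKl (by positivity) (by positivity)
    have := mul_nonneg hB0 hN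
    linarith
  · have h := mul_le_mul hmu hKu (by positivity) (by positivity)
    linarith
  all_goals linarith

end Parameters

end HeatLCU

end

theorem mainTheorem1 :
    -- the algorithm
    (∃ c C p₀ : ℝ, 0 < c ∧ 0 < C ∧ 0 < p₀ ∧
      ∀ d nx np : ℕ, 1 ≤ np → ∃ alg : HeatLCU.Inputs → HeatLCU.Algorithm d nx np,
        ∀ (A : Matrix (HeatLCU.XReg d nx) (HeatLCU.XReg d nx) ℂ)
          (f u : ℝ → EuclideanSpace ℂ (HeatLCU.XReg d nx)) (R T δ Cheat : ℝ),
          (-A).PosSemidef → 0 < R → 0 < T → 0 < δ → δ ≤ 1 → 0 ≤ Cheat →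
          ContDiffOn ℝ 1 f (Set.Icc 0 T) → HeatLCU.SolvesODE A f T u → u T ≠ 0 →
          1 ≤ ‖u 0‖ + ∫ t in (0 : ℝ)..T, ‖f t‖ →
          HeatLCU.Resolved A f u np R T (δ / 4) →
          let 𝒜 := alg (HeatLCU.inputs A f u np R T δ Cheat)
          (∀ O : HeatLCU.Oracles d nx np 𝒜.ns, O.Encode A f (u 0) R T Cheat →
            𝒜.Prepares O (u T) δ p₀) ∧
          c * HeatLCU.evolBound A f u np R T δ Cheat 𝒜.ns ≤ 𝒜.evolQueries ∧
          𝒜.evolQueries ≤ C * HeatLCU.evolBound A f u np R T δ Cheat 𝒜.ns ∧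
          𝒜.prepQueries ≤ C * HeatLCU.stateBound f u np R T 𝒜.ns ∧
          𝒜.sourceQueries ≤ C * HeatLCU.stateBound f u np R T 𝒜.ns ∧
          𝒜.coefQueries ≤ C * HeatLCU.stateBound f u np R T 𝒜.ns) ∧
    -- every problem is resolved by all sufficiently large intervals and fine meshes in `p`
    (∀ (d nx : ℕ) (A : Matrix (HeatLCU.XReg d nx) (HeatLCU.XReg d nx) ℂ)
      (f u : ℝ → EuclideanSpace ℂ (HeatLCU.XReg d nx)) (T ε : ℝ),
      (-A).PosSemidef → 0 < T → 0 < ε →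
      ContDiffOn ℝ 1 f (Set.Icc 0 T) → HeatLCU.SolvesODE A f T u → u T ≠ 0 →
      ∃ R₀ : ℝ, 0 < R₀ ∧ ∀ R, R₀ ≤ R → ∃ n₀ : ℕ, ∀ np, n₀ ≤ np →
        HeatLCU.Resolved A f u np R T ε) ∧
    -- the discrete heat equation with its boundary terms and evolution circuit is an instance
    (∀ (d nx np : ℕ) (a Δx R : ℝ), 1 ≤ nx → 1 ≤ np → 0 < a → 0 < Δx → 0 < R →
      (-HeatLCU.heatMatrix d nx a Δx).PosSemidef ∧
      (∀ (T : ℝ) (U : ℝ → (Fin d → ℕ) → ℂ), HeatLCU.SolvesHeatScheme nx a Δx T U →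
        HeatLCU.SolvesODE (HeatLCU.heatMatrix d nx a Δx) (HeatLCU.boundarySource nx a Δx U) T
          (HeatLCU.interior nx U)) ∧
      ∀ s : ℝ, HeatLCU.Vheat d nx np a Δx R (-s) ∈
          Matrix.unitaryGroup (HeatLCU.XReg d nx × HeatLCU.QReg np) ℂ ∧
        HeatLCU.ApproxEvol (HeatLCU.heatMatrix d nx a Δx) np R
          (HeatLCU.cHeat d nx np a Δx R) s (HeatLCU.Vheat d nx np a Δx R (-s))) := by
  refine ⟨?_, fun d nx A f u T ε hA hT hε hf hu huT =>
      HeatLCU.exists_resolved hA hT hε hf.continuousOn hu huT,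
    fun d nx np a Δx R hnx hnp ha hΔ hR => ⟨HeatLCU.neg_heatMatrix_posSemidef d nx ha Δx,
      fun T U hU => HeatLCU.solvesODE_of_solvesHeatScheme hU,
      fun s => ⟨HeatLCU.Vheat_mem_unitary hnx a Δx R (-s),
        HeatLCU.approxEvol_Vheat hnx hnp hΔ hR s⟩⟩⟩
  refine ⟨1, 43200, 1 / 1000, by norm_num, by norm_num, by norm_num, fun d nx np hnp =>
    ⟨HeatLCU.lcuAlg np d nx, fun A f u R T δ Cheat hA hR hT hδ hδ1 hC hf _ huT hI hres => ?_⟩⟩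
  have hAH : A.IsHermitian := by simpa using hA.isHermitian.neg
  exact ⟨fun O hO => HeatLCU.lcuAlg_prepares hAH hR hnp hT hδ hδ1 hC hf huT hI hres O hO,
    HeatLCU.lcuAlg_counts hAH hR hnp hT hδ hδ1 hC hf huT hI hres⟩
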